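/- Let $\tau,\eta\in\mathbb C$ with $\operatorname{Im}\tau>0$, $\operatorname{Im}\eta>0$, and let $1,2\eta,\tau$ be linearly independent over $\mathbb Q$. Put $p=e^{2\pi i\tau}$, $q=e^{4\pi i\eta}$, $(p;p)_\infty=\prod_{j\ge1}(1-p^j)$, $R(\tau)=p^{-1/8}/(i\,(p;p)_\infty)$ with $p^{-1/8}=e^{-\pi i\tau/4}$, and $$\theta_1(z|\tau)=-\sum_{r\in\mathbb Z}e^{\pi i(r+\frac12)^2\tau+2\pi i(r+\frac12)(z+\frac12)},\quad \theta_3(z|\tau)=\sum_{r\in\mathbb Z}e^{\pi i r^2\tau+2\pi i rz},\quad \theta_4(z|\tau)=\theta_3(z+\tfrac12|\tau),$$ $$\Gamma(z)=\prod_{i,j\ge0}\frac{1-e^{-2\pi iz}p^{i+1}q^{j+1}}{1-e^{2\pi iz}p^iq^j}.$$ A test function is an entire function $\Phi$ with $\Phi(x+1)=\Phi(x)=\Phi(-x)$. For $\operatorname{Im}(-g\pm z)>0$ let $$[\mathrm M(g)\Phi](z)=\frac{(q;q)_\infty(p;p)_\infty}{2}\int_0^1\frac{\Gamma(z+x-g)\Gamma(z-x-g)\Gamma(-z+x-g)\Gamma(-z-x-g)}{\Gamma(-2g)\Gamma(2x)\Gamma(-2x)}\Phi(x)\,dx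 ,$$ and for other $g$ let $[\mathrm M(g)\Phi](z)$ be defined by analytic (meromorphic) continuation in $g$ at fixed $z$. Write $e^{a\partial_z}f(z)=f(z+a)$, $c_A=e^{\pi i\eta}/R(\tau)$, $c_B=e^{\pi i\tau/2}/R(2\eta)$ and, for $k\in\{3,4\}$, $$\mathrm A_k(g)=e^{\pi i z^2/\eta}\frac{c_A}{\theta_1(2z|\tau)}\Big[\theta_k(z+g+\eta|\tfrac\tau2)e^{\eta\partial_z}-\theta_k(z-g-\eta|\tfrac\tau2)e^{-\eta\partial_z}\Big]e^{-\pi i z^2/\eta},$$ $$\mathrm B_k(g)=e^{2\pi i z^2/\tau}\frac{c_B}{\theta_1(2z|2\eta)}\Big[\theta_k(z+g+\tfrac\tau2|\eta)e^{\frac\tau2\partial_z}-\theta_k(z-g-\tfrac\tau2|\eta)e^{-\frac\tau2\partial_z}\Big]e^{-2\pi i z^2/\tau},$$ $$\alpha^{(n)}_\ell(z)=c_A^n\,\frac{\prod_{j=1}^n\theta_1(2\eta j|\tau)}{\prod_{j=1}^{\ell}\theta_1(2\eta j|\tau)\prod_{j=1}^{n-\ell}\theta_1(2\eta j|\tau)}\cdot\frac{\theta_1(2z+2\eta(n-2\ell)|\tau)}{\prod_{j=0}^n\theta_1(2z-2\eta(\ell-j)|\tau)},$$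 and let $\beta^{(m)}_\ell(z)$ be obtained from $\alpha^{(m)}_\ell(z)$ by exchanging $\tau$ and $2\eta$ (and hence $c_A$ and $c_B$). Let $n,m\ge0$ be integers and $\Lambda=\mathbb Z+2\eta\mathbb Z+\tau\mathbb Z$. 1. For every test function $\Phi$ and every $z$ with $2z\notin\Lambda$, the continuations of $[\mathrm M(g)\Phi](z)$ to $g=n\eta$, $g=m\tau/2$ and $g=n\eta+m\tau/2$ exist and are finite, and $\mathrm M(n\eta)$, $\mathrm M(m\tau/2)$ act as the finite-difference operators $$\mathrm M(n\eta)=e^{\pi iz^2/\eta}\Big(\sum_{\ell=0}^n(-1)^\ell\alpha^{(n)}_\ell(z)e^{(n-2\ell)\eta\partial_z}\Big)e^{-\pi iz^2/\eta},$$ $$\mathrm M(m\tfrac\tau2)=e^{2\pi iz^2/\tau}\Big(\sum_{\ell=0}^m(-1)^\ell\beta^{(m)}_\ell(z)e^{(m-2\ell)\frac\tau2\partial_z}\Big)e^{-2\pi iz^2/\tau}.$$ With $\mathrm M(n\eta)$ and $\mathrm M(m\tau/2)$ on the right-hand sides understood as these finite-difference operators (acting on arbitrary functions), $$\mathrm M(n\eta+m\tfrac\tau2)=e^{-\frac{\pi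 i\tau}2m^2n-\pi i\eta n^2m}\,e^{\pi im\frac{z^2}\eta}\,\mathrm M(n\eta)\,e^{-\pi im\frac{z^2}\eta-2\pi in\frac{z^2}\tau}\,\mathrm M(m\tfrac\tau2)\,e^{2\pi in\frac{z^2}\tau}$$ $$=e^{-\frac{\pi i\tau}2m^2n-\pi i\eta n^2m}\,e^{2\pi in\frac{z^2}\tau}\,\mathrm M(m\tfrac\tau2)\,e^{-\pi im\frac{z^2}\eta-2\pi in\frac{z^2}\tau}\,\mathrm M(n\eta)\,e^{\pi im\frac{z^2}\eta}.$$ 2. For every test function $\Phi$, every $z$ with $4z\notin\Lambda$ and each $k\in\{3,4\}$, $[\mathrm M(n\eta+m\frac\tau2)\Phi](z)=[\mathrm M^{(k)}_{n,m}\Phi](z)$, where $$\mathrm M^{(k)}_{n,m}=\mathrm A_k((n-1)\eta+m\tfrac\tau2)\cdots\mathrm A_k(m\tfrac\tau2)\;\mathrm B_k((m-1)\tfrac\tau2)\cdots\mathrm B_k(0)\;\theta_k^{-m}(z|\eta)\,\theta_k^{-n}(z|\tfrac\tau2).$$ 3. As finite-difference operators (applied to an arbitrary function $f:\mathbb C\to\mathbb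 C$ and evaluated at any $z$ with $4z\notin\Lambda$), for both $k=3,4$, $$e^{-\pi iz^2/\eta}\,\mathrm M^{(k)}_{n,0}\,e^{\pi iz^2/\eta}=\sum_{\ell=0}^n(-1)^\ell\alpha^{(n)}_\ell(z)e^{(n-2\ell)\eta\partial_z},\qquad e^{-2\pi iz^2/\tau}\,\mathrm M^{(k)}_{0,m}\,e^{2\pi iz^2/\tau}=\sum_{\ell=0}^m(-1)^\ell\beta^{(m)}_\ell(z)e^{(m-2\ell)\frac\tau2\partial_z},$$ and $\mathrm M^{(k)}_{n,m}$ equals each of the two right-hand sides of the factorization of $\mathrm M(n\eta+m\frac\tau2)$ in part 1. In particular, none of these operators depends on $k$. -/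

import Mathlib

open Complex

noncomputable section

namespace EllipticDouble

/-- Jacobi theta function `θ₁(z|τ)`. -/
def theta1 (z τ : ℂ) : ℂ :=
  -∑' n : ℤ, exp (Real.pi * I * ((n : ℂ) + 1 / 2) ^ 2 * τ) *
    exp (2 * Real.pi * I * ((n : ℂ) + 1 / 2) * (z + 1 / 2))

def theta2 (z τ : ℂ) : ℂ := theta1 (z + 1 / 2) τ

def theta3 (z τ : ℂ) : ℂ :=
  exp (Real.pi * I * τ / 4 + Real.pi * I * z) * theta2 (z + τ / 2) τ

def theta4 (z τ : ℂ) : ℂ := theta3 (z + 1 / 2) τ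

/-- The two values `k = 3, 4` of the index of the auxiliary theta function. -/
inductive Idx
  | three
  | four

/-- `θ_k(z|τ)` for `k = 3, 4`. -/
def theta : Idx → ℂ → ℂ → ℂ
  | Idx.three => theta3
  | Idx.four => theta4

/-- `(p;p)_∞` for `p = e^{2πiτ}`. -/
def qPoch (τ : ℂ) : ℂ := ∏' k : ℕ, (1 - exp (2 * Real.pi * I * τ) ^ (k + 1))

/-- `R(τ) = p^{-1/8} / (i (p;p)_∞)` with `p = e^{2πiτ}`, `p^{-1/8} = e^{-πiτ/4}`. -/
def R (τ : ℂ) : ℂ := exp (-(Real.pi * I * τ / 4)) / (I * qPoch τ)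

/-- The elliptic gamma function `Γ(z|τ,σ)`, with `p = e^{2πiτ}` and `q = e^{2πiσ}`.
At its poles the value is `0` by convention; only `1 / Γ` is evaluated there, so that the
value `1 / Γ = 0` is the correct one. -/
def ellGamma (τ σ z : ℂ) : ℂ :=
  (∏' ij : ℕ × ℕ, (1 - exp (-(2 * Real.pi * I * z)) *
      exp (2 * Real.pi * I * τ) ^ (ij.1 + 1) * exp (2 * Real.pi * I * σ) ^ (ij.2 + 1))) /
  (∏' ij : ℕ × ℕ, (1 - exp (2 * Real.pi * I * z) *
      exp (2 * Real.pi * I * τ) ^ ij.1 * exp (2 * Real.pi * I * σ) ^ ij.2))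

/-- The integral defining `[M(g)Φ](z)`; it represents it for `Im(-g ± z) > 0`. -/
def intM (τ η g : ℂ) (Φ : ℂ → ℂ) (z : ℂ) : ℂ :=
  qPoch (2 * η) * qPoch τ / 2 *
    ∫ x in (0 : ℝ)..1,
      ellGamma τ (2 * η) (z + x - g) * ellGamma τ (2 * η) (z - x - g) *
        ellGamma τ (2 * η) (-z + x - g) * ellGamma τ (2 * η) (-z - x - g) /
      (ellGamma τ (2 * η) (-2 * g) * ellGamma τ (2 * η) (2 * x) * ellGamma τ (2 * η) (-2 * x)) *
      Φ x

/-- `[M(g₀)Φ](z) = v`, where `M(g₀)` is understood by analytic continuation in the spin `g`: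
for the fixed point `z`, the function `g ↦ [M(g)Φ](z)`, given by the integral for
`Im(-g ± z) > 0` (away from the zeros of `Γ(-2g)`), extends to a meromorphic function on a
half-plane `Im g < c` containing `g₀`, and the extension is analytic at `g₀` with value `v`.
By the identity theorem, `v` is unique. -/
def IsMValue (τ η g₀ : ℂ) (Φ : ℂ → ℂ) (z v : ℂ) : Prop :=
  ∃ (c : ℝ) (F : ℂ → ℂ), g₀.im < c ∧ MeromorphicOn F {g | g.im < c} ∧
    (∀ g : ℂ, g.im < c → 0 < (-g + z).im → 0 < (-g - z).im →
      ellGamma τ (2 * η) (-2 * g) ≠ 0 → F g = intM τ η g Φ z) ∧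
    AnalyticAt ℂ F g₀ ∧ F g₀ = v

/-- Test functions for `M(g)`: holomorphic functions of `X = e^{2πix}` (`X ≠ 0`) that are
invariant under `X ↦ X⁻¹`. The kernel of `M(g)` is even in `x`. -/
structure IsTest (Φ : ℂ → ℂ) : Prop where
  holo : Differentiable ℂ Φ
  periodic : ∀ x, Φ (x + 1) = Φ x
  even : ∀ x, Φ (-x) = Φ x

/-- Linear operators on functions of a complex variable. -/
abbrev Op := Module.End ℂ (ℂ → ℂ)

/-- Multiplication by a function. -/
def mulOp (u : ℂ → ℂ) : Op := LinearMap.mulLeft ℂ u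

/-- The shift operator `e^{a∂_z}`, `f(z) ↦ f(z + a)`. -/
def shiftOp (a : ℂ) : Op := LinearMap.funLeft ℂ ℂ (fun z : ℂ => z + a)

/-- Multiplication by `e^{c z²}`. -/
def gaussOp (c : ℂ) : Op := mulOp fun z => exp (c * z ^ 2)

/-- The constant `c_A = e^{πiη}/R(τ)`; then `c_B = cA (2η) (τ/2)`. -/
def cA (τ η : ℂ) : ℂ := exp (Real.pi * I * η) / R τ

/-- The operator `A_k(g)`. -/
def opA (k : Idx) (τ η g : ℂ) : Op :=
  gaussOp (Real.pi * I / η) * mulOp (fun z => cA τ η / theta1 (2 * z) τ) *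
    (mulOp (fun z => theta k (z + g + η) (τ / 2)) * shiftOp η -
      mulOp (fun z => theta k (z - g - η) (τ / 2)) * shiftOp (-η)) *
    gaussOp (-(Real.pi * I / η))

/-- The operator `B_k(g)`: `A_k(g)` with `τ` and `2η` permuted. -/
def opB (k : Idx) (τ η g : ℂ) : Op := opA k (2 * η) (τ / 2) g

/-- `T (n-1) ⋯ T 1 * T 0`. -/
def descProd (T : ℕ → Op) : ℕ → Op
  | 0 => 1
  | n + 1 => T n * descProd T n

/-- The factored operator
`A_k((n-1)η + mτ/2) ⋯ A_k(mτ/2) B_k((m-1)τ/2) ⋯ B_k(0) θ_k^{-m}(z|η) θ_k^{-n}(z|τ/2)`. -/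
def factM (k : Idx) (τ η : ℂ) (n m : ℕ) : Op :=
  descProd (fun j => opA k τ η (j * η + m * (τ / 2))) n *
    descProd (fun j => opB k τ η (j * (τ / 2))) m *
    mulOp (fun z => (theta k z η)⁻¹ ^ m) * mulOp (fun z => (theta k z (τ / 2))⁻¹ ^ n)

/-- The elliptic binomial coefficient `[n, l]_{τ,2η}`. -/
def ellBinom (τ η : ℂ) (n l : ℕ) : ℂ :=
  (∏ j ∈ Finset.Icc 1 n, theta1 (2 * η * j) τ) /
    ((∏ j ∈ Finset.Icc 1 l, theta1 (2 * η * j) τ) *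
      ∏ j ∈ Finset.Icc 1 (n - l), theta1 (2 * η * j) τ)

/-- The coefficient `α_l^{(n)}(z)`; then `β_l^{(m)}(z) = alpha (2η) (τ/2) m l z`. -/
def alpha (τ η : ℂ) (n l : ℕ) (z : ℂ) : ℂ :=
  cA τ η ^ n * ellBinom τ η n l *
    (theta1 (2 * z + 2 * η * ((n : ℂ) - 2 * l)) τ /
      ∏ j ∈ Finset.range (n + 1), theta1 (2 * z - 2 * η * ((l : ℂ) - j)) τ)

/-- `Σ_{l=0}^n (-1)^l α_l^{(n)}(z) e^{(n-2l)η∂_z}`. -/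
def sumOp (τ η : ℂ) (n : ℕ) : Op :=
  ∑ l ∈ Finset.range (n + 1),
    (-1 : ℂ) ^ l • (mulOp (alpha τ η n l) * shiftOp (((n : ℂ) - 2 * l) * η))

/-- `e^{πiz²/η} (Σ_l (-1)^l α_l^{(n)}(z) e^{(n-2l)η∂_z}) e^{-πiz²/η}`. -/
def diffM (τ η : ℂ) (n : ℕ) : Op :=
  gaussOp (Real.pi * I / η) * sumOp τ η n * gaussOp (-(Real.pi * I / η))

/-- `e^{-πiτm²n/2 - πiηn²m} e^{πimz²/η} M(nη) e^{-πimz²/η - 2πinz²/τ} M(mτ/2) e^{2πinz²/τ}`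
with `M(nη)`, `M(mτ/2)` in difference form. -/
def prodM (τ η : ℂ) (n m : ℕ) : Op :=
  exp (-(Real.pi * I * τ / 2 * m ^ 2 * n) - Real.pi * I * η * n ^ 2 * m) •
    (gaussOp (Real.pi * I * m / η) * diffM τ η n *
      gaussOp (-(Real.pi * I * m / η) - 2 * Real.pi * I * n / τ) *
      diffM (2 * η) (τ / 2) m * gaussOp (2 * Real.pi * I * n / τ))

/-- `e^{-πiτm²n/2 - πiηn²m} e^{2πinz²/τ} M(mτ/2) e^{-πimz²/η - 2πinz²/τ} M(nη) e^{πimz²/η}`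
with `M(nη)`, `M(mτ/2)` in difference form. -/
def prodM' (τ η : ℂ) (n m : ℕ) : Op :=
  exp (-(Real.pi * I * τ / 2 * m ^ 2 * n) - Real.pi * I * η * n ^ 2 * m) •
    (gaussOp (2 * Real.pi * I * n / τ) * diffM (2 * η) (τ / 2) m *
      gaussOp (-(Real.pi * I * m / η) - 2 * Real.pi * I * n / τ) *
      diffM τ η n * gaussOp (Real.pi * I * m / η))

/-- `w ∉ ℤ + 2ηℤ + τℤ`. -/
def OffLattice (τ η w : ℂ) : Prop :=
  ∀ a b c : ℤ, w ≠ a + b * (2 * η) + c * τ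

end EllipticDouble

end

namespace EllipticDouble

/-! ### Theta functions -/

/-! The product θ₁(x+y|τ)θ₁(x-y|τ) is half of a 2×2 determinant in the values of θ₄ and θ₃ at
modulus τ/2 (`thetaW`), so the Plücker relation for such determinants supplies every three-term
theta identity that is needed. Two instances carry the proof. `theta_pascal` is a Pascal rule for
elliptic binomials and yields A_k(nη)M(nη) = M((n+1)η)θ_k for the explicit difference operators
(`opA_diffM`). `theta_kernel`, combined with Γ(u+2η) = θ(u)Γ(u), yields A_k(g)M(g) = M(g+η)θ_k for
the integral operators (`opA_intM`).

Algebra. By quasi-periodicity of θ_k, moving the spin of A_k by mτ/2 is conjugation by a Gaussian,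
and e^{2πiz²/τ}θ_k(z|τ/2) commutes with M(mτ/2) up to sign. Hence the recursion persists for the
factorized operator (`opA_prodM`). Iterating it, and dividing by the accumulated theta functions,
gives `factM_eq_prodM`, whose right side no longer contains k. The two orders of the factors agree
coefficient by coefficient (`prodCoeff_swap`).

Analysis. In X = e^{2πix} the poles of the kernel lie at X^{±1} = s_i = e^{2πi(±z-g)}p^a q^b.
Finitely many of them are split off by partial fractions in X + 1/X, and each resulting integral is
moved to a large circle, where it is analytic in g (`intM_eq_contM`, `IsCut.analyticAt_poleInt`). At
g₀ = nη + mτ/2 the factor 1/Γ(-2g) vanishes, while the coefficients of s_i blow up exactly when some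
s_j equals 1/s_i. The two effects cancel for paired poles and kill all others, and the two contour
integrals of a pair add up to a residue. So [M(g₀)Φ](z) is a finite combination of the values Φ(z -
g₀ + aτ + 2bη), a ≤ m, b ≤ n, with coefficients independent of Φ (`isMValue_sum`).

Identification. These coefficients are not evaluated directly, except at g = 0. The recursion for
the integral operators is continued in g by the identity theorem (`IsMValue.opA_eq`). Since the
difference operators obey the same recursion, and test functions multiplied by θ₃ or θ₄ separate the
points involved (`eq_of_sum_theta_mul_eq`), induction on n determines the coefficients. The symmetry
τ ↔ 2η turns the induction on m into the one on n. -/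

theorem theta1_eq_jacobiTheta₂ (z τ : ℂ) :
    theta1 z τ = -(exp (Real.pi * I * τ / 4 + Real.pi * I * (z + 1 / 2)) *
      jacobiTheta₂ (z + 1 / 2 + τ / 2) τ) := by
  rw [theta1, jacobiTheta₂, ← tsum_mul_left]
  congr 1
  refine tsum_congr fun n => ?_
  rw [jacobiTheta₂_term, ← exp_add, ← exp_add]
  ring_nf

theorem theta3_eq_jacobiTheta₂ (z τ : ℂ) : theta3 z τ = jacobiTheta₂ z τ := by
  rw [theta3, theta2, theta1_eq_jacobiTheta₂,
    show z + τ / 2 + 1 / 2 + 1 / 2 + τ / 2 = z + 1 + τ by ring, jacobiTheta₂_add_left',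
    jacobiTheta₂_add_left, mul_neg, ← mul_assoc, ← mul_assoc, ← exp_add, ← exp_add, ← neg_mul]
  rw [show (Real.pi * I * τ / 4 + Real.pi * I * z +
    (Real.pi * I * τ / 4 + Real.pi * I * (z + τ / 2 + 1 / 2 + 1 / 2)) +
      -Real.pi * I * (τ + 2 * (z + 1)) : ℂ) = -(Real.pi * I) by ring, exp_neg, exp_pi_mul_I]
  norm_num

theorem theta4_eq_jacobiTheta₂ (z τ : ℂ) : theta4 z τ = jacobiTheta₂ (z + 1 / 2) τ := by
  rw [theta4, theta3_eq_jacobiTheta₂]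

/-- The sign in the quasi-periodicity of `θ_k`. -/
def Idx.sign : Idx → ℂ
  | Idx.three => 1
  | Idx.four => -1

theorem Idx.sign_mul_self (k : Idx) : k.sign * k.sign = 1 := by cases k <;> simp [Idx.sign]

theorem Idx.sign_ne_zero (k : Idx) : k.sign ≠ 0 := by cases k <;> simp [Idx.sign]

theorem theta_neg (k : Idx) (z τ : ℂ) : theta k (-z) τ = theta k z τ := by
  cases k
  · simp only [theta, theta3_eq_jacobiTheta₂, jacobiTheta₂_neg_left]
  · simp only [theta, theta4_eq_jacobiTheta₂]
    rw [← jacobiTheta₂_neg_left, ← jacobiTheta₂_add_left]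
    ring_nf

theorem theta_add_one (k : Idx) (z τ : ℂ) : theta k (z + 1) τ = theta k z τ := by
  cases k
  · simp only [theta, theta3_eq_jacobiTheta₂, jacobiTheta₂_add_left]
  · simp only [theta, theta4_eq_jacobiTheta₂]
    rw [← jacobiTheta₂_add_left (z + 1 / 2)]
    ring_nf

theorem theta_add_period (k : Idx) (z τ : ℂ) :
    theta k (z + τ) τ = k.sign * exp (-(Real.pi * I * τ) - 2 * Real.pi * I * z) * theta k z τ := by
  cases k
  · simp only [theta, theta3_eq_jacobiTheta₂, jacobiTheta₂_add_left', Idx.sign]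
    ring_nf
  · simp only [theta, theta4_eq_jacobiTheta₂, Idx.sign]
    rw [show z + τ + 1 / 2 = z + 1 / 2 + τ by ring, jacobiTheta₂_add_left',
      show (-Real.pi * I * (τ + 2 * (z + 1 / 2)) : ℂ) =
        (-(Real.pi * I * τ) - 2 * Real.pi * I * z) + -(Real.pi * I) by ring, exp_add, exp_neg (_ * I),
        exp_pi_mul_I]
    ring_nf

theorem differentiable_theta (k : Idx) {τ : ℂ} (hτ : 0 < τ.im) :
    Differentiable ℂ fun z => theta k z τ := by
  intro z
  cases k
  · simp only [theta, theta3_eq_jacobiTheta₂]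
    exact differentiableAt_jacobiTheta₂_fst z hτ
  · simp only [theta, theta4_eq_jacobiTheta₂]
    have := differentiableAt_jacobiTheta₂_fst (z + 1 / 2) hτ
    exact this.comp (f := fun z => z + 1 / 2) z (by fun_prop)

theorem theta1_neg (z τ : ℂ) : theta1 (-z) τ = -theta1 z τ := by
  rw [theta1_eq_jacobiTheta₂, theta1_eq_jacobiTheta₂, neg_neg,
    ← jacobiTheta₂_neg_left (-z + 1 / 2 + τ / 2), ← jacobiTheta₂_add_left,
    ← neg_mul, show z + 1 / 2 + τ / 2 = -(-z + 1 / 2 + τ / 2) + 1 + τ by ring, jacobiTheta₂_add_left',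
    ← mul_assoc, ← exp_add]
  congr 1
  rw [show (Real.pi * I * τ / 4 + Real.pi * I * (z + 1 / 2) +
    -Real.pi * I * (τ + 2 * (-(-z + 1 / 2 + τ / 2) + 1)) : ℂ) =
      Real.pi * I * τ / 4 + Real.pi * I * (-z + 1 / 2) + -(Real.pi * I) by ring,
      exp_add _ (-(Real.pi * I)), exp_neg (Real.pi * I), exp_pi_mul_I]
  norm_num

theorem theta1_add_period (z τ : ℂ) :
    theta1 (z + τ) τ = -1 * exp (-(Real.pi * I * τ) - 2 * Real.pi * I * z) * theta1 z τ := by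
  rw [theta1_eq_jacobiTheta₂, theta1_eq_jacobiTheta₂,
    show z + τ + 1 / 2 + τ / 2 = z + 1 / 2 + τ / 2 + τ by ring, jacobiTheta₂_add_left',
    ← mul_assoc, ← exp_add,
    show (Real.pi * I * τ / 4 + Real.pi * I * (z + τ + 1 / 2) +
      -Real.pi * I * (τ + 2 * (z + 1 / 2 + τ / 2)) : ℂ) =
    -(Real.pi * I * τ) - 2 * Real.pi * I * z + (Real.pi * I * τ / 4 + Real.pi * I * (z + 1 / 2)) +
      -(Real.pi * I) by ring, exp_add _ (-(Real.pi * I)), exp_neg (Real.pi * I), exp_pi_mul_I,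
    exp_add (-(Real.pi * I * τ) - _)]
  norm_num
  ring

/-- Iterating a quasi-periodicity relation of theta type. -/
theorem quasiPeriodic_int {f : ℂ → ℂ} {h ε : ℂ} (hε : ε * ε = 1)
    (hf : ∀ z, f (z + h) = ε * exp (-(Real.pi * I * h) - 2 * Real.pi * I * z) * f z)
    (r : ℤ) (z : ℂ) :
    f (z + r * h) =
      ε ^ r * exp (-(Real.pi * I * r ^ 2 * h) - 2 * Real.pi * I * r * z) * f z := by
  have hε0 : ε ≠ 0 := fun h0 => by simp [h0] at hε
  have step : ∀ r : ℤ, f (z + ((r + 1 : ℤ) : ℂ) * h) =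
      ε * exp (-(Real.pi * I * h) - 2 * Real.pi * I * (z + r * h)) * f (z + r * h) := fun r => by
    rw [← hf]; push_cast; ring_nf
  have estep : ∀ r : ℤ, exp (-(Real.pi * I * ((r + 1 : ℤ) : ℂ) ^ 2 * h) -
        2 * Real.pi * I * ((r + 1 : ℤ) : ℂ) * z) =
      exp (-(Real.pi * I * h) - 2 * Real.pi * I * (z + r * h)) *
        exp (-(Real.pi * I * (r : ℂ) ^ 2 * h) - 2 * Real.pi * I * r * z) := fun r => by
    rw [← exp_add]; push_cast; ring_nf
  induction r using Int.induction_on with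
  | zero => simp
  | succ n ih =>
    rw [step, ih, estep, zpow_add_one₀ hε0]
    ring
  | pred n ih =>
    have h1 := step (-(n : ℤ) - 1)
    have h2 := estep (-(n : ℤ) - 1)
    rw [sub_add_cancel] at h1 h2
    rw [h1, h2] at ih
    have hx := exp_ne_zero (-(Real.pi * I * h) - 2 * Real.pi * I * (z + ((-(n : ℤ) - 1 : ℤ) : ℂ) * h))
    apply mul_left_cancel₀ (mul_ne_zero hε0 hx)
    rw [ih, zpow_sub_one₀ hε0]
    field_simp

theorem theta_add_int_mul (k : Idx) (r : ℤ) (z h : ℂ) :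
    theta k (z + r * h) h =
      k.sign ^ r * exp (-(Real.pi * I * r ^ 2 * h) - 2 * Real.pi * I * r * z) * theta k z h :=
  quasiPeriodic_int (f := fun z => theta k z h) k.sign_mul_self (fun z => theta_add_period k z h) r z

theorem theta1_add_int_mul (r : ℤ) (z τ : ℂ) :
    theta1 (z + r * τ) τ =
      (-1) ^ r * exp (-(Real.pi * I * r ^ 2 * τ) - 2 * Real.pi * I * r * z) * theta1 z τ :=
  quasiPeriodic_int (f := fun z => theta1 z τ) (ε := -1) (by norm_num) (fun z => theta1_add_period z τ) r z

theorem exp_pi_mul_I_mul_int (n : ℤ) : exp (Real.pi * I * n) = (-1) ^ n := by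
  rw [mul_comm, exp_int_mul, exp_pi_mul_I]

theorem half_im_pos {τ : ℂ} (hτ : 0 < τ.im) : 0 < (τ / 2).im := by
  have h2 : (τ / 2).im = τ.im / 2 := by simp
  rw [h2]
  exact half_pos hτ

/-- Product formula expressing `θ₁θ₁` at modulus `τ` by `θ₃, θ₄` at modulus `τ/2`. -/
theorem two_mul_theta1_mul_theta1 (x y : ℂ) {τ : ℂ} (hτ : 0 < τ.im) :
    2 * (theta1 (x + y) τ * theta1 (x - y) τ) =
      theta4 x (τ / 2) * theta3 y (τ / 2) - theta4 y (τ / 2) * theta3 x (τ / 2) := by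
  have hh : 0 < (τ / 2).im := half_im_pos hτ
  have hsum : ∀ w, Summable fun a : ℤ => ‖jacobiTheta₂_term a w (τ / 2)‖ := fun w =>
    ((summable_jacobiTheta₂_term_iff w _).2 hh).norm
  let u : ℂ → ℤ → ℂ := fun z n => exp (Real.pi * I * ((n : ℂ) + 1 / 2) ^ 2 * τ) *
    exp (2 * Real.pi * I * ((n : ℂ) + 1 / 2) * (z + 1 / 2))
  have hu : ∀ z, Summable fun n => ‖u z n‖ := fun z => by
    have h := (((summable_jacobiTheta₂_term_iff (z + 1 / 2 + τ / 2) τ).2 hτ).mul_left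
      (exp (Real.pi * I * τ / 4 + Real.pi * I * (z + 1 / 2)))).norm
    refine h.congr fun n => ?_
    congr 1
    simp only [u, jacobiTheta₂_term]
    rw [← exp_add, ← exp_add]
    ring_nf
  have hodd : ∀ (a : ℤ) (w : ℂ), jacobiTheta₂_term a (w + 1 / 2) (τ / 2) =
      (-1) ^ a * jacobiTheta₂_term a w (τ / 2) := fun a w => by
    rw [← exp_pi_mul_I_mul_int, jacobiTheta₂_term, jacobiTheta₂_term, ← exp_add]
    ring_nf
  let f : ℤ × ℤ → ℂ := fun ab => ((-1) ^ ab.1 - (-1) ^ ab.2) *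
    (jacobiTheta₂_term ab.1 x (τ / 2) * jacobiTheta₂_term ab.2 y (τ / 2))
  have hR : theta4 x (τ / 2) * theta3 y (τ / 2) - theta4 y (τ / 2) * theta3 x (τ / 2) =
      ∑' ab, f ab := by
    rw [mul_comm (theta4 y _)]
    simp only [theta3_eq_jacobiTheta₂, theta4_eq_jacobiTheta₂, jacobiTheta₂]
    rw [tsum_mul_tsum_of_summable_norm (hsum _) (hsum _),
      tsum_mul_tsum_of_summable_norm (hsum _) (hsum _),
      ← (summable_mul_of_summable_norm (hsum _) (hsum _)).tsum_sub
        (summable_mul_of_summable_norm (hsum _) (hsum _))]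
    refine tsum_congr fun ab => ?_
    rw [hodd, hodd]
    ring
  -- With a = r+s+1 and b = r-s one has (r+1/2)² + (s+1/2)² = (a²+b²)/2, which is how the modulus is
  -- halved. The pairs (a,b) obtained are those with a+b odd, and the difference of signs in `f`
  -- kills all others.
  let g : ℤ × ℤ → ℤ × ℤ := fun rs => (rs.1 + rs.2 + 1, rs.1 - rs.2)
  have hg : Function.Injective g := by
    rintro ⟨a, b⟩ ⟨c, d⟩ h
    simp only [g, Prod.mk.injEq] at h ⊢
    omega
  have hsupp : Function.support f ⊆ Set.range g := by
    rintro ⟨a, b⟩ h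
    rcases Int.even_or_odd (a + b) with he | ho
    · refine absurd ?_ h
      have : (-1 : ℂ) ^ a = (-1) ^ b := by
        rcases Int.even_or_odd a with ha | ha
        · rw [ha.neg_one_zpow, ((Int.even_add.1 he).1 ha).neg_one_zpow]
        · have hb : Odd b := by
            rw [← Int.not_even_iff_odd] at ha ⊢
            exact fun hb => ha ((Int.even_add.1 he).2 hb)
          rw [ha.neg_one_zpow, hb.neg_one_zpow]
      simp [f, this]
    · obtain ⟨c, hc⟩ := ho
      refine ⟨(c, a - c - 1), ?_⟩
      simp only [g, Prod.mk.injEq]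
      omega
  rw [hR, ← hg.tsum_eq hsupp]
  simp only [theta1]
  rw [neg_mul_neg, tsum_mul_tsum_of_summable_norm (hu _) (hu _), ← tsum_mul_left]
  refine tsum_congr fun rs => ?_
  have hsgn : ((-1 : ℂ) ^ (g rs).1 - (-1) ^ (g rs).2) = 2 * exp (Real.pi * I * (g rs).1) := by
    rw [exp_pi_mul_I_mul_int]
    have : (-1 : ℂ) ^ (g rs).2 = -(-1) ^ (g rs).1 := by
      rw [show (g rs).2 = (g rs).1 + 1 + 2 * (-rs.2 - 1) by simp only [g]; ring,
        zpow_add₀ (by norm_num), zpow_add₀ (by norm_num), zpow_mul]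
      norm_num
    rw [this]
    ring
  simp only [f]
  rw [hsgn]
  simp only [jacobiTheta₂_term, g, u]
  rw [mul_assoc 2 (cexp _), ← exp_add, ← exp_add, ← exp_add, ← exp_add, ← exp_add]
  push_cast
  ring_nf

/-- The antisymmetric function `θ₄(x|h)θ₃(y|h) - θ₄(y|h)θ₃(x|h)`. -/
noncomputable def thetaW (h x y : ℂ) : ℂ := theta4 x h * theta3 y h - theta4 y h * theta3 x h

/-- Three-term (Plücker) relation. -/
theorem theta_mul_thetaW (k : Idx) (h u v w : ℂ) :
    theta k u h * thetaW h v w + theta k v h * thetaW h w u + theta k w h * thetaW h u v = 0 := by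
  cases k <;> simp only [theta, thetaW] <;> ring

theorem two_mul_theta1_mul_theta1_eq_thetaW (x y : ℂ) {τ : ℂ} (hτ : 0 < τ.im) :
    2 * (theta1 (x + y) τ * theta1 (x - y) τ) = thetaW (τ / 2) x y :=
  two_mul_theta1_mul_theta1 x y hτ

theorem thetaW_neg_left (h x y : ℂ) : thetaW h (-x) y = thetaW h x y := by
  have h3 := theta_neg Idx.three x h
  have h4 := theta_neg Idx.four x h
  simp only [theta] at h3 h4
  simp only [thetaW, h3, h4]

theorem thetaW_neg_right (h x y : ℂ) : thetaW h x (-y) = thetaW h x y := by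
  have h3 := theta_neg Idx.three y h
  have h4 := theta_neg Idx.four y h
  simp only [theta] at h3 h4
  simp only [thetaW, h3, h4]

/-- Identity behind the recursion of the elliptic binomial coefficients. -/
theorem theta_pascal (k : Idx) (z N L : ℂ) {τ : ℂ} (hτ : 0 < τ.im) :
    theta k (z + N) (τ / 2) * theta1 (2 * (N - L)) τ * theta1 (2 * (z - L)) τ +
      theta k (z - N) (τ / 2) * theta1 (2 * L) τ * theta1 (2 * (z + N - L)) τ =
    theta1 (2 * z) τ * theta1 (2 * N) τ * theta k (z + N - 2 * L) (τ / 2) := by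
  have h1 := two_mul_theta1_mul_theta1_eq_thetaW (N + z - 2 * L) (N - z) hτ
  have h2 := two_mul_theta1_mul_theta1_eq_thetaW (z + N) (z + N - 2 * L) hτ
  have h3 := two_mul_theta1_mul_theta1_eq_thetaW (z + N) (z - N) hτ
  -- Plücker relation at the points z+N, z-N, z+N-2L; the three determinants are the three products
  -- of θ₁ above.
  have h4 := theta_mul_thetaW k (τ / 2) (z + N) (z - N) (z + N - 2 * L)
  rw [show N - z = -(z - N) by ring, thetaW_neg_right] at h1
  rw [show N + z - 2 * L + -(z - N) = 2 * (N - L) by ring,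
    show N + z - 2 * L - -(z - N) = 2 * (z - L) by ring, show N + z - 2 * L = z + N - 2 * L by ring] at h1
  rw [show z + N + (z + N - 2 * L) = 2 * (z + N - L) by ring,
    show z + N - (z + N - 2 * L) = 2 * L by ring] at h2
  rw [show z + N + (z - N) = 2 * z by ring, show z + N - (z - N) = 2 * N by ring] at h3
  have hanti : thetaW (τ / 2) (z - N) (z + N - 2 * L) = -thetaW (τ / 2) (z + N - 2 * L) (z - N) := by
    simp only [thetaW]; ring
  have hanti' : thetaW (τ / 2) (z + N - 2 * L) (z + N) = -thetaW (τ / 2) (z + N) (z + N - 2 * L) := by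
    simp only [thetaW]; ring
  rw [hanti, hanti', ← h1, ← h2, ← h3] at h4
  linear_combination (-1 / 2 : ℂ) * h4

/-- Identity behind the recursion of the kernel of the integral operator. -/
theorem theta_kernel (k : Idx) (z h x : ℂ) {τ : ℂ} (hτ : 0 < τ.im) :
    theta k (z + h) (τ / 2) * (theta1 (z + x - h) τ * theta1 (z - x - h) τ) -
      theta k (z - h) (τ / 2) * (theta1 (-z + x - h) τ * theta1 (-z - x - h) τ) =
    theta1 (2 * z) τ * theta1 (-2 * h) τ * theta k x (τ / 2) := by
  have h1 := two_mul_theta1_mul_theta1_eq_thetaW (z - h) x hτ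
  have h2 := two_mul_theta1_mul_theta1_eq_thetaW (-(z + h)) x hτ
  have h3 := two_mul_theta1_mul_theta1_eq_thetaW (z - h) (z + h) hτ
  -- Plücker relation at the points z+h, z-h, x.
  have h4 := theta_mul_thetaW k (τ / 2) (z + h) (z - h) x
  rw [thetaW_neg_left] at h2
  rw [show z - h + x = z + x - h by ring, show z - h - x = z - x - h by ring] at h1
  rw [show -(z + h) + x = -z + x - h by ring, show -(z + h) - x = -z - x - h by ring] at h2
  rw [show z - h + (z + h) = 2 * z by ring, show z - h - (z + h) = -2 * h by ring] at h3
  have hanti : thetaW (τ / 2) x (z + h) = -thetaW (τ / 2) (z + h) x := by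
    simp only [thetaW]; ring
  have hanti' : thetaW (τ / 2) (z + h) (z - h) = -thetaW (τ / 2) (z - h) (z + h) := by
    simp only [thetaW]; ring
  rw [hanti, hanti', ← h1, ← h2, ← h3] at h4
  linear_combination (1 / 2 : ℂ) * h4

/-! ### Infinite products `∏ (1 - t wᵢ)` -/

/-- The product `∏ᵢ (1 - t wᵢ)`. -/
noncomputable def qProd {ι : Type*} (w : ι → ℂ) (t : ℂ) : ℂ := ∏' i, (1 - t * w i)

section qProd

variable {ι : Type*} {w : ι → ℂ}

theorem summable_norm_neg_mul (hw : Summable fun i => ‖w i‖) (t : ℂ) :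
    Summable fun i => ‖-(t * w i)‖ := by
  simpa only [norm_neg, norm_mul] using hw.mul_left ‖t‖

theorem multipliable_one_sub_mul (hw : Summable fun i => ‖w i‖) (t : ℂ) :
    Multipliable fun i => 1 - t * w i := by
  simpa only [sub_eq_add_neg] using multipliable_one_add_of_summable (summable_norm_neg_mul hw t)

theorem qProd_ne_zero (hw : Summable fun i => ‖w i‖) {t : ℂ} (h : ∀ i, t * w i ≠ 1) :
    qProd w t ≠ 0 := by
  have := tprod_one_add_ne_zero_of_summable (f := fun i => -(t * w i))
    (fun i => by rw [← sub_eq_add_neg]; exact sub_ne_zero.2 (h i).symm) (summable_norm_neg_mul hw t)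
  simpa only [qProd, sub_eq_add_neg] using this

theorem qProd_ne_zero_of_norm_lt (hw : Summable fun i => ‖w i‖) {t : ℂ} (h : ∀ i, ‖t * w i‖ < 1) :
    qProd w t ≠ 0 :=
  qProd_ne_zero hw fun i hi => by simpa [hi] using h i

/-- The product converges uniformly on each ball, because there the terms t wᵢ are dominated by a
summable sequence independent of t. -/
theorem differentiable_qProd (hw : Summable fun i => ‖w i‖) : Differentiable ℂ (qProd w) := by
  intro t₀
  have hopen : IsOpen (Metric.ball (0 : ℂ) (‖t₀‖ + 1)) := Metric.isOpen_ball
  have hmem : t₀ ∈ Metric.ball (0 : ℂ) (‖t₀‖ + 1) := by simp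
  have h := Summable.hasProdLocallyUniformlyOn_one_add (f := fun i (t : ℂ) => -(t * w i)) hopen
    (hw.mul_left (‖t₀‖ + 1)) (Filter.Eventually.of_forall fun i t ht => by
      rw [norm_neg, norm_mul]
      rw [mem_ball_zero_iff] at ht
      gcongr) (fun i => by fun_prop)
  rw [hasProdLocallyUniformlyOn_iff_tendstoLocallyUniformlyOn] at h
  have hd := h.differentiableOn (Filter.Eventually.of_forall fun s => by fun_prop) hopen
  have := (hd t₀ hmem).differentiableAt (hopen.mem_nhds hmem)
  have heq : qProd w = fun t => ∏' i, (1 + -(t * w i)) := by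
    funext t
    simp only [qProd, sub_eq_add_neg]
  rw [heq]
  exact this

theorem qProd_mul_left (c t : ℂ) : qProd (fun i => c * w i) t = qProd w (t * c) := by
  simp only [qProd, mul_assoc]

/-- Splitting a product along a decomposition of the index set. -/
theorem qProd_split {α β : Type*} (hw : Summable fun i => ‖w i‖) {e : α → ι} {e' : β → ι}
    (he : Function.Injective e) (he' : Function.Injective e')
    (h : ∀ i, i ∈ Set.range e' ↔ i ∉ Set.range e) (t : ℂ) :
    qProd w t = qProd (fun a => w (e a)) t * qProd (fun b => w (e' b)) t := by
  classical
  -- Both partial products are extended to the whole index set by weight 0, that is by factors 1, so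
  -- that they can be multiplied termwise.
  have key : ∀ (s : Set ι) [DecidablePred (· ∈ s)],
      Summable fun i => ‖if i ∈ s then w i else 0‖ := fun s _ => by
    refine hw.of_nonneg_of_le (fun i => norm_nonneg _) fun i => ?_
    split_ifs <;> simp
  have h1 : qProd (fun a => w (e a)) t = qProd (fun i => if i ∈ Set.range e then w i else 0) t := by
    rw [qProd, qProd, ← he.tprod_eq]
    · simp
    · intro i hi
      by_contra hne
      exact hi (by simp only [if_neg hne, mul_zero, sub_zero])
  have h2 : qProd (fun b => w (e' b)) t = qProd (fun i => if i ∈ Set.range e' then w i else 0) t := by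
    rw [qProd, qProd, ← he'.tprod_eq]
    · simp
    · intro i hi
      by_contra hne
      exact hi (by simp only [if_neg hne, mul_zero, sub_zero])
  rw [h1, h2, qProd, qProd, qProd, ← (multipliable_one_sub_mul (key _) t).tprod_mul
    (multipliable_one_sub_mul (key _) t)]
  refine tprod_congr fun i => ?_
  by_cases hi : i ∈ Set.range e
  · simp only [if_pos hi, if_neg (fun h' => (h i).1 h' hi)]
    ring
  · simp only [if_neg hi, if_pos ((h i).2 hi)]
    ring

/-- Taking finitely many factors out of a product. -/
theorem qProd_eq_prod_mul [DecidableEq ι] (hw : Summable fun i => ‖w i‖) (S : Finset ι) (t : ℂ) :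
    qProd w t = (∏ i ∈ S, (1 - t * w i)) * qProd (fun i => if i ∈ S then 0 else w i) t := by
  have h1 : Summable fun i => ‖if i ∈ S then w i else 0‖ := by
    refine hw.of_nonneg_of_le (fun i => norm_nonneg _) fun i => ?_
    split_ifs <;> simp
  have h2 : Summable fun i => ‖if i ∈ S then 0 else w i‖ := by
    refine hw.of_nonneg_of_le (fun i => norm_nonneg _) fun i => ?_
    split_ifs <;> simp
  have h3 : ∏ i ∈ S, (1 - t * w i) = ∏' i, (1 - t * if i ∈ S then w i else 0) := by
    rw [tprod_eq_prod (s := S)]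
    · exact Finset.prod_congr rfl fun i hi => by rw [if_pos hi]
    · intro i hi
      simp [hi]
  rw [h3, qProd, qProd, ← (multipliable_one_sub_mul h1 t).tprod_mul (multipliable_one_sub_mul h2 t)]
  refine tprod_congr fun i => ?_
  split_ifs <;> ring

end qProd

theorem summable_norm_pow {p : ℂ} (hp : ‖p‖ < 1) : Summable fun i : ℕ => ‖p ^ i‖ := by
  simpa only [norm_pow] using summable_geometric_of_lt_one (norm_nonneg p) hp

theorem summable_norm_pow_succ {p : ℂ} (hp : ‖p‖ < 1) : Summable fun i : ℕ => ‖p ^ (i + 1)‖ :=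
  (summable_nat_add_iff 1 (f := fun i => ‖p ^ i‖)).2 (summable_norm_pow hp)

theorem summable_norm_pow_mul_pow {p q : ℂ} (hp : ‖p‖ < 1) (hq : ‖q‖ < 1) :
    Summable fun ij : ℕ × ℕ => ‖p ^ ij.1 * q ^ ij.2‖ :=
  Summable.mul_norm (f := fun i : ℕ => p ^ i) (g := fun j : ℕ => q ^ j)
    (summable_norm_pow hp) (summable_norm_pow hq)

theorem summable_norm_pow_succ_mul_pow_succ {p q : ℂ} (hp : ‖p‖ < 1) (hq : ‖q‖ < 1) :
    Summable fun ij : ℕ × ℕ => ‖p ^ (ij.1 + 1) * q ^ (ij.2 + 1)‖ :=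
  Summable.mul_norm (f := fun i : ℕ => p ^ (i + 1)) (g := fun j : ℕ => q ^ (j + 1))
    (summable_norm_pow_succ hp) (summable_norm_pow_succ hq)

theorem norm_exp_two_pi_I_mul (u : ℂ) :
    ‖exp (2 * Real.pi * I * u)‖ = Real.exp (-(2 * Real.pi * u.im)) := by
  rw [norm_exp]
  congr 1
  simp

theorem norm_exp_two_pi_I_mul_lt_one {u : ℂ} (hu : 0 < u.im) : ‖exp (2 * Real.pi * I * u)‖ < 1 := by
  rw [norm_exp_two_pi_I_mul, Real.exp_lt_one_iff]
  have := Real.pi_pos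
  nlinarith [mul_pos this hu]

/-! ### Jacobi's triple product -/

section tripleProduct

/-- The finite product `(1 - p)(1 - p²)⋯(1 - pⁿ)`. -/
def qFact (p : ℂ) (n : ℕ) : ℂ := ∏ i ∈ Finset.range n, (1 - p ^ (i + 1))

theorem qFact_succ (p : ℂ) (n : ℕ) : qFact p (n + 1) = qFact p n * (1 - p ^ (n + 1)) :=
  Finset.prod_range_succ _ _

theorem one_sub_pow_succ_ne_zero {p : ℂ} (hp : ‖p‖ < 1) (n : ℕ) : 1 - p ^ (n + 1) ≠ 0 := by
  intro h
  have h1 : ‖p ^ (n + 1)‖ < 1 := by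
    rw [norm_pow]
    exact pow_lt_one₀ (norm_nonneg _) hp (Nat.succ_ne_zero n)
  rw [← sub_eq_zero.1 h, norm_one] at h1
  exact lt_irrefl _ h1

theorem qFact_ne_zero {p : ℂ} (hp : ‖p‖ < 1) (n : ℕ) : qFact p n ≠ 0 :=
  Finset.prod_ne_zero_iff.2 fun i _ => one_sub_pow_succ_ne_zero hp i

/-- The Gaussian binomial coefficient, extended by zero. -/
noncomputable def qBinom (p : ℂ) (n j : ℕ) : ℂ :=
  if j ≤ n then qFact p n / (qFact p j * qFact p (n - j)) else 0

theorem qBinom_zero {p : ℂ} (hp : ‖p‖ < 1) (n : ℕ) : qBinom p n 0 = 1 := by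
  rw [qBinom, if_pos n.zero_le, Nat.sub_zero, show qFact p 0 = 1 from rfl, one_mul,
    div_self (qFact_ne_zero hp n)]

/-- The q-Pascal rule; multiplying it by pʲ avoids the exponent n-j, a subtraction of natural
numbers. -/
theorem pow_mul_qBinom_succ {p : ℂ} (hp : ‖p‖ < 1) {n j : ℕ} (hj : j ≤ n) :
    p ^ j * qBinom p (n + 1) (j + 1) = p ^ j * qBinom p n (j + 1) + p ^ n * qBinom p n j := by
  have h0 := qFact_ne_zero hp
  rcases hj.eq_or_lt with rfl | hlt
  · rw [qBinom, qBinom, qBinom, if_pos le_rfl, if_neg (by omega), if_pos le_rfl, Nat.sub_self,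
      Nat.sub_self, show qFact p 0 = 1 from rfl, mul_one, mul_one, div_self (h0 _), div_self (h0 _)]
    ring
  · obtain ⟨d, rfl⟩ := Nat.exists_eq_add_of_lt hlt
    have e1 : j + d + 1 + 1 - (j + 1) = d + 1 := by omega
    have e2 : j + d + 1 - (j + 1) = d := by omega
    have e3 : j + d + 1 - j = d + 1 := by omega
    rw [qBinom, qBinom, qBinom, if_pos (by omega), if_pos (by omega), if_pos hj, e1, e2, e3,
      qFact_succ p (j + d + 1), qFact_succ p j, qFact_succ p d]
    have h1 := h0 j
    have h2 := h0 d
    have h3 := one_sub_pow_succ_ne_zero hp j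
    have h4 := one_sub_pow_succ_ne_zero hp d
    field_simp
    ring

/-- The finite `q`-binomial theorem. -/
theorem prod_one_sub_mul_pow {p : ℂ} (hp : ‖p‖ < 1) (n : ℕ) (t : ℂ) :
    ∏ k ∈ Finset.range n, (1 - t * p ^ k) =
      ∑ j ∈ Finset.range (n + 1), (-1) ^ j * p ^ j.choose 2 * qBinom p n j * t ^ j := by
  induction n with
  | zero => simp [qBinom_zero hp]
  | succ n ih =>
    rw [Finset.prod_range_succ, ih, Finset.sum_range_succ' _ (n + 1)]
    -- The coefficient with j = n+1 is zero by convention, so the sum may be lengthened by one term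
    -- before the zeroth is split off.
    have hext : ∑ j ∈ Finset.range (n + 1), (-1) ^ j * p ^ j.choose 2 * qBinom p n j * t ^ j =
        ∑ j ∈ Finset.range (n + 1), (-1) ^ (j + 1) * p ^ (j + 1).choose 2 * qBinom p n (j + 1) *
          t ^ (j + 1) + 1 := by
      have : ∑ j ∈ Finset.range (n + 1), (-1) ^ j * p ^ j.choose 2 * qBinom p n j * t ^ j =
          ∑ j ∈ Finset.range (n + 2), (-1) ^ j * p ^ j.choose 2 * qBinom p n j * t ^ j := by
        rw [Finset.sum_range_succ _ (n + 1), qBinom, if_neg (by omega)]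
        ring
      rw [this, Finset.sum_range_succ']
      simp [qBinom_zero hp]
    rw [mul_sub, mul_one]
    nth_rw 1 [hext]
    rw [Finset.sum_mul, add_sub_right_comm, ← Finset.sum_sub_distrib]
    congr 1
    · refine Finset.sum_congr rfl fun j hj => ?_
      have hj' : j ≤ n := Nat.lt_succ_iff.1 (Finset.mem_range.1 hj)
      have hc : (j + 1).choose 2 = j.choose 2 + j := by
        rw [Nat.choose_succ_succ' j 1, Nat.choose_one_right, add_comm]
      have := pow_mul_qBinom_succ hp hj'
      rw [hc, pow_add]
      linear_combination (-(-1) ^ (j + 1) * p ^ j.choose 2 * t ^ (j + 1)) * this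
    · simp [qBinom_zero hp]

theorem tendsto_qFact {p : ℂ} (hp : ‖p‖ < 1) :
    Filter.Tendsto (qFact p) Filter.atTop (nhds (∏' k : ℕ, (1 - p ^ (k + 1)))) := by
  have h := multipliable_one_sub_mul (summable_norm_pow_succ hp) 1
  simp only [one_mul] at h
  exact h.hasProd.tendsto_prod_nat

theorem tprod_one_sub_pow_succ_ne_zero {p : ℂ} (hp : ‖p‖ < 1) :
    ∏' k : ℕ, (1 - p ^ (k + 1)) ≠ 0 := by
  have := qProd_ne_zero (summable_norm_pow_succ hp) (t := 1) fun i h => by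
    rw [one_mul] at h
    exact one_sub_pow_succ_ne_zero hp i (by rw [h, sub_self])
  simpa only [qProd, one_mul] using this

/-- The finite products converge to a nonzero limit, so they and their inverses are bounded. The
bound is the domination in the limit leading to the triple product. -/
theorem exists_norm_qBinom_le {p : ℂ} (hp : ‖p‖ < 1) : ∃ C, ∀ n j, ‖qBinom p n j‖ ≤ C := by
  obtain ⟨C₁, hC₁⟩ := (Metric.isBounded_range_of_tendsto _ (tendsto_qFact hp)).exists_norm_le
  obtain ⟨C₂, hC₂⟩ := (Metric.isBounded_range_of_tendsto _
    ((tendsto_qFact hp).inv₀ (tprod_one_sub_pow_succ_ne_zero hp))).exists_norm_le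
  have h1 : ∀ n, ‖qFact p n‖ ≤ C₁ := fun n => hC₁ _ ⟨n, rfl⟩
  have h2 : ∀ n, ‖(qFact p n)⁻¹‖ ≤ C₂ := fun n => hC₂ _ ⟨n, rfl⟩
  have p1 : 0 ≤ C₁ := (norm_nonneg _).trans (h1 0)
  have p2 : 0 ≤ C₂ := (norm_nonneg _).trans (h2 0)
  refine ⟨C₁ * (C₂ * C₂), fun n j => ?_⟩
  rw [qBinom]
  split_ifs
  · rw [div_eq_mul_inv, mul_inv, norm_mul, norm_mul]
    exact mul_le_mul (h1 _) (mul_le_mul (h2 _) (h2 _) (norm_nonneg _) p2) (by positivity) p1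
  · rw [norm_zero]
    positivity

/-- Each factor 1 - y with y = e^{2πiu}p^{-j} equals -y(1 - 1/y); after reversing the order, the
monomials collect into the exponential. -/
theorem jacobiTheta₂_term_zero_sub_prod (u τ : ℂ) (N : ℕ) :
    ∏ k ∈ Finset.range N, (1 - exp (2 * Real.pi * I * (u - N * τ)) * exp (2 * Real.pi * I * τ) ^ k) =
      exp (Real.pi * I * N + 2 * Real.pi * I * u * N - Real.pi * I * τ * (N * (N + 1))) *
        ∏ k ∈ Finset.range N, (1 - exp (-(2 * Real.pi * I * u)) * exp (2 * Real.pi * I * τ) ^ (k + 1)) := by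
  rw [← Finset.prod_range_reflect]
  have h : ∀ M : ℕ, ∏ k ∈ Finset.range M, exp (Real.pi * I + 2 * Real.pi * I * u -
      2 * Real.pi * I * τ * (k + 1)) =
      exp (Real.pi * I * M + 2 * Real.pi * I * u * M - Real.pi * I * τ * (M * (M + 1))) := by
    intro M
    induction M with
    | zero => simp
    | succ M ih =>
      rw [Finset.prod_range_succ, ih, ← exp_add]
      push_cast
      ring_nf
  rw [← h N, ← Finset.prod_mul_distrib]
  refine Finset.prod_congr rfl fun k hk => ?_
  have hk' : k + 1 ≤ N := Finset.mem_range.1 hk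
  obtain ⟨d, rfl⟩ := Nat.exists_eq_add_of_le hk'
  rw [show k + 1 + d - 1 - k = d by omega, ← exp_nat_mul, ← exp_nat_mul, ← exp_add, ← exp_add,
    mul_sub (exp _), mul_one, ← exp_add]
  have e1 : exp (Real.pi * I + 2 * Real.pi * I * u - 2 * Real.pi * I * τ * (k + 1) +
      (-(2 * Real.pi * I * u) + ((k + 1 : ℕ) : ℂ) * (2 * Real.pi * I * τ))) = -1 := by
    rw [← exp_pi_mul_I]
    push_cast
    ring_nf
  have e2 : exp (Real.pi * I + 2 * Real.pi * I * u - 2 * Real.pi * I * τ * (k + 1)) =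
      -exp (2 * Real.pi * I * (u - ((k + 1 + d : ℕ) : ℂ) * τ) + d * (2 * Real.pi * I * τ)) := by
    rw [← neg_one_mul, ← exp_pi_mul_I, ← exp_add]
    push_cast
    ring_nf
  rw [e1, e2]
  ring

/-- Finite form of Jacobi's triple product. -/
theorem finite_tripleProduct (u : ℂ) {τ : ℂ} (hτ : 0 < τ.im) (N : ℕ) :
    (∏ k ∈ Finset.range N, (1 - exp (2 * Real.pi * I * u) * exp (2 * Real.pi * I * τ) ^ k)) *
      ∏ k ∈ Finset.range N, (1 - exp (-(2 * Real.pi * I * u)) * exp (2 * Real.pi * I * τ) ^ (k + 1)) =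
    ∑ j ∈ Finset.range (2 * N + 1), jacobiTheta₂_term ((j : ℤ) - N) (u + 1 / 2 - τ / 2) τ *
      qBinom (exp (2 * Real.pi * I * τ)) (2 * N) j := by
  have hp := norm_exp_two_pi_I_mul_lt_one hτ
  -- The q-binomial theorem with 2N factors, started at e^{2πiu}p^{-N}: half of the factors have
  -- negative powers of p, and the summation index is centred at N.
  have h := prod_one_sub_mul_pow hp (2 * N) (exp (2 * Real.pi * I * (u - N * τ)))
  rw [two_mul, Finset.prod_range_add, jacobiTheta₂_term_zero_sub_prod, ← two_mul] at h
  have h' : ∏ x ∈ Finset.range N, (1 - exp (2 * Real.pi * I * (u - N * τ)) *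
      exp (2 * Real.pi * I * τ) ^ (N + x)) =
      ∏ k ∈ Finset.range N, (1 - exp (2 * Real.pi * I * u) * exp (2 * Real.pi * I * τ) ^ k) := by
    refine Finset.prod_congr rfl fun k _ => ?_
    rw [← exp_nat_mul, ← exp_nat_mul, ← exp_add, ← exp_add]
    push_cast
    ring_nf
  rw [h'] at h
  have hE := exp_ne_zero (Real.pi * I * N + 2 * Real.pi * I * u * N - Real.pi * I * τ * (N * (N + 1)))
  apply mul_left_cancel₀ hE
  rw [mul_comm (∏ k ∈ Finset.range N, (1 - exp (2 * Real.pi * I * u) * _)), ← mul_assoc, h,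
    Finset.mul_sum]
  refine Finset.sum_congr rfl fun j _ => ?_
  have e : (-1 : ℂ) ^ j * exp (2 * Real.pi * I * τ) ^ j.choose 2 *
      exp (2 * Real.pi * I * (u - N * τ)) ^ j =
      exp (Real.pi * I * N + 2 * Real.pi * I * u * N - Real.pi * I * τ * (N * (N + 1))) *
        jacobiTheta₂_term ((j : ℤ) - N) (u + 1 / 2 - τ / 2) τ := by
    rw [← exp_pi_mul_I, ← exp_nat_mul, ← exp_nat_mul, ← exp_nat_mul, ← exp_add, ← exp_add,
      jacobiTheta₂_term, ← exp_add, Nat.cast_choose_two]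
    push_cast
    ring_nf
  linear_combination qBinom (exp (2 * Real.pi * I * τ)) (2 * N) j * e

/-- The coefficient is a quotient of three finite products whose lengths 2N, N+n, N-n all tend to
infinity, so the limit is P/(P·P). -/
theorem tendsto_qBinom_central {p : ℂ} (hp : ‖p‖ < 1) (n : ℤ) :
    Filter.Tendsto (fun N : ℕ => qBinom p (2 * N) ((N : ℤ) + n).toNat) Filter.atTop
      (nhds (∏' k : ℕ, (1 - p ^ (k + 1)))⁻¹) := by
  have hP := tprod_one_sub_pow_succ_ne_zero hp
  set P := ∏' k : ℕ, (1 - p ^ (k + 1))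
  have t1 : Filter.Tendsto (fun N : ℕ => 2 * N) Filter.atTop Filter.atTop :=
    Filter.tendsto_atTop_mono (fun N => (by omega : N ≤ 2 * N)) Filter.tendsto_id
  have t2 : ∀ n : ℤ, Filter.Tendsto (fun N : ℕ => ((N : ℤ) + n).toNat) Filter.atTop Filter.atTop := by
    intro n
    refine Filter.tendsto_atTop.2 fun b => ?_
    filter_upwards [Filter.eventually_ge_atTop (b + n.natAbs)] with N hN
    omega
  have hl := ((tendsto_qFact hp).comp t1).div
    (((tendsto_qFact hp).comp (t2 n)).mul ((tendsto_qFact hp).comp (t2 (-n)))) (mul_ne_zero hP hP)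
  rw [show P / (P * P) = P⁻¹ by field_simp] at hl
  refine hl.congr' ?_
  filter_upwards [Filter.eventually_ge_atTop n.natAbs] with N hN
  rw [qBinom, if_pos (by omega), show 2 * N - ((N : ℤ) + n).toNat = ((N : ℤ) + -n).toNat by omega]
  rfl

/-- Jacobi's triple product. -/
theorem tripleProduct (u : ℂ) {τ : ℂ} (hτ : 0 < τ.im) :
    qPoch τ * (qProd (fun k : ℕ => exp (2 * Real.pi * I * τ) ^ k) (exp (2 * Real.pi * I * u)) *
      qProd (fun k : ℕ => exp (2 * Real.pi * I * τ) ^ (k + 1)) (exp (-(2 * Real.pi * I * u)))) =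
    jacobiTheta₂ (u + 1 / 2 - τ / 2) τ := by
  have hp := norm_exp_two_pi_I_mul_lt_one hτ
  have hP := tprod_one_sub_pow_succ_ne_zero hp
  set p := exp (2 * Real.pi * I * τ) with hpdef
  have hlim1 := (multipliable_one_sub_mul (summable_norm_pow hp)
    (exp (2 * Real.pi * I * u))).hasProd.tendsto_prod_nat.mul
    (multipliable_one_sub_mul (summable_norm_pow_succ hp)
    (exp (-(2 * Real.pi * I * u)))).hasProd.tendsto_prod_nat
  obtain ⟨C, hC⟩ := exists_norm_qBinom_le hp
  have hC0 : 0 ≤ C := (norm_nonneg _).trans (hC 0 0)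
  let f : ℕ → ℤ → ℂ := fun N n => if n ∈ Finset.Icc (-(N : ℤ)) N then
    jacobiTheta₂_term n (u + 1 / 2 - τ / 2) τ * qBinom p (2 * N) ((N : ℤ) + n).toNat else 0
  have hlim2 : Filter.Tendsto (fun N => ∑' n, f N n) Filter.atTop
      (nhds (∑' n, jacobiTheta₂_term n (u + 1 / 2 - τ / 2) τ * (∏' k : ℕ, (1 - p ^ (k + 1)))⁻¹)) := by
    -- The theta series converges absolutely and the Gaussian binomials are uniformly bounded, so
    -- the limit may be taken termwise.
    refine tendsto_tsum_of_dominated_convergence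
      (bound := fun n => ‖jacobiTheta₂_term n (u + 1 / 2 - τ / 2) τ‖ * C)
      (((summable_jacobiTheta₂_term_iff _ _).2 hτ).norm.mul_right C) (fun n => ?_)
      (Filter.Eventually.of_forall fun N n => ?_)
    · refine ((tendsto_qBinom_central hp n).const_mul _).congr' ?_
      filter_upwards [Filter.eventually_ge_atTop n.natAbs] with N hN
      simp only [f]
      rw [if_pos (by rw [Finset.mem_Icc]; omega)]
    · simp only [f]
      split_ifs
      · rw [norm_mul]
        exact mul_le_mul_of_nonneg_left (hC _ _) (norm_nonneg _)
      · rw [norm_zero]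
        positivity
  have hfin : ∀ N, ∑' n, f N n = (∏ k ∈ Finset.range N, (1 - exp (2 * Real.pi * I * u) * p ^ k)) *
      ∏ k ∈ Finset.range N, (1 - exp (-(2 * Real.pi * I * u)) * p ^ (k + 1)) := by
    intro N
    rw [finite_tripleProduct u hτ N, tsum_eq_sum (s := Finset.Icc (-(N : ℤ)) N)
      (fun n hn => by simp only [f, if_neg hn])]
    symm
    refine Finset.sum_bij (fun j _ => (j : ℤ) - N) (fun j hj => ?_) (fun a _ b _ h => by omega)
      (fun n hn => ?_) (fun j hj => ?_)
    · rw [Finset.mem_range] at hj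
      rw [Finset.mem_Icc]
      omega
    · rw [Finset.mem_Icc] at hn
      exact ⟨((N : ℤ) + n).toNat, by rw [Finset.mem_range]; omega, by omega⟩
    · rw [Finset.mem_range] at hj
      simp only [f]
      rw [if_pos (by rw [Finset.mem_Icc]; omega)]
      congr 2
      omega
  simp only [hfin] at hlim2
  have := tendsto_nhds_unique hlim1 hlim2
  rw [tsum_mul_right] at this
  simp only [qProd, qPoch, ← hpdef, jacobiTheta₂]
  rw [this]
  field_simp

end tripleProduct

/-- The multiplicative theta function `∏ (1 - e^{2πiu}pᵏ)(1 - e^{-2πiu}pᵏ⁺¹)`. -/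
noncomputable def thetaMul (τ u : ℂ) : ℂ :=
  qProd (fun k : ℕ => exp (2 * Real.pi * I * τ) ^ k) (exp (2 * Real.pi * I * u)) *
    qProd (fun k : ℕ => exp (2 * Real.pi * I * τ) ^ (k + 1)) (exp (-(2 * Real.pi * I * u)))

theorem qPoch_ne_zero {τ : ℂ} (hτ : 0 < τ.im) : qPoch τ ≠ 0 :=
  tprod_one_sub_pow_succ_ne_zero (norm_exp_two_pi_I_mul_lt_one hτ)

theorem R_ne_zero {τ : ℂ} (hτ : 0 < τ.im) : R τ ≠ 0 :=
  div_ne_zero (exp_ne_zero _) (mul_ne_zero I_ne_zero (qPoch_ne_zero hτ))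

/-- The triple product, moved by one quasi-period to the argument used for θ₁. It links the series
to the product: the zeros of all theta functions are read off from it, and it converts the
functional equation of Γ into one in terms of θ₁. -/
theorem thetaMul_eq (u : ℂ) {τ : ℂ} (hτ : 0 < τ.im) :
    thetaMul τ u = R τ * exp (Real.pi * I * u) * theta1 u τ := by
  have h := tripleProduct u hτ
  have hP := qPoch_ne_zero hτ
  have h1 : theta1 u τ = I * exp (Real.pi * I * τ / 4 - Real.pi * I * u) *
      jacobiTheta₂ (u + 1 / 2 - τ / 2) τ := by
    rw [theta1_eq_jacobiTheta₂, show u + 1 / 2 + τ / 2 = u + 1 / 2 - τ / 2 + τ by ring,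
      jacobiTheta₂_add_left', ← mul_assoc, ← exp_add, ← neg_mul]
    congr 1
    rw [show (Real.pi * I * τ / 4 + Real.pi * I * (u + 1 / 2) +
      -Real.pi * I * (τ + 2 * (u + 1 / 2 - τ / 2)) : ℂ) =
      Real.pi * I * τ / 4 - Real.pi * I * u + -(Real.pi / 2 * I) by ring, exp_add, exp_neg (Real.pi / 2 * I),
      exp_pi_div_two_mul_I, inv_I]
    ring
  rw [h1, ← h, R, thetaMul]
  have e : exp (-(Real.pi * I * τ / 4)) * exp (Real.pi * I * u) *
      exp (Real.pi * I * τ / 4 - Real.pi * I * u) = 1 := by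
    rw [← exp_add, ← exp_add, ← exp_zero]
    ring_nf
  rw [show ∀ a b c d x : ℂ, a / (I * x) * b * (I * c * (x * d)) = a * b * c * (I / I) * (x / x) * d by
    intros; ring, e, div_self I_ne_zero, div_self hP]
  ring

theorem exp_two_pi_I_mul_eq_one_iff {u : ℂ} : exp (2 * Real.pi * I * u) = 1 ↔ ∃ n : ℤ, u = n := by
  rw [exp_eq_one_iff]
  refine exists_congr fun n => ?_
  rw [mul_comm (n : ℂ)]
  exact mul_right_inj' two_pi_I_ne_zero

theorem thetaMul_ne_zero {u τ : ℂ} (hτ : 0 < τ.im) (h : ∀ a c : ℤ, u ≠ a + c * τ) :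
    thetaMul τ u ≠ 0 := by
  have hp := norm_exp_two_pi_I_mul_lt_one hτ
  refine mul_ne_zero (qProd_ne_zero (summable_norm_pow hp) fun k hk => ?_)
    (qProd_ne_zero (summable_norm_pow_succ hp) fun k hk => ?_)
  · rw [← exp_nat_mul, ← exp_add, show 2 * Real.pi * I * u + k * (2 * Real.pi * I * τ) =
      2 * Real.pi * I * (u + k * τ) by ring, exp_two_pi_I_mul_eq_one_iff] at hk
    obtain ⟨a, ha⟩ := hk
    exact h a (-k) (by push_cast; linear_combination ha)
  · rw [← exp_nat_mul, ← exp_add, show -(2 * Real.pi * I * u) + ((k + 1 : ℕ) : ℂ) * (2 * Real.pi * I * τ) =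
      2 * Real.pi * I * (-u + ((k + 1 : ℕ) : ℂ) * τ) by ring, exp_two_pi_I_mul_eq_one_iff] at hk
    obtain ⟨a, ha⟩ := hk
    exact h (-a) (k + 1) (by push_cast at ha ⊢; linear_combination -ha)

theorem theta1_ne_zero {u τ : ℂ} (hτ : 0 < τ.im) (h : ∀ a c : ℤ, u ≠ a + c * τ) :
    theta1 u τ ≠ 0 := fun h0 => thetaMul_ne_zero hτ h (by rw [thetaMul_eq u hτ, h0, mul_zero])

theorem theta_ne_zero (k : Idx) {u h : ℂ} (hh : 0 < h.im)
    (hu : ∀ a c : ℤ, 2 * u ≠ a + c * h) : theta k u h ≠ 0 := by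
  cases k
  · refine mul_ne_zero (exp_ne_zero _) (theta1_ne_zero hh fun a c hac => ?_)
    exact hu (2 * a - 1) (2 * c - 1) (by push_cast; linear_combination 2 * hac)
  · refine mul_ne_zero (exp_ne_zero _) (theta1_ne_zero hh fun a c hac => ?_)
    exact hu (2 * a - 2) (2 * c - 1) (by push_cast; linear_combination 2 * hac)

/-- `θ₃` and `θ₄` have no common zero. -/
theorem theta3_ne_zero_or_theta4_ne_zero {u h : ℂ} (hh : 0 < h.im) :
    theta Idx.three u h ≠ 0 ∨ theta Idx.four u h ≠ 0 := by
  by_contra hcon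
  push Not at hcon
  obtain ⟨h3, h4⟩ := hcon
  have key : ∀ w : ℂ, theta1 w h = 0 → ∃ a c : ℤ, w = a + c * h := fun w hw => by
    by_contra hne
    push Not at hne
    exact theta1_ne_zero hh hne hw
  obtain ⟨a, c, h1⟩ := key _ ((mul_eq_zero.1 h3).resolve_left (exp_ne_zero _))
  obtain ⟨b, d, h2⟩ := key _ ((mul_eq_zero.1 h4).resolve_left (exp_ne_zero _))
  -- At a common zero two arguments of θ₁ differing by 1/2 would both lie in ℤ + ℤh. The imaginary
  -- part removes h, and then 1/2 would be an integer.
  have hd : (1 / 2 : ℂ) = ((b - a : ℤ) : ℂ) + ((d - c : ℤ) : ℂ) * h := by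
    push_cast
    linear_combination h2 - h1
  have him := congrArg Complex.im hd
  have h0 : ((1 / 2 : ℂ)).im = 0 := by simp
  rw [h0, add_im, intCast_im, zero_add, ← ofReal_intCast, im_ofReal_mul] at him
  have hz : ((d - c : ℤ) : ℝ) = 0 := by
    rcases mul_eq_zero.1 him.symm with h' | h'
    · exact h'
    · exact absurd h' hh.ne'
  have hz' : d - c = 0 := by exact_mod_cast hz
  rw [hz', Int.cast_zero, zero_mul, add_zero] at hd
  have : (1 : ℂ) = ((2 * (b - a) : ℤ) : ℂ) := by
    push_cast at hd ⊢
    linear_combination 2 * hd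
  have h5 : 1 = 2 * (b - a) := by exact_mod_cast this
  omega

/-! ### Genericity -/

/-- `1, 2η, τ` satisfy no linear relation over `ℤ`. -/
def Generic (τ η : ℂ) : Prop := ∀ a b c : ℤ, (a : ℂ) + b * (2 * η) + c * τ = 0 → a = 0 ∧ b = 0 ∧ c = 0

theorem generic_of_linearIndependent {τ η : ℂ} (h : LinearIndependent ℚ ![(1 : ℂ), 2 * η, τ]) :
    Generic τ η := by
  intro a b c habc
  rw [Fintype.linearIndependent_iff] at h
  have := h ![(a : ℚ), b, c] (by
    simp only [Fin.sum_univ_three, Matrix.cons_val_zero, Matrix.cons_val_one, Matrix.cons_val]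
    rw [← habc]
    simp only [Algebra.smul_def, eq_ratCast, Rat.cast_intCast, mul_one])
  have h0 := this 0
  have h1 := this 1
  have h2 := this 2
  simp only [Matrix.cons_val_zero, Matrix.cons_val_one, Matrix.cons_val] at h0 h1 h2
  exact ⟨by exact_mod_cast h0, by exact_mod_cast h1, by exact_mod_cast h2⟩

theorem Generic.swap {τ η : ℂ} (h : Generic τ η) : Generic (2 * η) (τ / 2) := by
  intro a b c habc
  obtain ⟨h1, h2, h3⟩ := h a c b (by linear_combination habc)
  exact ⟨h1, h3, h2⟩

theorem OffLattice.swap {τ η w : ℂ} (h : OffLattice τ η w) : OffLattice (2 * η) (τ / 2) w := by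
  intro a b c habc
  exact h a c b (by linear_combination habc)

theorem OffLattice.add {τ η w : ℂ} (h : OffLattice τ η w) (a b c : ℤ) {v : ℂ}
    (hv : v = w + a + b * (2 * η) + c * τ) : OffLattice τ η v := by
  intro a' b' c' habc
  exact h (a' - a) (b' - b) (c' - c) (by push_cast; linear_combination habc - hv)

theorem OffLattice.of_two_mul {τ η w : ℂ} (h : OffLattice τ η (2 * w)) : OffLattice τ η w := by
  intro a b c habc
  exact h (2 * a) (2 * b) (2 * c) (by push_cast; linear_combination 2 * habc)

theorem OffLattice.theta1_ne_zero {τ η w : ℂ} (hτ : 0 < τ.im) (h : OffLattice τ η w) :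
    theta1 w τ ≠ 0 :=
  EllipticDouble.theta1_ne_zero hτ fun a c hac => h a 0 c (by push_cast; linear_combination hac)

theorem Generic.theta1_ne_zero {τ η : ℂ} (hτ : 0 < τ.im) (h : Generic τ η) {j : ℕ} (hj : j ≠ 0) :
    theta1 (2 * η * j) τ ≠ 0 :=
  EllipticDouble.theta1_ne_zero hτ fun a c hac => by
    obtain ⟨-, h2, -⟩ := h (-a) j (-c) (by push_cast; linear_combination hac)
    exact hj (by exact_mod_cast h2)

/-! ### Difference operators -/

theorem gaussOp_apply (c : ℂ) (f : ℂ → ℂ) (z : ℂ) : gaussOp c f z = exp (c * z ^ 2) * f z := rfl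

theorem op_mul_apply (S T : Op) (f : ℂ → ℂ) : (S * T) f = S (T f) := rfl

theorem opA_apply (k : Idx) (τ η g : ℂ) (f : ℂ → ℂ) (z : ℂ) :
    opA k τ η g f z = exp (Real.pi * I / η * z ^ 2) * (cA τ η / theta1 (2 * z) τ *
      (theta k (z + g + η) (τ / 2) * (exp (-(Real.pi * I / η) * (z + η) ^ 2) * f (z + η)) -
        theta k (z - g - η) (τ / 2) * (exp (-(Real.pi * I / η) * (z - η) ^ 2) * f (z - η)))) := rfl

theorem sumOp_apply (τ η : ℂ) (n : ℕ) (f : ℂ → ℂ) (z : ℂ) :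
    sumOp τ η n f z = ∑ l ∈ Finset.range (n + 1),
      (-1) ^ l * alpha τ η n l z * f (z + ((n : ℂ) - 2 * l) * η) := by
  rw [sumOp, LinearMap.sum_apply, Finset.sum_apply]
  refine Finset.sum_congr rfl fun l _ => ?_
  rw [mul_assoc]
  rfl

theorem diffM_apply (τ η : ℂ) (n : ℕ) (f : ℂ → ℂ) (z : ℂ) :
    diffM τ η n f z = exp (Real.pi * I / η * z ^ 2) * ∑ l ∈ Finset.range (n + 1),
      (-1) ^ l * alpha τ η n l z * (exp (-(Real.pi * I / η) * (z + ((n : ℂ) - 2 * l) * η) ^ 2) *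
        f (z + ((n : ℂ) - 2 * l) * η)) := by
  rw [diffM, op_mul_apply, op_mul_apply, gaussOp_apply, sumOp_apply]
  rfl

theorem prodM_apply (τ η : ℂ) (n m : ℕ) (f : ℂ → ℂ) (z : ℂ) :
    prodM τ η n m f z =
      exp (-(Real.pi * I * τ / 2 * m ^ 2 * n) - Real.pi * I * η * n ^ 2 * m) *
      (exp (Real.pi * I * m / η * z ^ 2) * diffM τ η n
        (fun z => exp ((-(Real.pi * I * m / η) - 2 * Real.pi * I * n / τ) * z ^ 2) *
          diffM (2 * η) (τ / 2) m (fun z => exp (2 * Real.pi * I * n / τ * z ^ 2) * f z) z) z) := rfl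

/-- The second order of the factors is the first one with τ and 2η exchanged, so equality of the two
becomes a symmetry of `prodM`. -/
theorem prodM'_eq_prodM_swap (τ η : ℂ) (n m : ℕ) :
    prodM' τ η n m = prodM (2 * η) (τ / 2) m n := by
  rw [prodM', prodM, show 2 * (τ / 2) = τ by ring, show 2 * η / 2 = η by ring]
  have e1 : -(Real.pi * I * τ / 2 * m ^ 2 * n) - Real.pi * I * η * n ^ 2 * m =
      -(Real.pi * I * (2 * η) / 2 * n ^ 2 * m) - Real.pi * I * (τ / 2) * m ^ 2 * n := by ring
  have e2 : 2 * Real.pi * I * n / τ = Real.pi * I * n / (τ / 2) := by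
    rw [div_div_eq_mul_div]; ring
  have e3 : Real.pi * I * m / η = 2 * Real.pi * I * m / (2 * η) := by
    rw [mul_assoc 2, mul_assoc 2, mul_div_mul_left _ _ (two_ne_zero)]
  rw [e1, e2, e3]
  congr 3
  ring_nf

theorem diffM_congr {τ η : ℂ} {n : ℕ} {f f' : ℂ → ℂ} {z : ℂ}
    (h : ∀ l ∈ Finset.range (n + 1), f (z + ((n : ℂ) - 2 * l) * η) = f' (z + ((n : ℂ) - 2 * l) * η)) :
    diffM τ η n f z = diffM τ η n f' z := by
  rw [diffM_apply, diffM_apply]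
  congr 1
  exact Finset.sum_congr rfl fun l hl => by rw [h l hl]

/-- The identities hold only off a lattice, so functions have to be compared only at the points that
the shifts reach. -/
theorem prodM_congr {τ η : ℂ} {n m : ℕ} {f f' : ℂ → ℂ} {z : ℂ}
    (h : ∀ r s : ℤ, f (z + r * η + s * (τ / 2)) = f' (z + r * η + s * (τ / 2))) :
    prodM τ η n m f z = prodM τ η n m f' z := by
  rw [prodM_apply, prodM_apply]
  congr 2
  refine diffM_congr fun l _ => ?_
  congr 1
  refine diffM_congr fun j _ => ?_
  congr 1
  have := h (n - 2 * l) (m - 2 * j)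
  push_cast at this
  exact this

/-! ### Pascal recursion -/

section pascal

variable {τ η : ℂ}

/-- Common factor of the three terms in the Pascal recursion. -/
noncomputable def pascalFactor (τ η : ℂ) (n l : ℕ) (z : ℂ) : ℂ :=
  cA τ η ^ (n + 1) * ((∏ j ∈ Finset.Icc 1 n, theta1 (2 * η * j) τ) /
    ((∏ j ∈ Finset.Icc 1 l, theta1 (2 * η * j) τ) *
      ∏ j ∈ Finset.Icc 1 (n + 1 - l), theta1 (2 * η * j) τ)) *
    (theta1 (2 * z + 2 * η * ((n : ℂ) + 1 - 2 * l)) τ /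
      (∏ j ∈ Finset.range (n + 2), theta1 (2 * z - 2 * η * ((l : ℂ) - j)) τ) / theta1 (2 * z) τ)

/-- This and the next two lemmas write the three coefficients attached to the same shift (n+1-2l)η
as one common factor times a product of two θ₁. These products are those of `theta_pascal` at N =
(n+1)η, L = lη. -/
theorem alpha_succ_eq (n l : ℕ) {z : ℂ} (hz : theta1 (2 * z) τ ≠ 0) :
    alpha τ η (n + 1) l z =
      pascalFactor τ η n l z * (theta1 (2 * z) τ * theta1 (2 * ((n + 1) * η)) τ) := by
  rw [alpha, pascalFactor, ellBinom, Finset.prod_Icc_succ_top (by omega : 1 ≤ n + 1)]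
  rw [show 2 * η * ((n + 1 : ℕ) : ℂ) = 2 * ((n + 1) * η) by push_cast; ring]
  push_cast
  rw [show ∀ a b c d e f t : ℂ, a * (b / c) * (d / e / t) * (t * f) = a * (b * f / c) * (d / e) * (t / t)
    by intros; ring, div_self hz, mul_one]

theorem alpha_add_eq (hτ : 0 < τ.im) (hgen : Generic τ η) {n l : ℕ} (hl : l ≤ n) {z : ℂ}
    (hz : OffLattice τ η (2 * z)) :
    cA τ η / theta1 (2 * z) τ * alpha τ η n l (z + η) = pascalFactor τ η n l z *
      (theta1 (2 * ((n + 1) * η - l * η)) τ * theta1 (2 * (z - l * η)) τ) := by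
  obtain ⟨d, rfl⟩ := Nat.exists_eq_add_of_le hl
  have h1 : theta1 (2 * (z - l * η)) τ ≠ 0 :=
    (hz.add 0 (-l) 0 (by push_cast; ring)).theta1_ne_zero hτ
  have h2 : theta1 (2 * ((((l + d : ℕ) : ℂ) + 1) * η - l * η)) τ ≠ 0 := by
    have := hgen.theta1_ne_zero hτ (Nat.succ_ne_zero d)
    rwa [show 2 * ((((l + d : ℕ) : ℂ) + 1) * η - l * η) = 2 * η * ((d + 1 : ℕ) : ℂ) by
      push_cast; ring]
  rw [alpha, pascalFactor, ellBinom, show l + d - l = d by omega,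
    show l + d + 1 - l = d + 1 by omega, Finset.prod_Icc_succ_top (by omega : 1 ≤ d + 1),
    Finset.prod_range_succ' _ (l + d + 1)]
  rw [show 2 * η * ((d + 1 : ℕ) : ℂ) = 2 * ((((l + d : ℕ) : ℂ) + 1) * η - l * η) by push_cast; ring,
    show 2 * z - 2 * η * ((l : ℂ) - ((0 : ℕ) : ℂ)) = 2 * (z - l * η) by push_cast; ring,
    show 2 * (z + η) + 2 * η * (((l + d : ℕ) : ℂ) - 2 * l) =
      2 * z + 2 * η * (((l + d : ℕ) : ℂ) + 1 - 2 * l) by ring]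
  have h3 : ∏ j ∈ Finset.range (l + d + 1), theta1 (2 * (z + η) - 2 * η * ((l : ℂ) - j)) τ =
      ∏ j ∈ Finset.range (l + d + 1), theta1 (2 * z - 2 * η * ((l : ℂ) - ((j + 1 : ℕ) : ℂ))) τ :=
    Finset.prod_congr rfl fun j _ => by
      congr 1
      push_cast
      ring
  rw [h3]
  generalize theta1 (2 * ((((l + d : ℕ) : ℂ) + 1) * η - l * η)) τ = a at *
  generalize theta1 (2 * (z - l * η)) τ = b at *
  rw [show ∀ c t x y w u v : ℂ, c ^ (l + d + 1) * (x / (y * (w * a))) * (u / (v * b) / t) * (a * b) =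
    c / t * (c ^ (l + d) * (x / (y * w)) * (u / v)) * (a / a) * (b / b) by intros; ring, div_self h1,
    div_self h2, mul_one, mul_one]

theorem alpha_sub_eq (hτ : 0 < τ.im) (hgen : Generic τ η) {n l : ℕ} (hl : l ≤ n) {z : ℂ}
    (hz : OffLattice τ η (2 * z)) :
    cA τ η / theta1 (2 * z) τ * alpha τ η n l (z - η) = pascalFactor τ η n (l + 1) z *
      (theta1 (2 * (((l + 1 : ℕ) : ℂ) * η)) τ *
        theta1 (2 * (z + (n + 1) * η - ((l + 1 : ℕ) : ℂ) * η)) τ) := by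
  have h1 : theta1 (2 * (z + (n + 1) * η - ((l + 1 : ℕ) : ℂ) * η)) τ ≠ 0 :=
    (hz.add 0 (n - l) 0 (by push_cast; ring)).theta1_ne_zero hτ
  have h2 : theta1 (2 * (((l + 1 : ℕ) : ℂ) * η)) τ ≠ 0 := by
    have := hgen.theta1_ne_zero hτ (Nat.succ_ne_zero l)
    rwa [show 2 * (((l + 1 : ℕ) : ℂ) * η) = 2 * η * ((l + 1 : ℕ) : ℂ) by ring]
  rw [alpha, pascalFactor, ellBinom, show n + 1 - (l + 1) = n - l by omega,
    Finset.prod_Icc_succ_top (by omega : 1 ≤ l + 1), Finset.prod_range_succ _ (n + 1)]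
  rw [show 2 * η * ((l + 1 : ℕ) : ℂ) = 2 * (((l + 1 : ℕ) : ℂ) * η) by ring,
    show 2 * z - 2 * η * (((l + 1 : ℕ) : ℂ) - ((n + 1 : ℕ) : ℂ)) =
      2 * (z + (n + 1) * η - ((l + 1 : ℕ) : ℂ) * η) by push_cast; ring,
    show 2 * (z - η) + 2 * η * ((n : ℂ) - 2 * l) =
      2 * z + 2 * η * ((n : ℂ) + 1 - 2 * ((l + 1 : ℕ) : ℂ)) by push_cast; ring]
  have h3 : ∏ j ∈ Finset.range (n + 1), theta1 (2 * (z - η) - 2 * η * ((l : ℂ) - j)) τ =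
      ∏ j ∈ Finset.range (n + 1), theta1 (2 * z - 2 * η * (((l + 1 : ℕ) : ℂ) - j)) τ :=
    Finset.prod_congr rfl fun j _ => by
      congr 1
      push_cast
      ring
  rw [h3]
  generalize theta1 (2 * (z + (n + 1) * η - ((l + 1 : ℕ) : ℂ) * η)) τ = a at *
  generalize theta1 (2 * (((l + 1 : ℕ) : ℂ) * η)) τ = b at *
  rw [show ∀ c t x y w u v : ℂ, c ^ (n + 1) * (x / (y * b * w)) * (u / (v * a) / t) * (b * a) =
    c / t * (c ^ n * (x / (y * w)) * (u / v)) * (a / a) * (b / b) by intros; ring, div_self h1,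
    div_self h2, mul_one, mul_one]

theorem theta1_zero (τ : ℂ) : theta1 0 τ = 0 := by
  have := theta1_neg 0 τ
  rw [neg_zero] at this
  exact self_eq_neg.1 this

/-- Apply `theta_pascal` to each coefficient on the right and regroup: one part comes from z+η, the
other, with l moved by one, from z-η. The arbitrary `F` leaves room for the Gaussian. -/
theorem sum_pascal (hτ : 0 < τ.im) (hgen : Generic τ η) (k : Idx) (n : ℕ) (F : ℂ → ℂ) {z : ℂ}
    (hz : OffLattice τ η (2 * z)) :
    cA τ η / theta1 (2 * z) τ *
      (theta k (z + n * η + η) (τ / 2) * (∑ l ∈ Finset.range (n + 1),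
          (-1) ^ l * alpha τ η n l (z + η) * F (z + η + ((n : ℂ) - 2 * l) * η)) -
        theta k (z - n * η - η) (τ / 2) * (∑ l ∈ Finset.range (n + 1),
          (-1) ^ l * alpha τ η n l (z - η) * F (z - η + ((n : ℂ) - 2 * l) * η))) =
    ∑ l ∈ Finset.range (n + 2), (-1) ^ l * alpha τ η (n + 1) l z *
      (theta k (z + (((n + 1 : ℕ) : ℂ) - 2 * l) * η) (τ / 2) *
        F (z + (((n + 1 : ℕ) : ℂ) - 2 * l) * η)) := by
  have hz0 := hz.theta1_ne_zero hτ
  have key : ∀ l : ℕ, (-1 : ℂ) ^ l * alpha τ η (n + 1) l z *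
      (theta k (z + (((n + 1 : ℕ) : ℂ) - 2 * l) * η) (τ / 2) *
        F (z + (((n + 1 : ℕ) : ℂ) - 2 * l) * η)) =
      (-1) ^ l * pascalFactor τ η n l z * (theta k (z + (n + 1) * η) (τ / 2) *
        theta1 (2 * ((n + 1) * η - l * η)) τ * theta1 (2 * (z - l * η)) τ) *
        F (z + (((n + 1 : ℕ) : ℂ) - 2 * l) * η) +
      (-1) ^ l * pascalFactor τ η n l z * (theta k (z - (n + 1) * η) (τ / 2) *
        theta1 (2 * (l * η)) τ * theta1 (2 * (z + (n + 1) * η - l * η)) τ) *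
        F (z + (((n + 1 : ℕ) : ℂ) - 2 * l) * η) := fun l => by
    have h := theta_pascal k z ((n + 1) * η) (l * η) hτ
    rw [show z + (n + 1) * η - 2 * (l * η) = z + (((n + 1 : ℕ) : ℂ) - 2 * l) * η by
      push_cast; ring] at h
    rw [alpha_succ_eq n l hz0]
    linear_combination (-((-1) ^ l * pascalFactor τ η n l z *
      F (z + (((n + 1 : ℕ) : ℂ) - 2 * l) * η))) * h
  rw [Finset.sum_congr rfl fun l _ => key l, Finset.sum_add_distrib,
    Finset.sum_range_succ _ (n + 1), Finset.sum_range_succ' _ (n + 1)]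
  -- The superfluous end terms, l = n+1 in the first sum and l = 0 in the second, vanish because
  -- θ₁(0) = 0.
  have e1 : theta1 (2 * (((n : ℂ) + 1) * η - ((n + 1 : ℕ) : ℂ) * η)) τ = 0 := by
    rw [show 2 * (((n : ℂ) + 1) * η - ((n + 1 : ℕ) : ℂ) * η) = 0 by push_cast; ring, theta1_zero]
  have e2 : theta1 (2 * (((0 : ℕ) : ℂ) * η)) τ = 0 := by
    rw [show 2 * (((0 : ℕ) : ℂ) * η) = 0 by push_cast; ring, theta1_zero]
  rw [e1, e2]
  simp only [mul_zero, zero_mul, add_zero]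
  rw [mul_sub, sub_eq_add_neg]
  congr 1
  · rw [Finset.mul_sum, Finset.mul_sum]
    refine Finset.sum_congr rfl fun l hl => ?_
    have h := alpha_add_eq hτ hgen (Nat.lt_succ_iff.1 (Finset.mem_range.1 hl)) hz
    rw [show z + η + ((n : ℂ) - 2 * l) * η = z + (((n + 1 : ℕ) : ℂ) - 2 * l) * η by push_cast; ring,
      show z + n * η + η = z + (n + 1) * η by ring]
    linear_combination (theta k (z + (n + 1) * η) (τ / 2) * (-1) ^ l *
      F (z + (((n + 1 : ℕ) : ℂ) - 2 * l) * η)) * h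
  · rw [Finset.mul_sum, Finset.mul_sum, ← Finset.sum_neg_distrib]
    refine Finset.sum_congr rfl fun l hl => ?_
    have h := alpha_sub_eq hτ hgen (Nat.lt_succ_iff.1 (Finset.mem_range.1 hl)) hz
    rw [show z - η + ((n : ℂ) - 2 * l) * η =
      z + (((n + 1 : ℕ) : ℂ) - 2 * ((l + 1 : ℕ) : ℂ)) * η by push_cast; ring,
      show z - n * η - η = z - (n + 1) * η by ring, pow_succ]
    linear_combination (-(theta k (z - (n + 1) * η) (τ / 2) * (-1) ^ l *
      F (z + (((n + 1 : ℕ) : ℂ) - 2 * ((l + 1 : ℕ) : ℂ)) * η))) * h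

/-- `A_k(nη) M(nη) = M((n+1)η) θ_k`. -/
theorem opA_diffM (hτ : 0 < τ.im) (hgen : Generic τ η) (k : Idx) (n : ℕ) (f : ℂ → ℂ) {z : ℂ}
    (hz : OffLattice τ η (2 * z)) :
    opA k τ η (n * η) (diffM τ η n f) z =
      diffM τ η (n + 1) (fun z => theta k z (τ / 2) * f z) z := by
  have h := sum_pascal hτ hgen k n (fun z => exp (-(Real.pi * I / η) * z ^ 2) * f z) hz
  have hexp : ∀ w F : ℂ, exp (-(Real.pi * I / η) * w ^ 2) * (exp (Real.pi * I / η * w ^ 2) * F) = F :=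
    fun w F => by
      rw [← mul_assoc, ← exp_add, neg_mul, neg_add_cancel, exp_zero, one_mul]
  rw [opA_apply, diffM_apply, diffM_apply, diffM_apply, hexp, hexp, h]
  congr 1
  refine Finset.sum_congr rfl fun l _ => ?_
  ring

theorem alpha_zero_zero (hτ : 0 < τ.im) {z : ℂ} (hz : OffLattice τ η (2 * z)) :
    alpha τ η 0 0 z = 1 := by
  have := hz.theta1_ne_zero hτ
  simp [alpha, ellBinom, this]

theorem diffM_zero (hτ : 0 < τ.im) (f : ℂ → ℂ) {z : ℂ} (hz : OffLattice τ η (2 * z)) :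
    diffM τ η 0 f z = f z := by
  rw [diffM_apply, zero_add, Finset.sum_range_one, alpha_zero_zero hτ hz]
  simp only [Nat.cast_zero, mul_zero, sub_zero, zero_mul, add_zero, pow_zero, one_mul]
  rw [← mul_assoc, ← exp_add, neg_mul, add_neg_cancel, exp_zero, one_mul]

end pascal

/-! ### Factorization of the difference operators -/

section factorization

variable {τ η : ℂ}

theorem ne_zero_of_im_pos {a : ℂ} (h : 0 < a.im) : a ≠ 0 := fun h0 => by simp [h0] at h

/-- Shifting the spin of `A_k` by `mτ/2` is a conjugation by a Gaussian. -/
theorem opA_add_half_period (hη : η ≠ 0) (k : Idx) (g : ℂ) (m : ℕ) (f : ℂ → ℂ) (z : ℂ) :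
    opA k τ η (g + m * (τ / 2)) f z =
      k.sign ^ m * exp (-(Real.pi * I * m ^ 2 * (τ / 2)) - 2 * Real.pi * I * m * g -
        Real.pi * I * m * η) *
      (exp (Real.pi * I * m / η * z ^ 2) *
        opA k τ η g (fun z => exp (-(Real.pi * I * m / η) * z ^ 2) * f z) z) := by
  have h1 := theta_add_int_mul k m (z + g + η) (τ / 2)
  have h2 := theta_add_int_mul k (-m) (z - g - η) (τ / 2)
  rw [zpow_neg, zpow_natCast] at h2
  rw [zpow_natCast] at h1
  push_cast at h1 h2
  have hs : (k.sign ^ m)⁻¹ = k.sign ^ m := by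
    refine inv_eq_of_mul_eq_one_left ?_
    rw [← mul_pow, k.sign_mul_self, one_pow]
  rw [hs] at h2
  rw [opA_apply, opA_apply, show z + (g + m * (τ / 2)) + η = z + g + η + m * (τ / 2) by ring,
    show z - (g + m * (τ / 2)) - η = z - g - η + -m * (τ / 2) by ring, h1, h2]
  -- The Gaussian at z+η and z-η reproduces the z-dependence of the multipliers of θ_k(z+g+η) and
  -- θ_k(z-g-η); the same constant remains in both.
  have e1 : exp (-(Real.pi * I * m ^ 2 * (τ / 2)) - 2 * Real.pi * I * m * (z + g + η)) =
      exp (-(Real.pi * I * m ^ 2 * (τ / 2)) - 2 * Real.pi * I * m * g - Real.pi * I * m * η) *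
        (exp (Real.pi * I * m / η * z ^ 2) * exp (-(Real.pi * I * m / η) * (z + η) ^ 2)) := by
    rw [← exp_add, ← exp_add]
    congr 1
    field_simp
    ring
  have e2 : exp (-(Real.pi * I * (-m) ^ 2 * (τ / 2)) - 2 * Real.pi * I * (-m) * (z - g - η)) =
      exp (-(Real.pi * I * m ^ 2 * (τ / 2)) - 2 * Real.pi * I * m * g - Real.pi * I * m * η) *
        (exp (Real.pi * I * m / η * z ^ 2) * exp (-(Real.pi * I * m / η) * (z - η) ^ 2)) := by
    rw [← exp_add, ← exp_add]
    congr 1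
    field_simp
    ring
  rw [e1, e2]
  ring

theorem opA_congr {k : Idx} {g : ℂ} {f f' : ℂ → ℂ} {z : ℂ} (h1 : f (z + η) = f' (z + η))
    (h2 : f (z - η) = f' (z - η)) : opA k τ η g f z = opA k τ η g f' z := by
  rw [opA_apply, opA_apply, h1, h2]

theorem opA_const_mul (k : Idx) (g c : ℂ) (f : ℂ → ℂ) (z : ℂ) :
    opA k τ η g (fun z => c * f z) z = c * opA k τ η g f z := by
  rw [opA_apply, opA_apply]
  ring

theorem diffM_const_mul (n : ℕ) (c : ℂ) (f : ℂ → ℂ) (z : ℂ) :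
    diffM τ η n (fun z => c * f z) z = c * diffM τ η n f z := by
  rw [diffM_apply, diffM_apply, mul_left_comm, Finset.mul_sum (a := c)]
  congr 1
  exact Finset.sum_congr rfl fun l _ => by ring

/-- `e^{2πiz²/τ} θ_k(z|τ/2)` is periodic up to sign, hence commutes with `M(mτ/2)` up to sign. -/
theorem diffM_mul_theta (hτ : τ ≠ 0) (k : Idx) (m : ℕ) (f : ℂ → ℂ) (z : ℂ) :
    diffM (2 * η) (τ / 2) m
      (fun z => exp (2 * Real.pi * I / τ * z ^ 2) * theta k z (τ / 2) * f z) z =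
    k.sign ^ m * (exp (2 * Real.pi * I / τ * z ^ 2) * theta k z (τ / 2)) *
      diffM (2 * η) (τ / 2) m f z := by
  rw [diffM_apply, diffM_apply, mul_left_comm, Finset.mul_sum (a := k.sign ^ m * _)]
  congr 1
  refine Finset.sum_congr rfl fun l _ => ?_
  have h := theta_add_int_mul k (m - 2 * l) z (τ / 2)
  -- All shifts m-2l have the parity of m, so one sign serves the whole sum.
  have hs : k.sign ^ ((m : ℤ) - 2 * l) = k.sign ^ m := by
    rw [sub_eq_add_neg, zpow_add₀ k.sign_ne_zero, zpow_natCast, ← mul_neg, zpow_mul, zpow_ofNat, pow_two,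
      k.sign_mul_self, one_zpow, mul_one]
  rw [hs] at h
  push_cast at h
  have e : exp (2 * Real.pi * I / τ * (z + ((m : ℂ) - 2 * l) * (τ / 2)) ^ 2) *
      exp (-(Real.pi * I * ((m : ℂ) - 2 * l) ^ 2 * (τ / 2)) -
        2 * Real.pi * I * ((m : ℂ) - 2 * l) * z) = exp (2 * Real.pi * I / τ * z ^ 2) := by
    rw [← exp_add]
    congr 1
    field_simp
    ring
  rw [h, ← e]
  ring

/-- The operator to the right of `M(nη)` in the factorization. -/
theorem gauss_diffM_theta (hτ : τ ≠ 0) (k : Idx) (n m : ℕ) (f : ℂ → ℂ) (z : ℂ) :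
    exp (-(2 * Real.pi * I * ((n + 1 : ℕ) : ℂ) / τ) * z ^ 2) * diffM (2 * η) (τ / 2) m
      (fun z => exp (2 * Real.pi * I * ((n + 1 : ℕ) : ℂ) / τ * z ^ 2) * (theta k z (τ / 2) * f z)) z =
    k.sign ^ m * theta k z (τ / 2) * (exp (-(2 * Real.pi * I * n / τ) * z ^ 2) *
      diffM (2 * η) (τ / 2) m (fun z => exp (2 * Real.pi * I * n / τ * z ^ 2) * f z) z) := by
  have h := diffM_mul_theta (η := η) hτ k m (fun z => exp (2 * Real.pi * I * n / τ * z ^ 2) * f z) z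
  have e : (fun z => exp (2 * Real.pi * I * ((n + 1 : ℕ) : ℂ) / τ * z ^ 2) * (theta k z (τ / 2) * f z)) =
      fun z => exp (2 * Real.pi * I / τ * z ^ 2) * theta k z (τ / 2) *
        (exp (2 * Real.pi * I * n / τ * z ^ 2) * f z) := by
    funext w
    rw [show 2 * Real.pi * I * ((n + 1 : ℕ) : ℂ) / τ * w ^ 2 =
      2 * Real.pi * I / τ * w ^ 2 + 2 * Real.pi * I * n / τ * w ^ 2 by push_cast; ring, exp_add]
    ring
  have e2 : exp (-(2 * Real.pi * I * ((n + 1 : ℕ) : ℂ) / τ) * z ^ 2) * exp (2 * Real.pi * I / τ * z ^ 2) =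
      exp (-(2 * Real.pi * I * n / τ) * z ^ 2) := by
    rw [← exp_add]
    push_cast
    ring_nf
  rw [e, h, ← e2]
  ring

theorem prodM_apply' (n m : ℕ) (f : ℂ → ℂ) (z : ℂ) :
    prodM τ η n m f z =
      exp (-(Real.pi * I * τ / 2 * m ^ 2 * n) - Real.pi * I * η * n ^ 2 * m) *
      (exp (Real.pi * I * m / η * z ^ 2) * diffM τ η n
        (fun z => exp (-(Real.pi * I * m / η) * z ^ 2) * (exp (-(2 * Real.pi * I * n / τ) * z ^ 2) *
          diffM (2 * η) (τ / 2) m (fun z => exp (2 * Real.pi * I * n / τ * z ^ 2) * f z) z)) z) := by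
  rw [prodM_apply]
  congr 2
  refine diffM_congr fun l _ => ?_
  rw [← mul_assoc (exp _) (exp _), ← exp_add]
  ring_nf

/-- `A_k(nη + mτ/2) M(nη + mτ/2) = M((n+1)η + mτ/2) θ_k` for the factorized difference operators. -/
theorem opA_prodM (hτ : 0 < τ.im) (hη : 0 < η.im) (hgen : Generic τ η) (k : Idx) (n m : ℕ)
    (f : ℂ → ℂ) {z : ℂ} (hz : OffLattice τ η (2 * z)) :
    opA k τ η (n * η + m * (τ / 2)) (prodM τ η n m f) z =
      prodM τ η (n + 1) m (fun z => theta k z (τ / 2) * f z) z := by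
  have hη0 := ne_zero_of_im_pos hη
  have hτ0 := ne_zero_of_im_pos hτ
  let h : ℂ → ℂ := fun z => exp (-(2 * Real.pi * I * n / τ) * z ^ 2) *
    diffM (2 * η) (τ / 2) m (fun z => exp (2 * Real.pi * I * n / τ * z ^ 2) * f z) z
  let G : ℂ → ℂ := fun z => exp (-(Real.pi * I * m / η) * z ^ 2) * h z
  have hG : ∀ w F : ℂ, exp (-(Real.pi * I * m / η) * w ^ 2) *
      (exp (Real.pi * I * m / η * w ^ 2) * F) = F := fun w F => by
    rw [← mul_assoc, ← exp_add, neg_mul, neg_add_cancel, exp_zero, one_mul]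
  have h1 : ∀ w, prodM τ η n m f w =
      exp (-(Real.pi * I * τ / 2 * m ^ 2 * n) - Real.pi * I * η * n ^ 2 * m) *
        (exp (Real.pi * I * m / η * w ^ 2) * diffM τ η n G w) := fun w => prodM_apply' n m f w
  have h2 : (fun z => exp (-(Real.pi * I * m / η) * z ^ 2) * prodM τ η n m f z) =
      fun z => exp (-(Real.pi * I * τ / 2 * m ^ 2 * n) - Real.pi * I * η * n ^ 2 * m) *
        diffM τ η n G z := by
    funext w
    rw [h1, mul_left_comm, hG]
  -- The half-period part of the spin becomes a Gaussian conjugation, after which `opA_diffM` raises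
  -- n. On the other side the new θ_k is pulled out of M(mτ/2), which costs the same sign.
  rw [opA_add_half_period hη0, h2, opA_const_mul, opA_diffM hτ hgen k n G hz, prodM_apply']
  simp only [gauss_diffM_theta hτ0]
  have h3 : (fun z => exp (-(Real.pi * I * m / η) * z ^ 2) * (k.sign ^ m * theta k z (τ / 2) *
      (exp (-(2 * Real.pi * I * n / τ) * z ^ 2) * diffM (2 * η) (τ / 2) m
        (fun z => exp (2 * Real.pi * I * n / τ * z ^ 2) * f z) z))) =
      fun z => k.sign ^ m * (theta k z (τ / 2) * G z) := by
    funext w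
    simp only [G, h]
    ring
  rw [h3, diffM_const_mul]
  have e : exp (-(Real.pi * I * τ / 2 * m ^ 2 * ((n + 1 : ℕ) : ℂ)) -
      Real.pi * I * η * ((n + 1 : ℕ) : ℂ) ^ 2 * m) =
      exp (-(Real.pi * I * m ^ 2 * (τ / 2)) - 2 * Real.pi * I * m * (n * η) - Real.pi * I * m * η) *
      exp (-(Real.pi * I * τ / 2 * m ^ 2 * n) - Real.pi * I * η * n ^ 2 * m) := by
    rw [← exp_add]
    push_cast
    ring_nf
  rw [e]
  ring

/-- Iteration of `opA_prodM`: each factor A_k leaves one θ_k(·|τ/2) on the right, which the power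
θ_k^{-n} in `factM` compensates. -/
theorem descProd_opA (hτ : 0 < τ.im) (hη : 0 < η.im) (hgen : Generic τ η) (k : Idx) (n m : ℕ)
    (f : ℂ → ℂ) {z : ℂ} (hz : OffLattice τ η (2 * z)) :
    descProd (fun j => opA k τ η (j * η + m * (τ / 2))) n (prodM τ η 0 m f) z =
      prodM τ η n m (fun z => theta k z (τ / 2) ^ n * f z) z := by
  induction n generalizing z with
  | zero => simp only [descProd, pow_zero, one_mul, Module.End.one_apply]
  | succ n ih =>
    rw [descProd, op_mul_apply, opA_congr (ih (hz.add 0 1 0 (by push_cast; ring)))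
      (ih (hz.add 0 (-1) 0 (by push_cast; ring))), opA_prodM hτ hη hgen k n m _ hz]
    refine prodM_congr fun r s => ?_
    ring

theorem prodM_zero_left (hτ : 0 < τ.im) (m : ℕ) (f : ℂ → ℂ) {z : ℂ}
    (hz : OffLattice τ η (2 * z)) :
    prodM τ η 0 m f z = diffM (2 * η) (τ / 2) m f z := by
  rw [prodM_apply', diffM_zero hτ _ hz]
  simp only [Nat.cast_zero, mul_zero, zero_mul, zero_div, neg_zero, exp_zero, one_mul, ne_eq,
    OfNat.ofNat_ne_zero, not_false_eq_true, zero_pow, sub_zero]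
  rw [← mul_assoc, ← exp_add, neg_mul, add_neg_cancel, exp_zero, one_mul]

theorem prodM_zero_right (hη : 0 < η.im) (n : ℕ) (f : ℂ → ℂ) {z : ℂ}
    (hz : OffLattice τ η (2 * z)) :
    prodM τ η n 0 f z = diffM τ η n f z := by
  rw [prodM_apply']
  simp only [Nat.cast_zero, mul_zero, zero_mul, zero_div, neg_zero, exp_zero, one_mul, ne_eq,
    OfNat.ofNat_ne_zero, not_false_eq_true, zero_pow, sub_zero]
  refine diffM_congr fun l _ => ?_
  have hz' : OffLattice τ η (2 * (z + ((n : ℂ) - 2 * l) * η)) :=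
    hz.add 0 (n - 2 * l) 0 (by push_cast; ring)
  rw [diffM_zero (by simpa using hη) _ hz'.swap, ← mul_assoc, ← exp_add, neg_mul, neg_add_cancel,
    exp_zero, one_mul]

/-- Quasi-periodicity of the coefficients `α_l^{(n)}`. -/
theorem alpha_add_half_period (n l : ℕ) (s : ℤ) (z : ℂ) :
    alpha τ η n l (z + s * (τ / 2)) = (-1) ^ (s * n) *
      exp (Real.pi * I * s ^ 2 * τ * n +
        2 * Real.pi * I * s * (2 * n * z + η * ((n : ℂ) - 2 * l) * (n - 1))) * alpha τ η n l z := by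
  have h1 := theta1_add_int_mul s (2 * z + 2 * η * ((n : ℂ) - 2 * l)) τ
  -- The multipliers of the denominator, for any number of factors; N(N-1)/2 is the sum of the
  -- indices.
  have h2 : ∀ N : ℕ, ∏ j ∈ Finset.range N, theta1 (2 * (z + s * (τ / 2)) - 2 * η * ((l : ℂ) - j)) τ =
      (-1) ^ (s * N) * exp (-(Real.pi * I * s ^ 2 * τ) * N - 2 * Real.pi * I * s *
        (2 * z * N - 2 * η * (l * N - N * (N - 1) / 2))) *
      ∏ j ∈ Finset.range N, theta1 (2 * z - 2 * η * ((l : ℂ) - j)) τ := by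
    intro N
    induction N with
    | zero => simp
    | succ N ih =>
      have h3 := theta1_add_int_mul s (2 * z - 2 * η * ((l : ℂ) - N)) τ
      rw [Finset.prod_range_succ, Finset.prod_range_succ, ih,
        show 2 * (z + s * (τ / 2)) - 2 * η * ((l : ℂ) - N) =
          2 * z - 2 * η * ((l : ℂ) - N) + s * τ by ring, h3]
      push_cast
      rw [mul_add, mul_one, zpow_add₀ (by norm_num)]
      rw [show ∀ a b c d e f : ℂ, a * b * c * (d * e * f) = a * d * (b * e) * (c * f) by intros; ring,
        ← exp_add]
      congr 3
      ring
  rw [alpha, alpha, show 2 * (z + s * (τ / 2)) + 2 * η * ((n : ℂ) - 2 * l) =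
    2 * z + 2 * η * ((n : ℂ) - 2 * l) + s * τ by ring, h1, h2 (n + 1)]
  push_cast
  have hsn : (-1 : ℂ) ^ (s * ((n : ℤ) + 1)) = (-1) ^ (s * (n : ℤ)) * (-1) ^ s := by
    rw [mul_add s, mul_one, zpow_add₀ (by norm_num)]
  have hs : ((-1 : ℂ) ^ (s * (n : ℤ)))⁻¹ = (-1) ^ (s * (n : ℤ)) := by
    rw [← inv_zpow, inv_neg, inv_one]
  have hs0 : (-1 : ℂ) ^ s ≠ 0 := zpow_ne_zero _ (by norm_num)
  set E := exp (-(Real.pi * I * s ^ 2 * τ) * (n + 1) - 2 * Real.pi * I * s *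
    (2 * z * (n + 1) - 2 * η * (l * (n + 1) - (n + 1) * (n + 1 - 1) / 2))) with hE
  have e : exp (-(Real.pi * I * s ^ 2 * τ) - 2 * Real.pi * I * s * (2 * z + 2 * η * ((n : ℂ) - 2 * l))) =
      exp (Real.pi * I * s ^ 2 * τ * n +
        2 * Real.pi * I * s * (2 * n * z + η * ((n : ℂ) - 2 * l) * (n - 1))) * E := by
    rw [hE, ← exp_add]
    congr 1
    ring
  have hE0 : E ≠ 0 := exp_ne_zero _
  rw [e, hsn]
  rw [show ∀ c B a X T b P : ℂ, c * B * (a * (X * E) * T / (b * a * E * P)) =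
    b⁻¹ * X * (c * B * (T / P)) * (a / a) * (E / E) by intros; ring, div_self hs0, div_self hE0, mul_one,
    mul_one, hs]

/-- The coefficients of the factorized difference operator `prodM`. -/
noncomputable def prodCoeff (τ η : ℂ) (n m l j : ℕ) (z : ℂ) : ℂ :=
  exp (-(Real.pi * I * τ / 2 * m ^ 2 * n) - Real.pi * I * η * n ^ 2 * m) *
    ((-1) ^ l * (-1) ^ j) * (alpha τ η n l z * alpha (2 * η) (τ / 2) m j (z + ((n : ℂ) - 2 * l) * η)) *
    exp (Real.pi * I * m / η * z ^ 2 + Real.pi * I / η * z ^ 2 -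
      Real.pi * I / η * (z + ((n : ℂ) - 2 * l) * η) ^ 2 +
      (-(Real.pi * I * m / η) - 2 * Real.pi * I * n / τ) * (z + ((n : ℂ) - 2 * l) * η) ^ 2 +
      Real.pi * I / (τ / 2) * (z + ((n : ℂ) - 2 * l) * η) ^ 2 -
      Real.pi * I / (τ / 2) * (z + ((n : ℂ) - 2 * l) * η + ((m : ℂ) - 2 * j) * (τ / 2)) ^ 2 +
      2 * Real.pi * I * n / τ * (z + ((n : ℂ) - 2 * l) * η + ((m : ℂ) - 2 * j) * (τ / 2)) ^ 2)

theorem prodM_eq_sum (n m : ℕ) (f : ℂ → ℂ) (z : ℂ) :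
    prodM τ η n m f z = ∑ l ∈ Finset.range (n + 1), ∑ j ∈ Finset.range (m + 1),
      prodCoeff τ η n m l j z * f (z + ((n : ℂ) - 2 * l) * η + ((m : ℂ) - 2 * j) * (τ / 2)) := by
  rw [prodM_apply, diffM_apply]
  simp only [diffM_apply, Finset.mul_sum]
  refine Finset.sum_congr rfl fun l _ => Finset.sum_congr rfl fun j _ => ?_
  simp only [prodCoeff, exp_add, sub_eq_add_neg, neg_mul]
  ring

/-- The coefficients do not depend on the order of the two factors. -/
theorem prodCoeff_swap (hτ : τ ≠ 0) (hη : η ≠ 0) (n m l j : ℕ) (z : ℂ) :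
    prodCoeff (2 * η) (τ / 2) m n j l z = prodCoeff τ η n m l j z := by
  -- In each order one coefficient is evaluated at a point shifted by the other operator. Both
  -- shifts are by half-periods of the coefficient in question, and both signs are (-1)^{nm}, so
  -- only exponents remain to be compared.
  have h1 := alpha_add_half_period (τ := τ) (η := η) n l ((m : ℤ) - 2 * j) z
  have h2 := alpha_add_half_period (τ := 2 * η) (η := τ / 2) m j ((n : ℤ) - 2 * l) z
  have h22 : 2 * (τ / 2) = τ := by ring
  have h23 : 2 * η / 2 = η := by ring
  rw [h23] at h2
  push_cast at h1 h2
  have hs : ∀ a b c : ℕ, (-1 : ℂ) ^ (((a : ℤ) - 2 * b) * c) = (-1) ^ (a * c) := fun a b c => by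
    rw [show ((a : ℤ) - 2 * b) * c = (a * c : ℕ) + 2 * (-(b * c)) by push_cast; ring,
      zpow_add₀ (by norm_num), zpow_mul, zpow_natCast]
    norm_num
  rw [hs] at h1 h2
  rw [prodCoeff, prodCoeff, h22, h23, h1, h2, mul_comm n m]
  rw [show ∀ a b x y e A B E : ℂ, a * (b * x) * (A * (y * e * B)) * E = b * x * y * (A * B) * (a * e * E)
    by intros; ring, show ∀ a b x y e A B E : ℂ, a * (x * b) * (B * (y * e * A)) * E =
    b * x * y * (A * B) * (a * e * E) by intros; ring, ← exp_add, ← exp_add, ← exp_add, ← exp_add]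
  congr 2
  field_simp
  ring

theorem prodM'_eq_prodM (hτ : τ ≠ 0) (hη : η ≠ 0) (n m : ℕ) : prodM' τ η n m = prodM τ η n m := by
  refine LinearMap.ext fun f => funext fun z => ?_
  rw [prodM'_eq_prodM_swap, prodM_eq_sum, prodM_eq_sum, Finset.sum_comm]
  refine Finset.sum_congr rfl fun l _ => Finset.sum_congr rfl fun j _ => ?_
  rw [prodCoeff_swap hτ hη, show 2 * η / 2 = η by ring]
  congr 2
  ring

theorem descProd_congr {T T' : ℕ → Op} (h : ∀ j, T j = T' j) (n : ℕ) :
    descProd T n = descProd T' n := by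
  induction n with
  | zero => rfl
  | succ n ih => rw [descProd, descProd, ih, h]

theorem descProd_opA_congr {k : Idx} {g : ℕ → ℂ} (n : ℕ) {f f' : ℂ → ℂ}
    (h : ∀ z, OffLattice τ η (2 * z) → f z = f' z) {z : ℂ} (hz : OffLattice τ η (2 * z)) :
    descProd (fun j => opA k τ η (g j)) n f z = descProd (fun j => opA k τ η (g j)) n f' z := by
  induction n generalizing z with
  | zero => exact h z hz
  | succ n ih =>
    rw [descProd, op_mul_apply, op_mul_apply]
    exact opA_congr (ih (hz.add 0 1 0 (by push_cast; ring)))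
      (ih (hz.add 0 (-1) 0 (by push_cast; ring)))

theorem descProd_opA_eq_diffM (hτ : 0 < τ.im) (hη : 0 < η.im) (hgen : Generic τ η) (k : Idx) (n : ℕ)
    (f : ℂ → ℂ) {z : ℂ} (hz : OffLattice τ η (2 * z)) :
    descProd (fun j => opA k τ η (j * η)) n f z =
      diffM τ η n (fun z => theta k z (τ / 2) ^ n * f z) z := by
  have h := descProd_opA hτ hη hgen k n 0 f hz
  rw [prodM_zero_right hη _ _ hz, descProd_congr (T' := fun j => opA k τ η (j * η))
    (fun j => by rw [Nat.cast_zero, zero_mul, add_zero])] at h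
  rw [← h]
  refine descProd_opA_congr n (fun w hw => ?_) hz
  rw [prodM_zero_left hτ _ _ hw, diffM_zero (by simpa using hη) _ hw.swap]

theorem theta_half_ne_zero (hτ : 0 < τ.im) (k : Idx) {z : ℂ} (hz : OffLattice τ η (4 * z)) :
    theta k z (τ / 2) ≠ 0 :=
  theta_ne_zero k (half_im_pos hτ) fun a c hac =>
    hz (2 * a) 0 c (by push_cast; linear_combination 2 * hac)

theorem theta_eta_ne_zero (hη : 0 < η.im) (k : Idx) {z : ℂ} (hz : OffLattice τ η (4 * z)) :
    theta k z η ≠ 0 :=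
  theta_ne_zero k hη fun a c hac =>
    hz (2 * a) c 0 (by push_cast; linear_combination 2 * hac)

/-- The factored operator coincides with the factorized difference operator. -/
theorem factM_eq_prodM (hτ : 0 < τ.im) (hη : 0 < η.im) (hgen : Generic τ η) (k : Idx) (n m : ℕ)
    (f : ℂ → ℂ) {z : ℂ} (hz : OffLattice τ η (4 * z)) :
    factM k τ η n m f z = prodM τ η n m f z := by
  have hη2 : 0 < (2 * η).im := by simpa using hη
  have hz2 : OffLattice τ η (2 * z) := OffLattice.of_two_mul (by rwa [← mul_assoc, show (2 : ℂ) * 2 = 4 by norm_num])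
  let G : ℂ → ℂ := fun z => (theta k z η)⁻¹ ^ m * ((theta k z (τ / 2))⁻¹ ^ n * f z)
  have h1 : factM k τ η n m f z = descProd (fun j => opA k τ η (j * η + m * (τ / 2))) n
      (descProd (fun j => opA k (2 * η) (τ / 2) (j * (τ / 2))) m G) z := rfl
  rw [h1, descProd_opA_congr n (f' := prodM τ η 0 m fun z => theta k z η ^ m * G z) _ hz2,
    descProd_opA hτ hη hgen k n m _ hz2]
  · refine prodM_congr fun r s => ?_
    -- Every point reached from z keeps 4w off the lattice, so the theta functions being inverted
    -- are nonzero and the powers really cancel.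
    have hw : OffLattice τ η (4 * (z + r * η + s * (τ / 2))) :=
      hz.add 0 (2 * r) (2 * s) (by push_cast; ring)
    have h2 := theta_half_ne_zero hτ k hw
    have h3 := theta_eta_ne_zero hη k hw
    simp only [G]
    generalize z + r * η + s * (τ / 2) = w at *
    rw [inv_pow, inv_pow]
    field_simp
  · intro w hw
    rw [prodM_zero_left hτ _ _ hw,
      descProd_opA_eq_diffM hη2 (half_im_pos hτ) hgen.swap k m G hw.swap, show 2 * η / 2 = η by ring]

end factorization

/-! ### Circle averages -/

section circle

open Real (circleAverage)

/-- Holomorphic dependence of an integral on a parameter. -/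
theorem differentiableOn_intervalIntegral_param {U : Set ℂ} (hU : IsOpen U) {f : ℂ → ℝ → ℂ} {a b : ℝ}
    (hc : ContinuousOn (fun p : ℂ × ℝ => f p.1 p.2) (U ×ˢ Set.uIcc a b))
    (hd : ∀ t ∈ Set.uIcc a b, DifferentiableOn ℂ (fun g => f g t) U) :
    DifferentiableOn ℂ (fun g => ∫ t in a..b, f g t) U := by
  intro x₀ hx₀
  obtain ⟨ε, hε, hball⟩ := Metric.isOpen_iff.1 hU x₀ hx₀
  set r := ε / 3 with hr
  have hr0 : 0 < r := by positivity
  have hsub : Metric.closedBall x₀ (2 * r) ⊆ U := fun x hx =>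
    hball (Metric.mem_ball.2 (lt_of_le_of_lt (Metric.mem_closedBall.1 hx) (by rw [hr]; linarith)))
  have hx_cont : ∀ x ∈ U, ContinuousOn (f x) (Set.uIcc a b) := fun x hx =>
    hc.comp (f := fun t : ℝ => (x, t)) (by fun_prop) fun t ht => ⟨hx, ht⟩
  have hx_meas : ∀ x ∈ U, MeasureTheory.AEStronglyMeasurable (f x)
      (MeasureTheory.volume.restrict (Set.uIoc a b)) := fun x hx =>
    ((hx_cont x hx).mono Set.uIoc_subset_uIcc).aestronglyMeasurable measurableSet_uIoc
  obtain ⟨M, hM⟩ := ((isCompact_closedBall x₀ (2 * r)).prod isCompact_uIcc).exists_bound_of_continuousOn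
    (hc.mono (Set.prod_mono_left hsub))
  have hdat : ∀ t ∈ Set.uIcc a b, ∀ x ∈ U, HasDerivAt (fun g => f g t) (deriv (fun g => f g t) x) x :=
    fun t ht x hx => ((hd t ht x hx).differentiableAt (hU.mem_nhds hx)).hasDerivAt
  -- The derivative is measurable in t as the limit of difference quotients along the sequence
  -- r/(n+1).
  have hmeas' : MeasureTheory.AEStronglyMeasurable (fun t => deriv (fun g => f g t) x₀)
      (MeasureTheory.volume.restrict (Set.uIoc a b)) := by
    let h : ℕ → ℂ := fun n => ((r / (n + 1) : ℝ) : ℂ)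
    have hne : ∀ n, h n ≠ 0 := fun n => by
      simp only [h, ne_eq, ofReal_eq_zero]
      positivity
    have hlim : Filter.Tendsto h Filter.atTop (nhdsWithin 0 {0}ᶜ) := by
      refine tendsto_nhdsWithin_iff.2 ⟨?_, Filter.Eventually.of_forall fun n => hne n⟩
      have h1 : Filter.Tendsto (fun n : ℕ => r * (1 / ((n : ℝ) + 1))) Filter.atTop (nhds (r * 0)) :=
        tendsto_one_div_add_atTop_nhds_zero_nat.const_mul r
      rw [mul_zero] at h1
      have h2 := (continuous_ofReal.tendsto 0).comp h1
      simp only [ofReal_zero] at h2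
      refine h2.congr fun n => ?_
      simp only [Function.comp, h, mul_one_div]
    have hmemU : ∀ n, x₀ + h n ∈ U := fun n => by
      refine hsub ?_
      rw [Metric.mem_closedBall, dist_eq_norm, add_sub_cancel_left]
      simp only [h, Complex.norm_real, Real.norm_eq_abs]
      rw [abs_of_nonneg (by positivity)]
      refine (div_le_self hr0.le ?_).trans (by linarith)
      have : (0 : ℝ) ≤ n := n.cast_nonneg
      linarith
    refine aestronglyMeasurable_of_tendsto_ae Filter.atTop
      (f := fun n t => (h n)⁻¹ • (f (x₀ + h n) t - f x₀ t))
      (fun n => ((hx_meas _ (hmemU n)).sub (hx_meas _ hx₀)).const_smul (h n)⁻¹) ?_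
    refine (MeasureTheory.ae_restrict_iff' measurableSet_uIoc).2 (Filter.Eventually.of_forall fun t ht => ?_)
    exact ((hdat t (Set.uIoc_subset_uIcc ht) x₀ hx₀).tendsto_slope_zero).comp hlim
  have hs : Metric.ball x₀ r ∈ nhds x₀ := Metric.ball_mem_nhds _ hr0
  have hbU : Metric.ball x₀ r ⊆ U := fun x hx =>
    hsub (Metric.mem_closedBall.2 ((Metric.mem_ball.1 hx).le.trans (by linarith)))
  -- The domination M/r is Cauchy's estimate: circles of radius r about points of the r-ball stay in
  -- the 2r-ball, where the integrand is bounded by M.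
  refine DifferentiableAt.differentiableWithinAt (HasDerivAt.differentiableAt
    (intervalIntegral.hasDerivAt_integral_of_dominated_loc_of_deriv_le (s := Metric.ball x₀ r)
      (F' := fun x t => deriv (fun g => f g t) x) (bound := fun _ => M / r) hs
      (Filter.mem_of_superset hs fun x hx => hx_meas x (hbU hx)) (hx_cont x₀ hx₀).intervalIntegrable
      hmeas' (Filter.Eventually.of_forall fun t ht x hx => ?_) _root_.intervalIntegrable_const
      (Filter.Eventually.of_forall fun t ht x hx => hdat t (Set.uIoc_subset_uIcc ht) x (hbU hx))).2)
  have hsub' : Metric.closedBall x r ⊆ Metric.closedBall x₀ (2 * r) := fun y hy => by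
    rw [Metric.mem_closedBall] at hy ⊢
    rw [Metric.mem_ball] at hx
    linarith [dist_triangle y x x₀]
  refine norm_deriv_le_of_forall_mem_sphere_norm_le hr0 ?_ fun y hy => ?_
  · refine DifferentiableOn.diffContOnCl ?_
    rw [closure_ball x hr0.ne']
    exact (hd t (Set.uIoc_subset_uIcc ht)).mono (hsub'.trans hsub)
  · exact hM (y, t) ⟨hsub' (Metric.sphere_subset_closedBall hy), Set.uIoc_subset_uIcc ht⟩

theorem differentiableOn_circleAverage_param {U : Set ℂ} (hU : IsOpen U) {f : ℂ → ℂ → ℂ} {ρ : ℝ}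
    (hρ : 0 ≤ ρ) (hc : ContinuousOn (fun p : ℂ × ℂ => f p.1 p.2) (U ×ˢ Metric.sphere 0 ρ))
    (hd : ∀ X ∈ Metric.sphere (0 : ℂ) ρ, DifferentiableOn ℂ (fun g => f g X) U) :
    DifferentiableOn ℂ (fun g => circleAverage (f g) 0 ρ) U := by
  have h := differentiableOn_intervalIntegral_param hU (a := 0) (b := 2 * Real.pi)
    (f := fun g t => f g (circleMap 0 ρ t))
    (hc.comp (f := fun p : ℂ × ℝ => (p.1, circleMap 0 ρ p.2)) (by fun_prop)
      fun p hp => ⟨hp.1, circleMap_mem_sphere 0 hρ p.2⟩)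
    fun t _ => hd _ (circleMap_mem_sphere 0 hρ t)
  exact h.const_smul (2 * Real.pi)⁻¹

theorem circleAverage_annulus {f : ℂ → ℂ} {r ρ : ℝ} (hr : 0 < r) (hle : r ≤ ρ)
    (hf : ∀ X : ℂ, r ≤ ‖X‖ → ‖X‖ ≤ ρ → DifferentiableAt ℂ f X) :
    circleAverage f 0 ρ = circleAverage f 0 r := by
  rw [Real.circleAverage_eq_circleIntegral (hr.trans_le hle).ne',
    Real.circleAverage_eq_circleIntegral hr.ne',
    circleIntegral_sub_center_inv_smul_eq_of_differentiable_on_annulus_off_countable hr hle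
      Set.countable_empty]
  · intro X hX
    exact (hf X (by simpa using hX.2) (by simpa using hX.1)).continuousAt.continuousWithinAt
  · intro X hX
    refine hf X (le_of_lt ?_) (le_of_lt ?_)
    · simpa using hX.1.2
    · simpa using hX.1.1

theorem circleAverage_inv (f : ℂ → ℂ) (ρ : ℝ) :
    circleAverage (fun X => f X⁻¹) 0 ρ = circleAverage f 0 ρ⁻¹ := by
  rw [Real.circleAverage_eq_circleAverage_zero_one, Real.circleAverage_eq_circleAverage_zero_one (R := ρ⁻¹),
    ← Real.circleAverage_zero_one_congr_inv]
  congr 1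
  funext X
  simp [mul_comm]

theorem circleIntegrable_of_differentiableAt {f : ℂ → ℂ} {ρ : ℝ} (hρ : 0 ≤ ρ)
    (hf : ∀ X : ℂ, ‖X‖ = ρ → DifferentiableAt ℂ f X) : CircleIntegrable f 0 ρ :=
  ContinuousOn.circleIntegrable hρ fun X hX =>
    (hf X (by simpa using hX)).continuousAt.continuousWithinAt

theorem circleAverage_mul_left (c : ℂ) (f : ℂ → ℂ) (ρ : ℝ) :
    circleAverage (fun X => c * f X) 0 ρ = c * circleAverage f 0 ρ :=
  Real.circleAverage_fun_smul (a := c)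

theorem differentiableAt_cayley {s X : ℂ} (h : X - s ≠ 0) :
    DifferentiableAt ℂ (fun X => (X + s) / (X - s)) X :=
  DifferentiableAt.div (by fun_prop) (by fun_prop) h

/-- Moving the contour in `∫ E(X) / ((1 - sX)(1 - s/X))` to a large circle. -/
theorem circleAverage_div_eq {E : ℂ → ℂ} {s : ℂ} {ρ : ℝ} (hs : ‖s‖ < 1) (hρ : 1 ≤ ρ)
    (hE : ∀ X : ℂ, 1 ≤ ‖X‖ → ‖X‖ ≤ ρ → DifferentiableAt ℂ E X)
    (hinv : ∀ X : ℂ, ‖X‖ = 1 → E X⁻¹ = E X) :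
    circleAverage (fun X => E X / ((1 - s * X) * (1 - s / X))) 0 1 =
      (1 - s ^ 2)⁻¹ * circleAverage (fun X => E X * ((X + s) / (X - s))) 0 ρ := by
  have hX0 : ∀ X : ℂ, 1 ≤ ‖X‖ → X ≠ 0 := fun X h h0 => by simp [h0] at h; linarith
  have hXs : ∀ X : ℂ, 1 ≤ ‖X‖ → X - s ≠ 0 := fun X h h0 => by
    rw [sub_eq_zero.1 h0] at h
    linarith
  have h1 : ∀ X : ℂ, ‖X‖ = 1 → 1 - s * X ≠ 0 := fun X h h0 => by
    have := congrArg norm (sub_eq_zero.1 h0)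
    rw [norm_one, norm_mul, h, mul_one] at this
    linarith
  have h2 : ∀ X : ℂ, ‖X‖ = 1 → 1 - s * X⁻¹ ≠ 0 := fun X h => h1 X⁻¹ (by rw [norm_inv, h, inv_one])
  have hs2 : 1 - s ^ 2 ≠ 0 := fun h0 => by
    have := congrArg norm (sub_eq_zero.1 h0)
    rw [norm_one, norm_pow] at this
    nlinarith [norm_nonneg s]
  -- Only s is a pole of (X+s)/(X-s), and it lies inside the unit disc; the circle may therefore
  -- expand as far as E is holomorphic.
  rw [circleAverage_annulus one_pos hρ fun X h h' => ?_]
  · have d1 : CircleIntegrable (fun X => E X / (1 - s * X)) 0 1 :=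
      circleIntegrable_of_differentiableAt zero_le_one fun X h =>
        (hE X h.ge (h.le.trans hρ)).div (by fun_prop) (h1 X h)
    have d2 : CircleIntegrable (fun X => E X / (1 - s * X⁻¹)) 0 1 :=
      circleIntegrable_of_differentiableAt zero_le_one fun X h =>
        (hE X h.ge (h.le.trans hρ)).div
          (((differentiableAt_inv (hX0 X h.ge)).const_mul s).const_sub 1) (h2 X h)
    have d3 : CircleIntegrable E 0 1 :=
      circleIntegrable_of_differentiableAt zero_le_one fun X h => hE X h.ge (h.le.trans hρ)
    have e1 : circleAverage (fun X => E X / (1 - s * X)) 0 1 =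
        circleAverage (fun X => E X / (1 - s * X⁻¹)) 0 1 := by
      have := circleAverage_inv (fun X => E X / (1 - s * X)) 1
      rw [inv_one] at this
      rw [← this]
      refine Real.circleAverage_congr_sphere fun X hX => ?_
      have hX1 : ‖X‖ = 1 := by simpa using hX
      simp only [hinv X hX1]
    -- Partial fractions: (1-s²)/((1-sX)(1-s/X)) = 1/(1-sX) + 1/(1-s/X) - 1. By the symmetry of E
    -- the first two terms have equal averages, and 2/(1-s/X) - 1 = (X+s)/(X-s).
    have e2 : circleAverage (fun X => E X / ((1 - s * X) * (1 - s / X))) 0 1 =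
        (1 - s ^ 2)⁻¹ * (circleAverage (fun X => E X / (1 - s * X)) 0 1 +
          circleAverage (fun X => E X / (1 - s * X⁻¹)) 0 1 - circleAverage E 0 1) := by
      rw [← Real.circleAverage_add d1 d2, ← Real.circleAverage_sub (d1.add d2) d3,
        ← circleAverage_mul_left]
      refine Real.circleAverage_congr_sphere fun X hX => ?_
      have hX1 : ‖X‖ = 1 := by simpa using hX
      have a1 := h1 X hX1
      have a2 := h2 X hX1
      have a3 := hX0 X hX1.ge
      have a4 := hXs X hX1.ge
      have a5 : 1 - s * X⁻¹ = (X - s) / X := by field_simp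
      simp only [Pi.add_apply, Pi.sub_apply]
      rw [div_eq_mul_inv s X, a5]
      field_simp
      ring
    have e3 : circleAverage (fun X => E X * ((X + s) / (X - s))) 0 1 =
        circleAverage (fun X => E X / (1 - s * X⁻¹)) 0 1 +
          circleAverage (fun X => E X / (1 - s * X⁻¹)) 0 1 - circleAverage E 0 1 := by
      rw [← Real.circleAverage_add d2 d2, ← Real.circleAverage_sub (d2.add d2) d3]
      refine Real.circleAverage_congr_sphere fun X hX => ?_
      have hX1 : ‖X‖ = 1 := by simpa using hX
      have a2 := h2 X hX1
      have a3 := hX0 X hX1.ge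
      have a4 := hXs X hX1.ge
      have a5 : 1 - s * X⁻¹ = (X - s) / X := by field_simp
      simp only [Pi.add_apply, Pi.sub_apply]
      rw [a5]
      field_simp
      ring
    rw [e2, e3, e1]
  · exact (hE X h h').mul (differentiableAt_cayley (hXs X h))

/-- The integrand is 2X/(X-s) - 1, and the average of X/(X-s) is 1 by Cauchy's formula. -/
theorem circleAverage_cayley {s : ℂ} {ρ : ℝ} (hs : ‖s‖ < ρ) :
    circleAverage (fun X => (X + s) / (X - s)) 0 ρ = 1 := by
  have hρ : 0 < ρ := (norm_nonneg s).trans_lt hs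
  have hXs : ∀ X : ℂ, ‖X‖ = ρ → X - s ≠ 0 := fun X h h0 => by
    rw [sub_eq_zero.1 h0] at h
    linarith
  have hX0 : ∀ X : ℂ, ‖X‖ = ρ → X ≠ 0 := fun X h h0 => by
    rw [h0, norm_zero] at h
    linarith
  have h1 : circleAverage (fun X => X / (X - s)) 0 ρ = 1 := by
    rw [Real.circleAverage_eq_circleIntegral hρ.ne']
    have : (∮ X in C(0, ρ), (X - 0)⁻¹ • (X / (X - s))) = ∮ X in C(0, ρ), (X - s)⁻¹ := by
      refine circleIntegral.integral_congr hρ.le fun X hX => ?_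
      have hXρ : ‖X‖ = ρ := by simpa using hX
      have := hX0 X hXρ
      simp only [sub_zero, smul_eq_mul]
      field_simp
    rw [this, circleIntegral.integral_sub_inv_of_mem_ball (by simpa using hs), smul_eq_mul,
      inv_mul_cancel₀ two_pi_I_ne_zero]
  have d1 : CircleIntegrable (fun X => X / (X - s)) 0 ρ :=
    circleIntegrable_of_differentiableAt hρ.le fun X h =>
      DifferentiableAt.div (by fun_prop) (by fun_prop) (hXs X h)
  have d2 : CircleIntegrable (fun _ => (1 : ℂ)) 0 ρ :=
    circleIntegrable_of_differentiableAt hρ.le fun X h => by fun_prop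
  have h2 := Real.circleAverage_sub (d1.add d1) d2
  rw [Real.circleAverage_add d1 d1, h1, Real.circleAverage_const] at h2
  norm_num at h2
  rw [← h2]
  refine Real.circleAverage_congr_sphere fun X hX => ?_
  have hXρ : ‖X‖ = ρ := by simpa [abs_of_pos hρ] using hX
  have := hXs X hXρ
  simp only [Pi.add_apply, Pi.sub_apply]
  field_simp
  ring

/-- The sum of the continued integrals at `s` and `s⁻¹` is a residue. -/
theorem circleAverage_add_inv {E : ℂ → ℂ} {s : ℂ} {ρ : ℝ} (hs : ‖s‖ < ρ) (hs' : ρ⁻¹ < ‖s‖)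
    (hE : ∀ X : ℂ, ρ⁻¹ ≤ ‖X‖ → ‖X‖ ≤ ρ → DifferentiableAt ℂ E X)
    (hinv : ∀ X : ℂ, X ≠ 0 → E X⁻¹ = E X) :
    circleAverage (fun X => E X * ((X + s) / (X - s))) 0 ρ +
      circleAverage (fun X => E X * ((X + s⁻¹) / (X - s⁻¹))) 0 ρ = 2 * E s := by
  have hρ : 0 < ρ := (norm_nonneg s).trans_lt hs
  have hsn : 0 < ‖s‖ := (inv_pos.2 hρ).trans hs'
  have hs0 : s ≠ 0 := norm_pos_iff.1 hsn
  have hi : ‖s⁻¹‖ < ρ := by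
    rw [norm_inv]
    exact inv_lt_of_inv_lt₀ hρ hs'
  have hi' : ρ⁻¹ < ‖s⁻¹‖ := by
    rw [norm_inv]
    exact (inv_lt_inv₀ hρ hsn).2 hs
  let A : Set ℂ := {X | ρ⁻¹ < ‖X‖ ∧ ‖X‖ < ρ}
  have hA : IsOpen A := (isOpen_lt continuous_const continuous_norm).inter
    (isOpen_lt continuous_norm continuous_const)
  have hEA : DifferentiableOn ℂ E A := fun X hX =>
    (hE X hX.1.le hX.2.le).differentiableWithinAt
  have hds : ∀ c ∈ A, ∀ X : ℂ, ρ⁻¹ ≤ ‖X‖ → ‖X‖ ≤ ρ → DifferentiableAt ℂ (dslope E c) X := by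
    intro c hc X h1 h2
    by_cases hXc : X = c
    · rw [hXc]
      exact (((differentiableOn_dslope (hA.mem_nhds hc)).2 hEA) c hc).differentiableAt (hA.mem_nhds hc)
    · exact (differentiableAt_dslope_of_ne hXc).2 (hE X h1 h2)
  have hXne : ∀ X : ℂ, ‖X‖ = ρ → X - s ≠ 0 ∧ X - s⁻¹ ≠ 0 ∧ X ≠ 0 := fun X h => by
    refine ⟨fun h0 => ?_, fun h0 => ?_, fun h0 => ?_⟩
    · rw [sub_eq_zero.1 h0] at h
      linarith
    · rw [sub_eq_zero.1 h0] at h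
      linarith
    · rw [h0, norm_zero] at h
      linarith
  -- Subtracting the common value E(s) = E(1/s) removes both poles, so D is holomorphic on the
  -- annulus; what is subtracted contributes E(s)(1+1).
  let D : ℂ → ℂ := fun X => dslope E s X * (X + s) + dslope E s⁻¹ X * (X + s⁻¹)
  have hEs : E s⁻¹ = E s := hinv s hs0
  have hD : ∀ X : ℂ, X - s ≠ 0 → X - s⁻¹ ≠ 0 →
      D X = (E X - E s) * ((X + s) / (X - s) + (X + s⁻¹) / (X - s⁻¹)) := fun X h1 h2 => by
    simp only [D]
    rw [dslope_of_ne _ (sub_ne_zero.1 h1), dslope_of_ne _ (sub_ne_zero.1 h2), slope_def_field,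
      slope_def_field, hEs]
    ring
  have hDd : ∀ X : ℂ, ρ⁻¹ ≤ ‖X‖ → ‖X‖ ≤ ρ → DifferentiableAt ℂ D X := fun X h1 h2 =>
    ((hds s ⟨hs', hs⟩ X h1 h2).mul (by fun_prop)).add ((hds s⁻¹ ⟨hi', hi⟩ X h1 h2).mul (by fun_prop))
  -- D is odd under X ↦ 1/X, while its averages over the radii ρ and 1/ρ agree by Cauchy's theorem.
  have hD0 : circleAverage D 0 ρ = 0 := by
    have h1 := circleAverage_annulus (inv_pos.2 hρ) (hs'.trans hs).le hDd
    rw [← circleAverage_inv] at h1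
    have h2 : circleAverage (fun X => D X⁻¹) 0 ρ = circleAverage (fun X => (-1) * D X) 0 ρ := by
      refine Real.circleAverage_congr_sphere fun X hX => ?_
      have hXρ : ‖X‖ = ρ := by simpa [abs_of_pos hρ] using hX
      obtain ⟨a1, a2, a3⟩ := hXne X hXρ
      have b1 : X⁻¹ - s ≠ 0 := fun h => a2 (by rw [← sub_eq_zero.1 h, inv_inv, sub_self])
      have b2 : X⁻¹ - s⁻¹ ≠ 0 := fun h => a1 (by rw [inv_injective (sub_eq_zero.1 h), sub_self])
      have c1 : X⁻¹ - s = -(s * (X - s⁻¹) / X) := by field_simp; ring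
      have c2 : X⁻¹ - s⁻¹ = -((X - s) / (s * X)) := by field_simp; ring
      have c3 : X⁻¹ + s = s * (X + s⁻¹) / X := by field_simp; ring
      have c4 : X⁻¹ + s⁻¹ = (X + s) / (s * X) := by field_simp; ring
      change D X⁻¹ = -1 * D X
      rw [hD _ b1 b2, hD _ a1 a2, hinv X a3, c1, c2, c3, c4]
      have e1 : s * (X + s⁻¹) / X / -(s * (X - s⁻¹) / X) = -((X + s⁻¹) / (X - s⁻¹)) := by
        rw [div_neg, div_div_div_cancel_right₀ a3, mul_div_mul_left _ _ hs0]
      have e2 : (X + s) / (s * X) / -((X - s) / (s * X)) = -((X + s) / (X - s)) := by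
        rw [div_neg, div_div_div_cancel_right₀ (mul_ne_zero hs0 a3)]
      rw [e1, e2]
      ring
    rw [h2, circleAverage_mul_left] at h1
    linear_combination (1 / 2 : ℂ) * h1
  have hEc : ∀ X : ℂ, ‖X‖ = ρ → DifferentiableAt ℂ E X := fun X h =>
    hE X ((hs'.trans hs).le.trans h.ge) h.le
  have hc1 : CircleIntegrable (fun X => (X + s) / (X - s)) 0 ρ :=
    circleIntegrable_of_differentiableAt hρ.le fun X h =>
      differentiableAt_cayley (hXne X h).1
  have hc2 : CircleIntegrable (fun X => (X + s⁻¹) / (X - s⁻¹)) 0 ρ :=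
    circleIntegrable_of_differentiableAt hρ.le fun X h =>
      differentiableAt_cayley (hXne X h).2.1
  have i1 : CircleIntegrable (fun X => E X * ((X + s) / (X - s))) 0 ρ :=
    circleIntegrable_of_differentiableAt hρ.le fun X h =>
      (hEc X h).mul (differentiableAt_cayley (hXne X h).1)
  have i2 : CircleIntegrable (fun X => E X * ((X + s⁻¹) / (X - s⁻¹))) 0 ρ :=
    circleIntegrable_of_differentiableAt hρ.le fun X h =>
      (hEc X h).mul (differentiableAt_cayley (hXne X h).2.1)
  have iD : CircleIntegrable D 0 ρ := circleIntegrable_of_differentiableAt hρ.le fun X h =>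
    hDd X ((hs'.trans hs).le.trans h.ge) h.le
  have hc3 : CircleIntegrable (fun X => E s * ((X + s) / (X - s) + (X + s⁻¹) / (X - s⁻¹))) 0 ρ :=
    circleIntegrable_of_differentiableAt hρ.le fun X h =>
      ((differentiableAt_cayley (hXne X h).1).add
        (differentiableAt_cayley (hXne X h).2.1)).const_mul _
  have hfin : circleAverage (fun X => E X * ((X + s) / (X - s))) 0 ρ +
      circleAverage (fun X => E X * ((X + s⁻¹) / (X - s⁻¹))) 0 ρ =
      circleAverage D 0 ρ +
        circleAverage (fun X => E s * ((X + s) / (X - s) + (X + s⁻¹) / (X - s⁻¹))) 0 ρ := by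
    rw [← Real.circleAverage_add i1 i2, ← Real.circleAverage_add iD hc3]
    refine Real.circleAverage_congr_sphere fun X hX => ?_
    have hXρ : ‖X‖ = ρ := by simpa [abs_of_pos hρ] using hX
    obtain ⟨a1, a2, -⟩ := hXne X hXρ
    simp only [Pi.add_apply]
    rw [hD X a1 a2]
    ring
  rw [hfin, hD0, circleAverage_mul_left, Real.circleAverage_fun_add hc1 hc2, circleAverage_cayley hs,
    circleAverage_cayley hi]
  ring

/-- The integral over a period in logarithmic coordinates as a circle average. -/
theorem integral_exp_eq_circleAverage (h : ℂ → ℂ) :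
    ∫ x in (0 : ℝ)..1, h (exp (2 * Real.pi * I * x)) = circleAverage h 0 1 := by
  rw [Real.circleAverage_def]
  have := intervalIntegral.integral_comp_mul_left (a := 0) (b := 1)
    (fun θ : ℝ => h (circleMap 0 1 θ)) Real.two_pi_pos.ne'
  rw [mul_zero, mul_one] at this
  rw [← this]
  refine intervalIntegral.integral_congr fun x _ => ?_
  simp only [circleMap_zero]
  congr 1
  push_cast
  rw [one_mul]
  ring_nf

end circle

/-! ### Partial fractions -/

/-- The coefficients in the partial fraction expansion of `∏ᵢ ((1 - sᵢX)(1 - sᵢ/X))⁻¹`. -/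
noncomputable def pfCoeff {ι : Type*} [DecidableEq ι] (S : Finset ι) (s : ι → ℂ) (i : ι) : ℂ :=
  ∏ j ∈ S.erase i, ((1 - s j * s i) * (1 - s j / s i))⁻¹

/-- Since (1-sX)(1-s/X) = -s(X + 1/X - s - 1/s), this is a partial fraction expansion with simple
poles in the variable X + 1/X. It follows from Lagrange interpolation of the constant 1 at the nodes
sᵢ + 1/sᵢ; the hypotheses on the sᵢ make them distinct. -/
theorem prod_inv_eq_sum_pfCoeff {ι : Type*} [DecidableEq ι] {S : Finset ι} (hS : S.Nonempty) {s : ι → ℂ}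
    (h0 : ∀ i ∈ S, s i ≠ 0) (h1 : ∀ i ∈ S, ∀ j ∈ S, i ≠ j → s j * s i ≠ 1)
    (h2 : ∀ i ∈ S, ∀ j ∈ S, i ≠ j → s j ≠ s i) {X : ℂ} (hX : X ≠ 0)
    (hX1 : ∀ i ∈ S, (1 - s i * X) * (1 - s i / X) ≠ 0) :
    (∏ i ∈ S, ((1 - s i * X) * (1 - s i / X)))⁻¹ =
      ∑ i ∈ S, pfCoeff S s i / ((1 - s i * X) * (1 - s i / X)) := by
  let v : ι → ℂ := fun i => s i + (s i)⁻¹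
  let w : ℂ := X + X⁻¹
  have hv : Set.InjOn v S := by
    intro i hi j hj hij
    by_contra hne
    have hi0 := h0 i hi
    have hj0 := h0 j hj
    have : (s j - s i) * (s j * s i - 1) = 0 := by
      simp only [v] at hij
      field_simp at hij
      linear_combination -hij
    rcases mul_eq_zero.1 this with h | h
    · exact h2 i hi j hj hne (sub_eq_zero.1 h)
    · exact h1 i hi j hj hne (sub_eq_zero.1 h)
  have hsum := congrArg (Polynomial.eval w) (Lagrange.sum_basis hv hS)
  rw [Polynomial.eval_finsetSum, Polynomial.eval_one] at hsum
  have hterm : ∀ i ∈ S, ∀ Y : ℂ, Y ≠ 0 → (1 - s i * Y) * (1 - s i / Y) = -s i * (Y + Y⁻¹ - v i) :=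
    fun i hi Y hY => by
      have := h0 i hi
      simp only [v]
      field_simp
      ring
  have hmul : (∏ i ∈ S, ((1 - s i * X) * (1 - s i / X)))⁻¹ =
      (∑ i ∈ S, Polynomial.eval w (Lagrange.basis S v i)) *
        (∏ i ∈ S, ((1 - s i * X) * (1 - s i / X)))⁻¹ := by rw [hsum, one_mul]
  rw [hmul, Finset.sum_mul]
  refine Finset.sum_congr rfl fun i hi => ?_
  rw [Lagrange.basis, Polynomial.eval_prod, ← Finset.mul_prod_erase S _ hi, mul_inv, mul_left_comm,
    ← Finset.prod_inv_distrib, ← Finset.prod_mul_distrib, pfCoeff, div_eq_mul_inv, mul_comm]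
  congr 1
  refine Finset.prod_congr rfl fun j hj => ?_
  obtain ⟨hji, hjS⟩ := Finset.mem_erase.1 hj
  have hw : w - v j ≠ 0 := fun h => hX1 j hjS (by rw [hterm j hjS X hX, show X + X⁻¹ - v j = 0 from h, mul_zero])
  have hvij : v i - v j ≠ 0 := sub_ne_zero.2 fun h => hji (hv hjS hi h.symm)
  rw [Lagrange.basisDivisor, hterm j hjS X hX, hterm j hjS (s i) (h0 i hi)]
  simp only [Polynomial.eval_mul, Polynomial.eval_C, Polynomial.eval_sub, Polynomial.eval_X]
  have hj0 := h0 j hjS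
  have e1 : X + X⁻¹ - v j = w - v j := rfl
  have e2 : s i + (s i)⁻¹ - v j = v i - v j := rfl
  rw [e1, e2]
  field_simp

/-! ### The elliptic gamma function -/

/-- The function `e^{2πiu}`. -/
noncomputable def ee (u : ℂ) : ℂ := exp (2 * Real.pi * I * u)

theorem ee_ne_zero (u : ℂ) : ee u ≠ 0 := exp_ne_zero _

theorem ee_add (u v : ℂ) : ee (u + v) = ee u * ee v := by
  rw [ee, ee, ee, ← exp_add, mul_add]

theorem ee_neg (u : ℂ) : ee (-u) = (ee u)⁻¹ := by
  rw [ee, ee, ← exp_neg, mul_neg]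

theorem ee_zero : ee 0 = 1 := by rw [ee, mul_zero, exp_zero]

theorem ee_nat_mul (n : ℕ) (u : ℂ) : ee (n * u) = ee u ^ n := by
  rw [ee, ee, ← exp_nat_mul]
  ring_nf

theorem ee_eq_one_iff {u : ℂ} : ee u = 1 ↔ ∃ n : ℤ, u = n := exp_two_pi_I_mul_eq_one_iff

theorem norm_ee (u : ℂ) : ‖ee u‖ = Real.exp (-(2 * Real.pi * u.im)) := norm_exp_two_pi_I_mul u

theorem norm_ee_lt_one {u : ℂ} (hu : 0 < u.im) : ‖ee u‖ < 1 := norm_exp_two_pi_I_mul_lt_one hu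

theorem differentiable_ee : Differentiable ℂ ee := by
  unfold ee
  fun_prop

/-- The weights `pⁱqʲ`. -/
noncomputable def wt (τ σ : ℂ) (ij : ℕ × ℕ) : ℂ := ee (ij.1 * τ + ij.2 * σ)

/-- The weights `pⁱ⁺¹qʲ⁺¹`. -/
noncomputable def wt1 (τ σ : ℂ) (ij : ℕ × ℕ) : ℂ := wt τ σ (ij.1 + 1, ij.2 + 1)

theorem wt_eq (τ σ : ℂ) (ij : ℕ × ℕ) : wt τ σ ij = ee τ ^ ij.1 * ee σ ^ ij.2 := by
  rw [wt, ee_add, ee_nat_mul, ee_nat_mul]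

theorem wt1_eq (τ σ : ℂ) : wt1 τ σ = fun ij => ee τ ^ (ij.1 + 1) * ee σ ^ (ij.2 + 1) :=
  funext fun _ => wt_eq _ _ _

section gamma

variable {τ σ : ℂ}

theorem summable_wt (hτ : 0 < τ.im) (hσ : 0 < σ.im) : Summable fun ij => ‖wt τ σ ij‖ := by
  simp only [wt_eq]
  exact summable_norm_pow_mul_pow (norm_ee_lt_one hτ) (norm_ee_lt_one hσ)

theorem summable_wt1 (hτ : 0 < τ.im) (hσ : 0 < σ.im) : Summable fun ij => ‖wt1 τ σ ij‖ := by
  simp only [wt1, wt_eq]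
  exact summable_norm_pow_succ_mul_pow_succ (norm_ee_lt_one hτ) (norm_ee_lt_one hσ)

theorem norm_wt_le_one (hτ : 0 < τ.im) (hσ : 0 < σ.im) (ij : ℕ × ℕ) : ‖wt τ σ ij‖ ≤ 1 := by
  rw [wt_eq, norm_mul, norm_pow, norm_pow]
  exact mul_le_one₀ (pow_le_one₀ (norm_nonneg _) (norm_ee_lt_one hτ).le) (by positivity)
    (pow_le_one₀ (norm_nonneg _) (norm_ee_lt_one hσ).le)

theorem norm_wt1_lt_one (hτ : 0 < τ.im) (hσ : 0 < σ.im) (ij : ℕ × ℕ) : ‖wt1 τ σ ij‖ < 1 := by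
  rw [wt1, wt_eq, norm_mul, norm_pow, norm_pow]
  exact mul_lt_one_of_nonneg_of_lt_one_left (by positivity)
    (pow_lt_one₀ (norm_nonneg _) (norm_ee_lt_one hτ) (Nat.succ_ne_zero _))
    (pow_le_one₀ (norm_nonneg _) (norm_ee_lt_one hσ).le)

theorem ellGamma_eq (u : ℂ) :
    ellGamma τ σ u = qProd (wt1 τ σ) (ee (-u)) / qProd (wt τ σ) (ee u) := by
  simp only [ellGamma, qProd, wt1, wt_eq, ee, mul_neg, mul_assoc]

/-- The quotient of the products with weights `pⁱqʲ` and `pⁱ⁺¹qʲ⁺¹`. -/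
noncomputable def axisProd (τ σ t : ℂ) : ℂ :=
  qProd (fun i : ℕ => ee τ ^ i) t * qProd (fun j : ℕ => ee σ ^ (j + 1)) t

/-- The product with weights `pⁱqʲ`, with the factors `j = 0` separated. -/
theorem qProd_wt_eq (hτ : 0 < τ.im) (hσ : 0 < σ.im) (t : ℂ) :
    qProd (wt τ σ) t = qProd (fun i : ℕ => ee τ ^ i) t *
      qProd (fun ij : ℕ × ℕ => ee τ ^ ij.1 * ee σ ^ (ij.2 + 1)) t := by
  rw [qProd_split (summable_wt hτ hσ) (e := fun i : ℕ => (i, 0))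
    (e' := fun ij : ℕ × ℕ => (ij.1, ij.2 + 1))]
  · simp only [wt_eq, pow_zero, mul_one]
  · intro i j h
    simpa using h
  · rintro ⟨i, j⟩ ⟨i', j'⟩ h
    simpa using h
  · rintro ⟨i, j⟩
    cases j <;> simp

theorem qProd_wt1_eq (hτ : 0 < τ.im) (hσ : 0 < σ.im) (t : ℂ) :
    qProd (fun ij : ℕ × ℕ => ee τ ^ ij.1 * ee σ ^ (ij.2 + 1)) t =
      qProd (fun j : ℕ => ee σ ^ (j + 1)) t * qProd (wt1 τ σ) t := by
  have hs : Summable fun ij : ℕ × ℕ => ‖ee τ ^ ij.1 * ee σ ^ (ij.2 + 1)‖ :=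
    Summable.mul_norm (f := fun i : ℕ => ee τ ^ i) (g := fun j : ℕ => ee σ ^ (j + 1))
      (summable_norm_pow (norm_ee_lt_one hτ)) (summable_norm_pow_succ (norm_ee_lt_one hσ))
  rw [qProd_split hs (e := fun j : ℕ => (0, j)) (e' := fun ij : ℕ × ℕ => (ij.1 + 1, ij.2))]
  · simp only [wt1_eq, pow_zero, one_mul]
  · intro i j h
    simpa using h
  · rintro ⟨i, j⟩ ⟨i', j'⟩ h
    simpa using h
  · rintro ⟨i, j⟩
    cases i <;> simp

/-- The quadrant of exponents is its interior together with the two axes. Thus 1/(Γ(2x)Γ(-2x))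
reduces to products over the axes and has no poles. -/
theorem qProd_wt_eq_axisProd (hτ : 0 < τ.im) (hσ : 0 < σ.im) (t : ℂ) :
    qProd (wt τ σ) t = axisProd τ σ t * qProd (wt1 τ σ) t := by
  rw [qProd_wt_eq hτ hσ, qProd_wt1_eq hτ hσ, axisProd, mul_assoc]

theorem differentiable_axisProd (hτ : 0 < τ.im) (hσ : 0 < σ.im) :
    Differentiable ℂ (axisProd τ σ) :=
  (differentiable_qProd (summable_norm_pow (norm_ee_lt_one hτ))).mul
    (differentiable_qProd (summable_norm_pow_succ (norm_ee_lt_one hσ)))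

theorem qProd_wt_ne_zero (hτ : 0 < τ.im) (hσ : 0 < σ.im) {t : ℂ} (ht : ‖t‖ < 1) :
    qProd (wt τ σ) t ≠ 0 :=
  qProd_ne_zero_of_norm_lt (summable_wt hτ hσ) fun ij => by
    rw [norm_mul]
    exact mul_lt_one_of_nonneg_of_lt_one_left (norm_nonneg _) ht (norm_wt_le_one hτ hσ ij)

theorem qProd_wt1_ne_zero (hτ : 0 < τ.im) (hσ : 0 < σ.im) {t : ℂ} (ht : ‖t‖ ≤ 1) :
    qProd (wt1 τ σ) t ≠ 0 :=
  qProd_ne_zero_of_norm_lt (summable_wt1 hτ hσ) fun ij => by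
    rw [norm_mul]
    exact mul_lt_one_of_nonneg_of_lt_one_right ht (norm_nonneg _) (norm_wt1_lt_one hτ hσ ij)

/-- The functional equation `Γ(u + σ) = θ(u|τ) Γ(u)`. -/
theorem ellGamma_add (hτ : 0 < τ.im) (hσ : 0 < σ.im) {u : ℂ} (hu : 0 < u.im) :
    ellGamma τ σ (u + σ) = thetaMul τ u * ellGamma τ σ u := by
  -- This factor is cancelled at the end; its nonvanishing is where Im u > 0 enters.
  have hP : qProd (fun i : ℕ => ee τ ^ i) (ee u) ≠ 0 :=
    qProd_ne_zero_of_norm_lt (summable_norm_pow (norm_ee_lt_one hτ)) fun i => by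
      rw [norm_mul, norm_pow]
      exact mul_lt_one_of_nonneg_of_lt_one_left (norm_nonneg _) (norm_ee_lt_one hu)
        (pow_le_one₀ (norm_nonneg _) (norm_ee_lt_one hτ).le)
  have h1 : qProd (wt τ σ) (ee u) = qProd (fun i : ℕ => ee τ ^ i) (ee u) *
      qProd (wt τ σ) (ee (u + σ)) := by
    rw [qProd_wt_eq hτ hσ, ee_add, ← qProd_mul_left]
    congr 2
    funext ij
    rw [wt_eq]
    ring
  have h2 : qProd (wt1 τ σ) (ee (-(u + σ))) = qProd (fun i : ℕ => ee τ ^ (i + 1)) (ee (-u)) *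
      qProd (wt1 τ σ) (ee (-u)) := by
    have hs : Summable fun ij : ℕ × ℕ => ‖ee τ ^ (ij.1 + 1) * ee σ ^ ij.2‖ :=
      Summable.mul_norm (f := fun i : ℕ => ee τ ^ (i + 1)) (g := fun j : ℕ => ee σ ^ j)
        (summable_norm_pow_succ (norm_ee_lt_one hτ)) (summable_norm_pow (norm_ee_lt_one hσ))
    rw [show -(u + σ) = -u + -σ by ring, ee_add, ← qProd_mul_left]
    have e : (fun ij => ee (-σ) * wt1 τ σ ij) = fun ij : ℕ × ℕ => ee τ ^ (ij.1 + 1) * ee σ ^ ij.2 := by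
      funext ij
      have := ee_ne_zero σ
      rw [wt1, wt_eq, ee_neg, pow_succ (ee σ)]
      field_simp
    rw [e, qProd_split hs (e := fun i : ℕ => (i, 0)) (e' := fun ij : ℕ × ℕ => (ij.1, ij.2 + 1))]
    · simp only [wt1_eq, pow_zero, mul_one]
    · intro i j h
      simpa using h
    · rintro ⟨i, j⟩ ⟨i', j'⟩ h
      simpa using h
    · rintro ⟨i, j⟩
      cases j <;> simp
  have hT : thetaMul τ u = qProd (fun i : ℕ => ee τ ^ i) (ee u) *
      qProd (fun i : ℕ => ee τ ^ (i + 1)) (ee (-u)) := by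
    simp only [thetaMul, ee, mul_neg]
  rw [ellGamma_eq, ellGamma_eq, h1, h2, hT]
  rw [show ∀ a b c d : ℂ, a * b * (c / (a * d)) = b * c / d * (a / a) by intros; ring, div_self hP,
    mul_one]

theorem ellGamma_ne_zero (hτ : 0 < τ.im) (hσ : 0 < σ.im) {u : ℂ} (hu : 0 < u.im)
    (h : ∀ i j : ℕ, ∀ k : ℤ, u ≠ (i + 1) * τ + (j + 1) * σ + k) : ellGamma τ σ u ≠ 0 := by
  rw [ellGamma_eq]
  refine div_ne_zero (qProd_ne_zero (summable_wt1 hτ hσ) fun ij hij => ?_)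
    (qProd_wt_ne_zero hτ hσ (norm_ee_lt_one hu))
  rw [wt1, wt, ← ee_add, ee_eq_one_iff] at hij
  obtain ⟨k, hk⟩ := hij
  refine h ij.1 ij.2 (-k) ?_
  push_cast at hk ⊢
  linear_combination -hk

end gamma

/-! ### The integrand in the variable `X = e^{2πix}` -/

theorem exists_ee_eq {X : ℂ} (hX : X ≠ 0) : ∃ x, ee x = X := by
  refine ⟨log X / (2 * Real.pi * I), ?_⟩
  rw [ee, mul_div_cancel₀ _ two_pi_I_ne_zero, exp_log hX]

/-- A test function in the variable `X = e^{2πix}`. -/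
noncomputable def IsTest.descend (Φ : ℂ → ℂ) : ℂ → ℂ := Function.Periodic.cuspFunction 1 Φ

theorem qParam_one (x : ℂ) : Function.Periodic.qParam 1 x = ee x := by
  simp [Function.Periodic.qParam, ee]

theorem IsTest.periodic' {Φ : ℂ → ℂ} (h : IsTest Φ) : Function.Periodic Φ ((1 : ℝ) : ℂ) := by
  rw [ofReal_one]
  exact h.periodic

theorem IsTest.descend_ee {Φ : ℂ → ℂ} (h : IsTest Φ) (x : ℂ) : IsTest.descend Φ (ee x) = Φ x := by
  rw [← qParam_one]
  exact Function.Periodic.eq_cuspFunction one_ne_zero h.periodic' x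

theorem IsTest.differentiableAt_descend {Φ : ℂ → ℂ} (h : IsTest Φ) {X : ℂ} (hX : X ≠ 0) :
    DifferentiableAt ℂ (IsTest.descend Φ) X := by
  obtain ⟨x, rfl⟩ := exists_ee_eq hX
  rw [← qParam_one]
  exact Function.Periodic.differentiableAt_cuspFunction one_ne_zero h.periodic' (h.holo x)

theorem IsTest.descend_inv {Φ : ℂ → ℂ} (h : IsTest Φ) {X : ℂ} (hX : X ≠ 0) :
    IsTest.descend Φ X⁻¹ = IsTest.descend Φ X := by
  obtain ⟨x, rfl⟩ := exists_ee_eq hX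
  rw [← ee_neg, h.descend_ee, h.descend_ee, h.even]

/-- The part of the integrand without poles. -/
noncomputable def kerNum (Q T : ℂ → ℂ) (z g X : ℂ) : ℂ :=
  Q (ee (g - z) * X⁻¹) * Q (ee (g - z) * X) * (Q (ee (g + z) * X⁻¹) * Q (ee (g + z) * X)) *
    (T (X ^ 2) * T (X⁻¹ ^ 2))

/-- The denominator of the integrand. -/
noncomputable def kerDen (Q : ℂ → ℂ) (z g X : ℂ) : ℂ :=
  Q (ee (z - g) * X) * Q (ee (z - g) * X⁻¹) * (Q (ee (-z - g) * X) * Q (ee (-z - g) * X⁻¹))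

theorem kerNum_inv (Q T : ℂ → ℂ) (z g X : ℂ) : kerNum Q T z g X⁻¹ = kerNum Q T z g X := by
  simp only [kerNum, inv_inv]
  ring

theorem kerDen_inv (Q : ℂ → ℂ) (z g X : ℂ) : kerDen Q z g X⁻¹ = kerDen Q z g X := by
  simp only [kerDen, inv_inv]
  ring

theorem differentiableAt_kerNum {Q T : ℂ → ℂ} (hQ : Differentiable ℂ Q) (hT : Differentiable ℂ T)
    (z : ℂ) {p : ℂ × ℂ} (hp : p.2 ≠ 0) :
    DifferentiableAt ℂ (fun p : ℂ × ℂ => kerNum Q T z p.1 p.2) p := by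
  have he := differentiable_ee
  unfold kerNum
  fun_prop (disch := assumption)

theorem differentiableAt_kerDen {Q : ℂ → ℂ} (hQ : Differentiable ℂ Q) (z : ℂ) {p : ℂ × ℂ}
    (hp : p.2 ≠ 0) : DifferentiableAt ℂ (fun p : ℂ × ℂ => kerDen Q z p.1 p.2) p := by
  have he := differentiable_ee
  unfold kerDen
  fun_prop (disch := assumption)

/-- The weights `pⁱqʲ` outside a finite set. -/
noncomputable def tailWt (τ σ : ℂ) (S : Finset (ℕ × ℕ)) (ij : ℕ × ℕ) : ℂ :=
  if ij ∈ S then 0 else wt τ σ ij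

/-- The values of `X` and `X⁻¹` at the poles of the integrand, inverted. -/
noncomputable def poleVal (τ σ z g : ℂ) (i : (ℕ × ℕ) × Bool) : ℂ :=
  ee ((if i.2 then z else -z) - g) * wt τ σ i.1

/-- The index set of the poles that are split off. -/
def poleSet (S : Finset (ℕ × ℕ)) : Finset ((ℕ × ℕ) × Bool) := S ×ˢ Finset.univ

/-- The integrand with the poles in `poleSet S` removed. -/
noncomputable def kerE (τ σ : ℂ) (S : Finset (ℕ × ℕ)) (φ : ℂ → ℂ) (z g X : ℂ) : ℂ :=
  kerNum (qProd (wt1 τ σ)) (axisProd τ σ) z g X / kerDen (qProd (tailWt τ σ S)) z g X * φ X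

section

variable {τ σ : ℂ}

theorem summable_tailWt (hτ : 0 < τ.im) (hσ : 0 < σ.im) (S : Finset (ℕ × ℕ)) :
    Summable fun ij => ‖tailWt τ σ S ij‖ := by
  refine (summable_wt hτ hσ).of_nonneg_of_le (fun i => norm_nonneg _) fun i => ?_
  rw [tailWt]
  split_ifs <;> simp

theorem tailWt_empty : tailWt τ σ ∅ = wt τ σ := by
  funext ij
  simp [tailWt]

theorem qProd_tailWt_eq (hτ : 0 < τ.im) (hσ : 0 < σ.im) {S' S : Finset (ℕ × ℕ)} (h : S' ⊆ S) (t : ℂ) :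
    qProd (tailWt τ σ S') t = (∏ ij ∈ S \ S', (1 - t * wt τ σ ij)) * qProd (tailWt τ σ S) t := by
  rw [qProd_eq_prod_mul (summable_tailWt hτ hσ S') (S \ S')]
  congr 1
  · refine Finset.prod_congr rfl fun ij hij => ?_
    rw [tailWt, if_neg (Finset.mem_sdiff.1 hij).2]
  · congr 1
    funext ij
    by_cases h1 : ij ∈ S <;> by_cases h2 : ij ∈ S' <;> simp [tailWt, h1, h2]
    exact absurd (h h2) h1

theorem kerDen_tailWt_eq (hτ : 0 < τ.im) (hσ : 0 < σ.im) {S' S : Finset (ℕ × ℕ)} (hS : S' ⊆ S)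
    (z g X : ℂ) :
    kerDen (qProd (tailWt τ σ S')) z g X =
      (∏ i ∈ poleSet (S \ S'), ((1 - poleVal τ σ z g i * X) * (1 - poleVal τ σ z g i / X))) *
        kerDen (qProd (tailWt τ σ S)) z g X := by
  have e : ∀ u Y : ℂ, ∏ ij ∈ S \ S', (1 - u * Y * wt τ σ ij) =
      ∏ ij ∈ S \ S', (1 - u * wt τ σ ij * Y) :=
    fun u Y => Finset.prod_congr rfl fun ij _ => by ring
  rw [poleSet, Finset.prod_product]
  simp only [Fintype.prod_bool, poleVal, if_true, Bool.false_eq_true, if_false, Finset.prod_mul_distrib,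
    div_eq_mul_inv]
  simp only [kerDen, qProd_tailWt_eq hτ hσ hS, e]
  ring

theorem kerDen_eq (hτ : 0 < τ.im) (hσ : 0 < σ.im) (S : Finset (ℕ × ℕ)) (z g X : ℂ) :
    kerDen (qProd (wt τ σ)) z g X =
      (∏ i ∈ poleSet S, ((1 - poleVal τ σ z g i * X) * (1 - poleVal τ σ z g i / X))) *
        kerDen (qProd (tailWt τ σ S)) z g X := by
  have := kerDen_tailWt_eq hτ hσ (Finset.empty_subset S) z g X
  rwa [Finset.sdiff_empty, tailWt_empty] at this

theorem integrand_eq (hτ : 0 < τ.im) (hσ : 0 < σ.im) {Φ : ℂ → ℂ} (hΦ : IsTest Φ) (z g : ℂ) (x : ℝ) :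
    ellGamma τ σ (z + x - g) * ellGamma τ σ (z - x - g) *
        ellGamma τ σ (-z + x - g) * ellGamma τ σ (-z - x - g) /
      (ellGamma τ σ (-2 * g) * ellGamma τ σ (2 * x) * ellGamma τ σ (-2 * x)) * Φ x =
    qProd (wt τ σ) (ee (-2 * g)) / qProd (wt1 τ σ) (ee (2 * g)) *
      (kerNum (qProd (wt1 τ σ)) (axisProd τ σ) z g (ee x) / kerDen (qProd (wt τ σ)) z g (ee x) *
        IsTest.descend Φ (ee x)) := by
  -- For real x the interior products at e^{±4πix} do not vanish, so they cancel from
  -- 1/(Γ(2x)Γ(-2x)).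
  have hn : ∀ y : ℂ, y.im = 0 → qProd (wt1 τ σ) (ee y) ≠ 0 := fun y hy =>
    qProd_wt1_ne_zero hτ hσ (by rw [norm_ee, hy]; simp)
  have hx1 := hn (2 * x) (by simp)
  have hx2 := hn (-(2 * x)) (by simp)
  have e2 : ee x ^ 2 = ee (2 * x) := by
    rw [← ee_nat_mul]
    norm_num
  have e3 : (ee x)⁻¹ ^ 2 = ee (-(2 * x)) := by rw [inv_pow, e2, ee_neg]
  simp only [ellGamma_eq, kerNum, kerDen, e2, e3]
  rw [hΦ.descend_ee, ← ee_neg, ← ee_add, ← ee_add, ← ee_add, ← ee_add, ← ee_add, ← ee_add, ← ee_add,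
    ← ee_add, show (-2 * x : ℂ) = -(2 * x) by ring, neg_neg, show -(-2 * g) = 2 * g by ring,
    qProd_wt_eq_axisProd hτ hσ (ee (2 * x)), qProd_wt_eq_axisProd hτ hσ (ee (-(2 * x))),
    show -(z + x - g) = g - z + -x by ring, show -(z - x - g) = g - z + x by ring,
    show -(-z + x - g) = g + z + -x by ring, show -(-z - x - g) = g + z + x by ring,
    show z + x - g = z - g + x by ring, show z - x - g = z - g + -x by ring,
    show -z + x - g = -z - g + x by ring, show -z - x - g = -z - g + -x by ring]
  generalize qProd (wt1 τ σ) (ee (2 * x)) = A at *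
  generalize qProd (wt1 τ σ) (ee (-(2 * x))) = B at *
  rw [show ∀ a₁ b₁ a₂ b₂ a₃ b₃ a₄ b₄ c d s t f : ℂ,
    a₁ / b₁ * (a₂ / b₂) * (a₃ / b₃) * (a₄ / b₄) / (c / d * (B / (s * A)) * (A / (t * B))) * f =
    d / c * (a₁ * a₂ * (a₃ * a₄) * (s * t) / (b₁ * b₂ * (b₃ * b₄)) * f) * (A / A) * (B / B) by
    intros; simp only [div_eq_mul_inv, mul_inv, inv_inv]; ring, div_self hx1, div_self hx2, mul_one, mul_one]

theorem intM_eq {η : ℂ} (hτ : 0 < τ.im) (hη : 0 < (2 * η).im) {Φ : ℂ → ℂ} (hΦ : IsTest Φ)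
    (S : Finset (ℕ × ℕ)) (z g : ℂ) :
    intM τ η g Φ z = qPoch (2 * η) * qPoch τ / 2 *
      (qProd (wt τ (2 * η)) (ee (-2 * g)) / qProd (wt1 τ (2 * η)) (ee (2 * g)) *
      Real.circleAverage (fun X => kerE τ (2 * η) S (IsTest.descend Φ) z g X *
        (∏ i ∈ poleSet S, ((1 - poleVal τ (2 * η) z g i * X) *
          (1 - poleVal τ (2 * η) z g i / X)))⁻¹) 0 1) := by
  rw [intM, ← integral_exp_eq_circleAverage]
  congr 1
  rw [← intervalIntegral.integral_const_mul]
  apply intervalIntegral.integral_congr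
  intro x _
  simp only
  rw [integrand_eq hτ hη hΦ, kerDen_eq hτ hη S, kerE]
  change _ = _ * (_ / _ * IsTest.descend Φ (ee x) * _)
  rw [show exp (2 * Real.pi * I * x) = ee x from rfl]
  congr 1
  rw [div_eq_mul_inv, mul_inv, div_eq_mul_inv]
  ring

end

/-! ### Continuation in the spin -/

section tail

variable {τ σ : ℂ}

/-- The weights are summable, hence tend to zero. Containing all indices below ω guarantees that the
poles contributing at the degenerate spin are among those split off. -/
theorem exists_finset_wt (hτ : 0 < τ.im) (hσ : 0 < σ.im) (M : ℝ) (ω : ℕ × ℕ) :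
    ∃ S : Finset (ℕ × ℕ), Finset.Iic ω ⊆ S ∧ ∀ ij ∉ S, M * ‖wt τ σ ij‖ < 1 := by
  have h : Filter.Tendsto (fun ij => M * ‖wt τ σ ij‖) Filter.cofinite (nhds (M * 0)) :=
    (summable_wt hτ hσ).tendsto_cofinite_zero.const_mul M
  rw [mul_zero] at h
  have hfin : {ij | ¬ M * ‖wt τ σ ij‖ < 1}.Finite :=
    Filter.eventually_cofinite.1 (h.eventually (gt_mem_nhds one_pos))
  refine ⟨Finset.Iic ω ∪ hfin.toFinset, Finset.subset_union_left, fun ij hij => ?_⟩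
  by_contra hc
  exact hij (Finset.mem_union_right _ (hfin.mem_toFinset.2 hc))

theorem qProd_tailWt_ne_zero (hτ : 0 < τ.im) (hσ : 0 < σ.im) {S : Finset (ℕ × ℕ)} {M : ℝ}
    (hS : ∀ ij ∉ S, M * ‖wt τ σ ij‖ < 1) {t : ℂ} (ht : ‖t‖ ≤ M) : qProd (tailWt τ σ S) t ≠ 0 := by
  refine qProd_ne_zero_of_norm_lt (summable_tailWt hτ hσ S) fun ij => ?_
  rw [tailWt]
  split_ifs with h
  · simp
  · rw [norm_mul]
    exact (mul_le_mul_of_nonneg_right ht (norm_nonneg _)).trans_lt (hS ij h)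

theorem kerDen_tailWt_ne_zero (hτ : 0 < τ.im) (hσ : 0 < σ.im) {S : Finset (ℕ × ℕ)} {B ρ : ℝ}
    (hS : ∀ ij ∉ S, B * ρ * ‖wt τ σ ij‖ < 1) {z g X : ℂ} (h1 : ‖ee (z - g)‖ ≤ B)
    (h2 : ‖ee (-z - g)‖ ≤ B) (hX : ‖X‖ ≤ ρ) (hX' : ‖X⁻¹‖ ≤ ρ) :
    kerDen (qProd (tailWt τ σ S)) z g X ≠ 0 := by
  have h : ∀ u Y : ℂ, ‖u‖ ≤ B → ‖Y‖ ≤ ρ → qProd (tailWt τ σ S) (u * Y) ≠ 0 := fun u Y hu hY =>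
    qProd_tailWt_ne_zero hτ hσ hS (by
      rw [norm_mul]
      exact mul_le_mul hu hY (norm_nonneg _) ((norm_nonneg _).trans hu))
  exact mul_ne_zero (mul_ne_zero (h _ _ h1 hX) (h _ _ h1 hX'))
    (mul_ne_zero (h _ _ h2 hX) (h _ _ h2 hX'))

theorem differentiableAt_kerE (hτ : 0 < τ.im) (hσ : 0 < σ.im) {S : Finset (ℕ × ℕ)} {φ : ℂ → ℂ}
    {z : ℂ} {p : ℂ × ℂ} (hp : p.2 ≠ 0) (hφ : DifferentiableAt ℂ φ p.2)
    (hD : kerDen (qProd (tailWt τ σ S)) z p.1 p.2 ≠ 0) :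
    DifferentiableAt ℂ (fun p : ℂ × ℂ => kerE τ σ S φ z p.1 p.2) p := by
  have hN := differentiableAt_kerNum (differentiable_qProd (summable_wt1 hτ hσ))
    (differentiable_axisProd hτ hσ) z hp
  have hd := differentiableAt_kerDen (differentiable_qProd (summable_tailWt hτ hσ S)) z hp
  simp only [kerE, div_eq_mul_inv]
  exact (hN.fun_mul (hd.fun_inv hD)).fun_mul (DifferentiableAt.comp p hφ differentiableAt_snd)

theorem kerE_inv {S : Finset (ℕ × ℕ)} {Φ : ℂ → ℂ} (hΦ : IsTest Φ) (z g : ℂ) {X : ℂ} (hX : X ≠ 0) :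
    kerE τ σ S (IsTest.descend Φ) z g X⁻¹ = kerE τ σ S (IsTest.descend Φ) z g X := by
  rw [kerE, kerE, kerNum_inv, kerDen_inv, hΦ.descend_inv hX]

theorem poleVal_eq_ee (z g : ℂ) (i : (ℕ × ℕ) × Bool) :
    poleVal τ σ z g i = ee ((if i.2 then z else -z) - g + (i.1.1 * τ + i.1.2 * σ)) := by
  rw [poleVal, wt, ← ee_add]

theorem poleVal_ne_zero (z g : ℂ) (i : (ℕ × ℕ) × Bool) : poleVal τ σ z g i ≠ 0 := by
  rw [poleVal_eq_ee]
  exact ee_ne_zero _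

theorem differentiable_poleVal (z : ℂ) (i : (ℕ × ℕ) × Bool) :
    Differentiable ℂ fun g => poleVal τ σ z g i := by
  have := differentiable_ee
  unfold poleVal
  fun_prop

theorem norm_poleVal_le (hτ : 0 < τ.im) (hσ : 0 < σ.im) {B : ℝ} {z g : ℂ} (h1 : ‖ee (z - g)‖ ≤ B)
    (h2 : ‖ee (-z - g)‖ ≤ B) (i : (ℕ × ℕ) × Bool) : ‖poleVal τ σ z g i‖ ≤ B := by
  rw [poleVal, norm_mul]
  have h : ‖ee ((if i.2 then z else -z) - g)‖ ≤ B := by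
    split_ifs
    exacts [h1, h2]
  exact (mul_le_of_le_one_right (norm_nonneg _) (norm_wt_le_one hτ hσ _)).trans h

theorem norm_poleVal_lt (hτ : 0 < τ.im) (hσ : 0 < σ.im) {z g : ℂ} (h1 : ‖ee (z - g)‖ < 1)
    (h2 : ‖ee (-z - g)‖ < 1) (i : (ℕ × ℕ) × Bool) : ‖poleVal τ σ z g i‖ < 1 :=
  (norm_poleVal_le hτ hσ (le_max_left _ _) (le_max_right _ _) i).trans_lt (max_lt h1 h2)

/-- Two poles are paired if the product of their positions is `e^{-2·2πig} p^{ω₁} q^{ω₂}`. -/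
abbrev Paired (ω : ℕ × ℕ) (i j : (ℕ × ℕ) × Bool) : Prop := i.1 + j.1 = ω ∧ i.2 ≠ j.2

theorem Paired.symm {ω : ℕ × ℕ} {i j : (ℕ × ℕ) × Bool} (h : Paired ω i j) : Paired ω j i :=
  ⟨by rw [add_comm]; exact h.1, h.2.symm⟩

theorem Paired.unique {ω : ℕ × ℕ} {i j j' : (ℕ × ℕ) × Bool} (h : Paired ω i j) (h' : Paired ω i j') :
    j = j' := by
  obtain ⟨h1, h2⟩ := h
  obtain ⟨h3, h4⟩ := h'
  refine Prod.ext (add_left_cancel (h1.trans h3.symm)) ?_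
  revert h2 h4
  cases i.2 <;> cases j.2 <;> cases j'.2 <;> simp

theorem Paired.poleVal_mul {ω : ℕ × ℕ} {i j : (ℕ × ℕ) × Bool} (h : Paired ω i j) (z g : ℂ) :
    poleVal τ σ z g j * poleVal τ σ z g i = ee (-2 * g) * wt τ σ ω := by
  obtain ⟨h1, h2⟩ := h
  rw [poleVal_eq_ee, poleVal_eq_ee, wt, ← ee_add, ← ee_add, ← h1, Prod.fst_add, Prod.snd_add]
  congr 1
  push_cast
  revert h2
  cases i.2 <;> cases j.2 <;> simp <;> ring

/-- The partial fraction coefficient of a pole, multiplied by `1 - e^{-2·2πig} p^{ω₁} q^{ω₂}`. -/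
noncomputable def splitCoeff (τ σ : ℂ) (S : Finset (ℕ × ℕ)) (ω : ℕ × ℕ) (z g : ℂ) (i : (ℕ × ℕ) × Bool) : ℂ :=
  (∏ j ∈ (poleSet S).erase i, (1 - poleVal τ σ z g j / poleVal τ σ z g i)⁻¹) *
    (∏ j ∈ (poleSet S).erase i with ¬ Paired ω i j, (1 - poleVal τ σ z g j * poleVal τ σ z g i)⁻¹) *
    (1 - ee (-2 * g) * wt τ σ ω) ^ (1 - ((poleSet S).filter (Paired ω i)).card)

/-- A pole has at most one partner, and the partner's factor 1/(1 - s_j s_i) is exactly the inverse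
of the factor of 1/Γ(-2g) that vanishes at the degenerate spin. With a partner the two cancel;
without one the zero survives to the first power. -/
theorem pfCoeff_mul (S : Finset (ℕ × ℕ)) (ω : ℕ × ℕ) (z g : ℂ) (i : (ℕ × ℕ) × Bool)
    (h : 1 - ee (-2 * g) * wt τ σ ω ≠ 0) :
    pfCoeff (poleSet S) (poleVal τ σ z g) i * (1 - ee (-2 * g) * wt τ σ ω) =
      splitCoeff τ σ S ω z g i := by
  have hf : ((poleSet S).erase i).filter (Paired ω i) = (poleSet S).filter (Paired ω i) := by
    ext j
    simp only [Finset.mem_filter, Finset.mem_erase]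
    constructor
    · rintro ⟨⟨_, h1⟩, h2⟩
      exact ⟨h1, h2⟩
    · rintro ⟨h1, h2⟩
      exact ⟨⟨fun hji => h2.2 (by rw [hji]), h1⟩, h2⟩
  have hcard : ((poleSet S).filter (Paired ω i)).card ≤ 1 :=
    Finset.card_le_one.2 fun j hj j' hj' =>
      (Finset.mem_filter.1 hj).2.unique (Finset.mem_filter.1 hj').2
  have hp : ∏ j ∈ (poleSet S).erase i with Paired ω i j,
      (1 - poleVal τ σ z g j * poleVal τ σ z g i)⁻¹ =
      (1 - ee (-2 * g) * wt τ σ ω)⁻¹ ^ ((poleSet S).filter (Paired ω i)).card := by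
    rw [← hf, ← Finset.prod_const]
    exact Finset.prod_congr rfl fun j hj => by rw [(Finset.mem_filter.1 hj).2.poleVal_mul]
  rw [pfCoeff, splitCoeff]
  simp only [mul_inv]
  rw [Finset.prod_mul_distrib, ← Finset.prod_filter_mul_prod_filter_not _ (Paired ω i)
    (fun j => (1 - poleVal τ σ z g j * poleVal τ σ z g i)⁻¹), hp]
  have key : ∀ N : ℕ, N ≤ 1 → (1 - ee (-2 * g) * wt τ σ ω)⁻¹ ^ N * (1 - ee (-2 * g) * wt τ σ ω) =
      (1 - ee (-2 * g) * wt τ σ ω) ^ (1 - N) := by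
    intro N hN
    interval_cases N
    · simp
    · rw [pow_one, inv_mul_cancel₀ h, Nat.sub_self, pow_zero]
  rw [← key _ hcard]
  ring

/-- The contribution of a pole to the contour integral. -/
noncomputable def poleInt (τ σ : ℂ) (S : Finset (ℕ × ℕ)) (φ : ℂ → ℂ) (ρ : ℝ) (z g : ℂ) (i : (ℕ × ℕ) × Bool) : ℂ :=
  Real.circleAverage (fun X => kerE τ σ S φ z g X *
    ((X + poleVal τ σ z g i) / (X - poleVal τ σ z g i))) 0 ρ

/-- The continuation of `[M(g)Φ](z)` in `g`, up to a constant. -/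
noncomputable def contM (τ σ : ℂ) (S : Finset (ℕ × ℕ)) (ω : ℕ × ℕ) (φ : ℂ → ℂ) (ρ : ℝ) (z g : ℂ) : ℂ :=
  qProd (tailWt τ σ {ω}) (ee (-2 * g)) / qProd (wt1 τ σ) (ee (2 * g)) *
    ∑ i ∈ poleSet S, splitCoeff τ σ S ω z g i * (1 - poleVal τ σ z g i ^ 2)⁻¹ * poleInt τ σ S φ ρ z g i

/-- The standing assumptions on the size of the contour and the number of separated poles. -/
structure IsCut (τ σ : ℂ) (S : Finset (ℕ × ℕ)) (z : ℂ) (c B : ℝ) : Prop where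
  one_le : 1 ≤ B
  tail : ∀ ij ∉ S, B * (B + 1) * ‖wt τ σ ij‖ < 1
  norm_le : ∀ g : ℂ, g.im < c → ‖ee (z - g)‖ ≤ B
  norm_le' : ∀ g : ℂ, g.im < c → ‖ee (-z - g)‖ ≤ B

theorem exists_isCut (hτ : 0 < τ.im) (hσ : 0 < σ.im) (z : ℂ) (c : ℝ) (ω : ℕ × ℕ) :
    ∃ S B, Finset.Iic ω ⊆ S ∧ IsCut τ σ S z c B := by
  -- Since |e^{2πi(±z-g)}| = exp(2π(Im g ∓ Im z)), B bounds all poles for Im g < c. The contour is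
  -- then |X| = B+1, which explains B(B+1) in the tail condition.
  set B := Real.exp (2 * Real.pi * (|c| + |z.im|)) with hB
  obtain ⟨S, hS, ht⟩ := exists_finset_wt hτ hσ (B * (B + 1)) ω
  have hpi := Real.pi_pos
  refine ⟨S, B, hS, ⟨Real.one_le_exp (by positivity), ht, fun g hg => ?_, fun g hg => ?_⟩⟩
  · rw [norm_ee, hB, Real.exp_le_exp, sub_im]
    nlinarith [le_abs_self c, neg_abs_le z.im]
  · rw [norm_ee, hB, Real.exp_le_exp, sub_im, neg_im]
    nlinarith [le_abs_self c, le_abs_self z.im]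

theorem IsCut.norm_poleVal_lt (hτ : 0 < τ.im) (hσ : 0 < σ.im) {S : Finset (ℕ × ℕ)} {z : ℂ} {c B : ℝ}
    (h : IsCut τ σ S z c B) {g : ℂ} (hg : g.im < c) (i : (ℕ × ℕ) × Bool) :
    ‖poleVal τ σ z g i‖ < B + 1 :=
  (norm_poleVal_le hτ hσ (h.norm_le g hg) (h.norm_le' g hg) i).trans_lt (lt_add_one B)

theorem IsCut.differentiableAt_kerE (hτ : 0 < τ.im) (hσ : 0 < σ.im) {S : Finset (ℕ × ℕ)} {z : ℂ} {c B : ℝ}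
    (h : IsCut τ σ S z c B) {Φ : ℂ → ℂ} (hΦ : IsTest Φ) {p : ℂ × ℂ} (hg : p.1.im < c)
    (hX : ‖p.2‖ ≤ B + 1) (hX' : (B + 1)⁻¹ ≤ ‖p.2‖) :
    DifferentiableAt ℂ (fun p : ℂ × ℂ => kerE τ σ S (IsTest.descend Φ) z p.1 p.2) p := by
  have hB := h.one_le
  have hX0 : 0 < ‖p.2‖ := lt_of_lt_of_le (by positivity) hX'
  refine EllipticDouble.differentiableAt_kerE hτ hσ (norm_pos_iff.1 hX0)
    (hΦ.differentiableAt_descend (norm_pos_iff.1 hX0))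
    (kerDen_tailWt_ne_zero hτ hσ h.tail (h.norm_le _ hg) (h.norm_le' _ hg) hX ?_)
  rw [norm_inv]
  exact inv_le_of_inv_le₀ (by positivity) hX'

theorem IsCut.differentiableAt_kerE_right (hτ : 0 < τ.im) (hσ : 0 < σ.im) {S : Finset (ℕ × ℕ)} {z : ℂ}
    {c B : ℝ} (h : IsCut τ σ S z c B) {Φ : ℂ → ℂ} (hΦ : IsTest Φ) {g X : ℂ} (hg : g.im < c)
    (hX : ‖X‖ ≤ B + 1) (hX' : (B + 1)⁻¹ ≤ ‖X‖) :
    DifferentiableAt ℂ (kerE τ σ S (IsTest.descend Φ) z g) X :=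
  (h.differentiableAt_kerE hτ hσ hΦ (p := (g, X)) hg hX hX').comp X
    (f := fun X : ℂ => (g, X)) (by fun_prop)

/-- For Im g < c the split-off pole has modulus at most B and never meets the contour |X| = B+1, and
the poles left in the integrand stay away from it as well. -/
theorem IsCut.analyticAt_poleInt (hτ : 0 < τ.im) (hσ : 0 < σ.im) {S : Finset (ℕ × ℕ)} {z : ℂ} {c B : ℝ}
    (h : IsCut τ σ S z c B) {Φ : ℂ → ℂ} (hΦ : IsTest Φ) (i : (ℕ × ℕ) × Bool) {g : ℂ} (hg : g.im < c) :
    AnalyticAt ℂ (fun g => poleInt τ σ S (IsTest.descend Φ) (B + 1) z g i) g := by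
  have hB := h.one_le
  have hU : IsOpen {g : ℂ | g.im < c} := isOpen_lt continuous_im continuous_const
  have hjoint : ∀ p : ℂ × ℂ, p.1.im < c → ‖p.2‖ = B + 1 →
      DifferentiableAt ℂ (fun p : ℂ × ℂ => kerE τ σ S (IsTest.descend Φ) z p.1 p.2 *
        ((p.2 + poleVal τ σ z p.1 i) / (p.2 - poleVal τ σ z p.1 i))) p := by
    intro p hp hX
    have hs : p.2 - poleVal τ σ z p.1 i ≠ 0 := fun h0 => by
      have := h.norm_poleVal_lt hτ hσ hp i
      rw [← sub_eq_zero.1 h0, hX] at this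
      exact lt_irrefl _ this
    have hd := differentiable_poleVal (τ := τ) (σ := σ) z i
    simp only [div_eq_mul_inv]
    refine (h.differentiableAt_kerE hτ hσ hΦ hp hX.le ?_).fun_mul
      (DifferentiableAt.fun_mul ?_ (DifferentiableAt.fun_inv ?_ ?_))
    · rw [hX]
      exact (inv_le_one_of_one_le₀ (by linarith)).trans (by linarith)
    · exact differentiableAt_snd.add (DifferentiableAt.comp p (hd p.1) differentiableAt_fst)
    · exact differentiableAt_snd.sub (DifferentiableAt.comp p (hd p.1) differentiableAt_fst)
    · exact hs
  refine DifferentiableOn.analyticAt (s := {g : ℂ | g.im < c}) ?_ (hU.mem_nhds hg)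
  refine differentiableOn_circleAverage_param hU (by linarith)
    (f := fun g X => kerE τ σ S (IsTest.descend Φ) z g X *
      ((X + poleVal τ σ z g i) / (X - poleVal τ σ z g i))) ?_ ?_
  · intro p hp
    exact (hjoint p hp.1 (by simpa using hp.2)).continuousAt.continuousWithinAt
  · intro X hX g hg
    exact ((hjoint (g, X) hg (by simpa using hX)).comp g (f := fun g : ℂ => (g, X))
      (by fun_prop)).differentiableWithinAt

end tail

/-! ### The value at a degenerate spin as a sum over pairs of poles -/

section value

variable {τ σ : ℂ}

/-- When s_i s_{i'} = 1, the partner's remaining factor 1 - s_{i'}/s_i is 1 - s_{i'}². The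
coefficient then takes a form in which the symmetry between the two partners is visible. -/
theorem splitCoeff_mul_inv {S : Finset (ℕ × ℕ)} {ω : ℕ × ℕ} {z g : ℂ}
    {i i' : (ℕ × ℕ) × Bool} (h : Paired ω i i') (hi' : i' ∈ poleSet S)
    (hg : ee (-2 * g) * wt τ σ ω = 1) :
    splitCoeff τ σ S ω z g i * (1 - poleVal τ σ z g i ^ 2)⁻¹ =
      (∏ j ∈ ((poleSet S).erase i).erase i', ((1 - poleVal τ σ z g j * poleVal τ σ z g i) *
        (1 - poleVal τ σ z g j / poleVal τ σ z g i)))⁻¹ *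
        ((1 - poleVal τ σ z g i ^ 2) * (1 - poleVal τ σ z g i' ^ 2))⁻¹ := by
  have hs := h.poleVal_mul (τ := τ) (σ := σ) z g
  rw [hg] at hs
  have hne : i' ≠ i := fun e => h.2 (by rw [e])
  have hi : i' ∈ (poleSet S).erase i := Finset.mem_erase.2 ⟨hne, hi'⟩
  have hf : ((poleSet S).erase i).filter (fun j => ¬ Paired ω i j) =
      ((poleSet S).erase i).erase i' := by
    ext j
    simp only [Finset.mem_filter, Finset.mem_erase]
    constructor
    · rintro ⟨h1, h2⟩
      exact ⟨fun e => h2 (by rw [e]; exact h), h1⟩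
    · rintro ⟨h1, h2⟩
      exact ⟨h2, fun hp => h1 (hp.unique h)⟩
  have hcard : 1 - ((poleSet S).filter (Paired ω i)).card = 0 := by
    have : 0 < ((poleSet S).filter (Paired ω i)).card :=
      Finset.card_pos.2 ⟨i', Finset.mem_filter.2 ⟨hi', h⟩⟩
    omega
  have hq : poleVal τ σ z g i' / poleVal τ σ z g i = poleVal τ σ z g i' ^ 2 := by
    rw [div_eq_iff (poleVal_ne_zero _ _ _), sq, mul_assoc, hs, mul_one]
  rw [splitCoeff, hf, hcard, pow_zero, mul_one, ← Finset.mul_prod_erase _ _ hi, hq,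
    Finset.prod_mul_distrib, Finset.prod_inv_distrib, Finset.prod_inv_distrib]
  simp only [mul_inv]
  ring

theorem splitCoeff_eq_zero {S : Finset (ℕ × ℕ)} {ω : ℕ × ℕ} {z g : ℂ}
    {i : (ℕ × ℕ) × Bool} (h : ∀ j, ¬ Paired ω i j) (hg : ee (-2 * g) * wt τ σ ω = 1) :
    splitCoeff τ σ S ω z g i = 0 := by
  rw [splitCoeff, Finset.filter_false_of_mem fun j _ => h j, hg]
  simp

/-- The coefficient of a pair of poles. -/
noncomputable def pairCoeff (τ σ : ℂ) (S : Finset (ℕ × ℕ)) (ω : ℕ × ℕ) (z g : ℂ) (ij : ℕ × ℕ) : ℂ :=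
  (∏ j ∈ ((poleSet S).erase (ij, true)).erase (ω - ij, false),
    ((1 - poleVal τ σ z g j * poleVal τ σ z g (ij, true)) *
      (1 - poleVal τ σ z g j / poleVal τ σ z g (ij, true))))⁻¹ *
    ((1 - poleVal τ σ z g (ij, true) ^ 2) * (1 - poleVal τ σ z g (ω - ij, false) ^ 2))⁻¹

theorem mem_poleSet {S : Finset (ℕ × ℕ)} {i : (ℕ × ℕ) × Bool} : i ∈ poleSet S ↔ i.1 ∈ S := by
  simp [poleSet]

/-- Poles without a partner drop out. The others come in pairs (ij, +), (ω-ij, -) at inverse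
positions and with equal coefficients, so `circleAverage_add_inv` turns their two integrals into a
residue. -/
theorem contM_eq_sum (hτ : 0 < τ.im) (hσ : 0 < σ.im) {S : Finset (ℕ × ℕ)} {ω : ℕ × ℕ}
    (hω : Finset.Iic ω ⊆ S) {z g : ℂ} {c B : ℝ} (hC : IsCut τ σ S z c B) (hgc : g.im < c)
    (hg : ee (-2 * g) * wt τ σ ω = 1) {Φ : ℂ → ℂ} (hΦ : IsTest Φ) :
    contM τ σ S ω (IsTest.descend Φ) (B + 1) z g =
      qProd (tailWt τ σ {ω}) (ee (-2 * g)) / qProd (wt1 τ σ) (ee (2 * g)) *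
        ∑ ij ∈ Finset.Iic ω, pairCoeff τ σ S ω z g ij *
          (2 * kerE τ σ S (IsTest.descend Φ) z g (poleVal τ σ z g (ij, true))) := by
  have hadd : ∀ ij ∈ Finset.Iic ω, ij + (ω - ij) = ω := fun ij hij => by
    obtain ⟨h1, h2⟩ := Prod.le_def.1 (Finset.mem_Iic.1 hij)
    ext <;> simp <;> omega
  have hsub : ∀ ij ∈ Finset.Iic ω, ω - ij ∈ Finset.Iic ω := fun ij _ => by
    rw [Finset.mem_Iic, Prod.le_def]
    simp
  have hss : ∀ ij ∈ Finset.Iic ω, ω - (ω - ij) = ij := fun ij hij => by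
    obtain ⟨h1, h2⟩ := Prod.le_def.1 (Finset.mem_Iic.1 hij)
    ext <;> simp <;> omega
  rw [contM]
  congr 1
  rw [← Finset.sum_subset (s₁ := poleSet (Finset.Iic ω))]
  rotate_left
  · intro i hi
    exact mem_poleSet.2 (hω (mem_poleSet.1 hi))
  -- A pole with a partner has its index below ω.
  · intro i _ hi
    rw [splitCoeff_eq_zero, zero_mul, zero_mul]
    · intro j hj
      refine hi (mem_poleSet.2 (Finset.mem_Iic.2 ?_))
      rw [← hj.1, Prod.le_def]
      simp
    · exact hg
  rw [poleSet, Finset.sum_product]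
  simp only [Fintype.sum_bool]
  rw [Finset.sum_add_distrib]
  have hre : ∀ f : ℕ × ℕ → ℂ, ∑ ij ∈ Finset.Iic ω, f ij = ∑ ij ∈ Finset.Iic ω, f (ω - ij) := fun f =>
    Finset.sum_nbij' (fun ij => ω - ij) (fun ij => ω - ij) hsub hsub hss hss
      fun ij hij => by rw [hss ij hij]
  rw [hre fun ij => splitCoeff τ σ S ω z g (ij, false) * _ * _, ← Finset.sum_add_distrib]
  refine Finset.sum_congr rfl fun ij hij => ?_
  have hp : Paired ω (ij, true) (ω - ij, false) := ⟨hadd ij hij, by simp⟩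
  have hs := hp.poleVal_mul (τ := τ) (σ := σ) z g
  rw [hg] at hs
  have hinv : poleVal τ σ z g (ω - ij, false) = (poleVal τ σ z g (ij, true))⁻¹ :=
    eq_inv_of_mul_eq_one_left hs
  rw [splitCoeff_mul_inv hp (mem_poleSet.2 (hω (hsub ij hij))) hg,
    splitCoeff_mul_inv hp.symm (mem_poleSet.2 (hω hij)) hg, pairCoeff, Finset.erase_right_comm,
    mul_comm (1 - poleVal τ σ z g (ω - ij, false) ^ 2)]
  -- Replacing s by 1/s only interchanges the two factors 1 - s_j s and 1 - s_j/s.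
  have hprod : ∏ j ∈ ((poleSet S).erase (ω - ij, false)).erase (ij, true),
      ((1 - poleVal τ σ z g j * poleVal τ σ z g (ω - ij, false)) *
        (1 - poleVal τ σ z g j / poleVal τ σ z g (ω - ij, false))) =
      ∏ j ∈ ((poleSet S).erase (ω - ij, false)).erase (ij, true),
      ((1 - poleVal τ σ z g j * poleVal τ σ z g (ij, true)) *
        (1 - poleVal τ σ z g j / poleVal τ σ z g (ij, true))) := by
    refine Finset.prod_congr rfl fun j _ => ?_
    rw [hinv, div_inv_eq_mul, ← div_eq_mul_inv, mul_comm]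
  rw [hprod, ← mul_add]
  congr 1
  have hB := hC.one_le
  have hlt := hC.norm_poleVal_lt hτ hσ hgc (ω - ij, false)
  rw [hinv, norm_inv] at hlt
  have := circleAverage_add_inv (ρ := B + 1) (hC.norm_poleVal_lt hτ hσ hgc (ij, true))
    (inv_lt_of_inv_lt₀ (norm_pos_iff.2 (poleVal_ne_zero _ _ _)) hlt)
    (fun X hX hX' => hC.differentiableAt_kerE_right hτ hσ hΦ hgc hX' hX)
    (fun X hX => kerE_inv hΦ z g hX)
  rw [poleInt, poleInt, hinv]
  exact this

end value

/-! ### Generic position of the poles and agreement with the integral -/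

section generic

variable {τ η : ℂ}

theorem ee_eq_ee {u v : ℂ} (h : ee u = ee v) : ∃ k : ℤ, u = v + k := by
  have : ee (u - v) = 1 := by rw [sub_eq_add_neg, ee_add, ee_neg, h, mul_inv_cancel₀ (ee_ne_zero v)]
  obtain ⟨k, hk⟩ := ee_eq_one_iff.1 this
  exact ⟨k, by linear_combination hk⟩

/-- A coincidence between poles with the same sign of z would be a relation between 1, 2η and τ;
with opposite signs it would put 2z in the lattice. -/
theorem poleVal_injective (hgen : Generic τ η) {z : ℂ} (hz : OffLattice τ η (2 * z)) (g : ℂ) :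
    Function.Injective (poleVal τ (2 * η) z g) := by
  rintro ⟨⟨i, j⟩, a⟩ ⟨⟨i', j'⟩, b⟩ h
  rw [poleVal_eq_ee, poleVal_eq_ee] at h
  obtain ⟨k, hk⟩ := ee_eq_ee h
  have same : ((i : ℂ) - i') * τ + (j - j') * (2 * η) = k → i = i' ∧ j = j' := fun e => by
    obtain ⟨-, h2, h3⟩ := hgen (-k) (j - j') (i - i') (by push_cast; linear_combination e)
    omega
  cases a <;> cases b <;> simp at hk ⊢
  · exact same (by linear_combination hk)
  · exact hz (-k) (j - j') (i - i') (by push_cast; linear_combination -hk)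
  · exact hz k (j' - j) (i' - i) (by push_cast; linear_combination hk)
  · exact same (by linear_combination hk)

/-- With equal signs of z the equation puts 2z in the lattice; with opposite signs genericity forces
the exponents to add up to (m, n). Taking i = j shows in particular that no pole value squares to 1.
-/
theorem paired_of_poleVal_mul (hgen : Generic τ η) {z : ℂ} (hz : OffLattice τ η (2 * z)) {n m : ℕ}
    {i j : (ℕ × ℕ) × Bool} (h : poleVal τ (2 * η) z (n * η + m * (τ / 2)) j *
      poleVal τ (2 * η) z (n * η + m * (τ / 2)) i = 1) : Paired (m, n) i j := by
  obtain ⟨⟨i, i'⟩, a⟩ := i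
  obtain ⟨⟨j, j'⟩, b⟩ := j
  rw [poleVal_eq_ee, poleVal_eq_ee, ← ee_add, ee_eq_one_iff] at h
  obtain ⟨k, hk⟩ := h
  have diff : ((i : ℂ) + j - m) * τ + (i' + j' - n) * (2 * η) = k → i + j = m ∧ i' + j' = n := fun e => by
    obtain ⟨-, h2, h3⟩ := hgen (-k) (i' + j' - n) (i + j - m) (by push_cast; linear_combination e)
    omega
  cases a <;> cases b <;> simp at hk
  · exact (hz (-k) (i' + j' - n) (i + j - m) (by push_cast; linear_combination -hk)).elim
  · obtain ⟨h1, h2⟩ := diff (by linear_combination hk)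
    exact ⟨Prod.ext h1 h2, by simp⟩
  · obtain ⟨h1, h2⟩ := diff (by linear_combination hk)
    exact ⟨Prod.ext h1 h2, by simp⟩
  · exact (hz k (n - i' - j') (m - i - j) (by push_cast; linear_combination hk)).elim

theorem ee_mul_wt (n m : ℕ) : ee (-2 * (n * η + m * (τ / 2))) * wt τ (2 * η) (m, n) = 1 := by
  rw [wt, ← ee_add, ← ee_zero]
  congr 1
  push_cast
  ring

/-- In the region of the integral all s_i lie in the unit disc, so the kernel may be expanded in
partial fractions on |X| = 1 and each term moved outwards by `circleAverage_div_eq`. -/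
theorem intM_eq_contM (hτ : 0 < τ.im) (hη : 0 < (2 * η).im) (hgen : Generic τ η) {z : ℂ}
    (hz : OffLattice τ η (2 * z)) {S : Finset (ℕ × ℕ)} (hS : S.Nonempty) (ω : ℕ × ℕ) {c B : ℝ}
    (hC : IsCut τ (2 * η) S z c B) {g : ℂ} (hgc : g.im < c) (h1 : 0 < (-g + z).im)
    (h2 : 0 < (-g - z).im) {Φ : ℂ → ℂ} (hΦ : IsTest Φ) :
    intM τ η g Φ z = qPoch (2 * η) * qPoch τ / 2 *
      contM τ (2 * η) S ω (IsTest.descend Φ) (B + 1) z g := by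
  have hB := hC.one_le
  have hlt : ∀ i, ‖poleVal τ (2 * η) z g i‖ < 1 := norm_poleVal_lt hτ hη
    (norm_ee_lt_one (by rw [sub_eq_neg_add]; exact h1))
    (norm_ee_lt_one (by rw [← neg_add', add_comm, neg_add']; exact h2))
  have hmul : ∀ i, ∀ Y : ℂ, ‖Y‖ ≤ 1 → 1 - poleVal τ (2 * η) z g i * Y ≠ 0 := fun i Y hY h0 => by
    have : ‖poleVal τ (2 * η) z g i * Y‖ < 1 := by
      rw [norm_mul]
      exact mul_lt_one_of_nonneg_of_lt_one_left (norm_nonneg _) (hlt i) hY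
    rw [← sub_eq_zero.1 h0] at this
    simp at this
  have he : 1 - ee (-2 * g) * wt τ (2 * η) ω ≠ 0 := fun h0 => by
    have hlt : ‖ee (-2 * g) * wt τ (2 * η) ω‖ < 1 := by
      rw [norm_mul]
      refine mul_lt_one_of_nonneg_of_lt_one_left (norm_nonneg _) (norm_ee_lt_one ?_)
        (norm_wt_le_one hτ hη _)
      simp at h1 h2 ⊢
      linarith
    rw [← sub_eq_zero.1 h0] at hlt
    simp at hlt
  have hne : (poleSet S).Nonempty := by
    obtain ⟨ij, hij⟩ := hS
    exact ⟨(ij, true), mem_poleSet.2 hij⟩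
  rw [intM_eq hτ hη hΦ S, contM]
  congr 1
  -- The factor of 1/Γ(-2g) with exponent ω is detached and absorbed into the coefficients by
  -- `pfCoeff_mul`.
  have hQ : qProd (wt τ (2 * η)) (ee (-2 * g)) = (1 - ee (-2 * g) * wt τ (2 * η) ω) *
      qProd (tailWt τ (2 * η) {ω}) (ee (-2 * g)) := by
    have := qProd_tailWt_eq hτ hη (Finset.empty_subset {ω}) (ee (-2 * g))
    rwa [Finset.sdiff_empty, tailWt_empty, Finset.prod_singleton] at this
  have hX0 : ∀ X : ℂ, ‖X‖ = 1 → X ≠ 0 := fun X hX h0 => by simp [h0] at hX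
  have hfac : ∀ i X, ‖X‖ = 1 →
      (1 - poleVal τ (2 * η) z g i * X) * (1 - poleVal τ (2 * η) z g i / X) ≠ 0 := fun i X hX =>
    mul_ne_zero (hmul i X hX.le) (by
      rw [div_eq_mul_inv]
      exact hmul i _ (by rw [norm_inv, hX, inv_one]))
  have hdE : ∀ X : ℂ, 1 ≤ ‖X‖ → ‖X‖ ≤ B + 1 →
      DifferentiableAt ℂ (kerE τ (2 * η) S (IsTest.descend Φ) z g) X := fun X hX hX' =>
    hC.differentiableAt_kerE_right hτ hη hΦ hgc hX'
      ((inv_le_one_of_one_le₀ (by linarith)).trans hX)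
  have havg : Real.circleAverage (fun X => kerE τ (2 * η) S (IsTest.descend Φ) z g X *
        (∏ i ∈ poleSet S, ((1 - poleVal τ (2 * η) z g i * X) *
          (1 - poleVal τ (2 * η) z g i / X)))⁻¹) 0 1 =
      ∑ i ∈ poleSet S, pfCoeff (poleSet S) (poleVal τ (2 * η) z g) i *
        ((1 - poleVal τ (2 * η) z g i ^ 2)⁻¹ *
          poleInt τ (2 * η) S (IsTest.descend Φ) (B + 1) z g i) := by
    rw [Real.circleAverage_congr_sphere (f₂ := fun X => ∑ i ∈ poleSet S,
      pfCoeff (poleSet S) (poleVal τ (2 * η) z g) i *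
        (kerE τ (2 * η) S (IsTest.descend Φ) z g X /
          ((1 - poleVal τ (2 * η) z g i * X) * (1 - poleVal τ (2 * η) z g i / X)))),
      Real.circleAverage_fun_sum]
    · refine Finset.sum_congr rfl fun i _ => ?_
      rw [circleAverage_mul_left, circleAverage_div_eq (hlt i) (by linarith : 1 ≤ B + 1) hdE
        (fun X hX => kerE_inv hΦ z g (hX0 X hX)), poleInt]
    · intro i _
      refine circleIntegrable_of_differentiableAt zero_le_one fun X hX => ?_
      refine (DifferentiableAt.fun_div (hdE X hX.ge (by linarith)) ?_ (hfac i X hX)).const_mul _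
      have := hX0 X hX
      fun_prop (disch := assumption)
    · intro X hX
      have hX1 : ‖X‖ = 1 := by simpa using hX
      simp only
      rw [prod_inv_eq_sum_pfCoeff hne (fun i _ => poleVal_ne_zero _ _ _)
        (fun i _ j _ _ h => hmul j _ (hlt i).le (by rw [h, sub_self]))
        (fun i _ j _ hij h => hij (poleVal_injective hgen hz g h).symm) (hX0 X hX1)
        (fun i _ => hfac i X hX1), Finset.mul_sum]
      exact Finset.sum_congr rfl fun i _ => by ring
  rw [havg, hQ, mul_div_assoc, mul_assoc, mul_left_comm, Finset.mul_sum]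
  congr 1
  refine Finset.sum_congr rfl fun i _ => ?_
  rw [← pfCoeff_mul S ω z g i he]
  ring

end generic

/-! ### Meromorphy of the continuation and the coefficient at spin zero -/

section

variable {τ σ : ℂ}

theorem differentiable_qProd_ee {ι : Type*} {w : ι → ℂ} (hw : Summable fun i => ‖w i‖) (a : ℂ) :
    Differentiable ℂ fun g => qProd w (ee (a * g)) :=
  (differentiable_qProd hw).comp (differentiable_ee.comp (by fun_prop))

theorem meromorphicAt_splitCoeff (S : Finset (ℕ × ℕ)) (ω : ℕ × ℕ) (z : ℂ) (i : (ℕ × ℕ) × Bool) (g : ℂ) :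
    MeromorphicAt (fun g => splitCoeff τ σ S ω z g i) g := by
  have hs : ∀ j, MeromorphicAt (fun g => poleVal τ σ z g j) g := fun j =>
    ((differentiable_poleVal z j).analyticAt g).meromorphicAt
  have he : MeromorphicAt (fun g => 1 - ee (-2 * g) * wt τ σ ω) g := by
    have := differentiable_ee
    exact (Differentiable.analyticAt (by fun_prop) g).meromorphicAt
  have h1 : MeromorphicAt (fun _ : ℂ => (1 : ℂ)) g := MeromorphicAt.const _ _
  exact ((MeromorphicAt.fun_prod fun j _ => (h1.sub ((hs j).div (hs i))).inv).mul
    (MeromorphicAt.fun_prod fun j _ => (h1.sub ((hs j).mul (hs i))).inv)).mul (he.pow _)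

theorem analyticAt_splitCoeff {S : Finset (ℕ × ℕ)} {ω : ℕ × ℕ} {z : ℂ} {i : (ℕ × ℕ) × Bool} {g : ℂ}
    (hinj : Function.Injective (poleVal τ σ z g))
    (hpair : ∀ j, poleVal τ σ z g j * poleVal τ σ z g i = 1 → Paired ω i j) :
    AnalyticAt ℂ (fun g => splitCoeff τ σ S ω z g i) g := by
  have hs : ∀ j, AnalyticAt ℂ (fun g => poleVal τ σ z g j) g := fun j =>
    (differentiable_poleVal z j).analyticAt g
  have he : AnalyticAt ℂ (fun g => 1 - ee (-2 * g) * wt τ σ ω) g := by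
    have := differentiable_ee
    exact Differentiable.analyticAt (by fun_prop) g
  have h1 : AnalyticAt ℂ (fun _ : ℂ => (1 : ℂ)) g := analyticAt_const
  refine ((Finset.analyticAt_fun_prod _ fun j hj => (h1.sub ((hs j).div (hs i) (poleVal_ne_zero _ _ _))).inv
    (sub_ne_zero.2 fun h => ?_)).mul
    (Finset.analyticAt_fun_prod _ fun j hj => (h1.sub ((hs j).mul (hs i))).inv
      (sub_ne_zero.2 fun h => ?_))).mul (he.pow _)
  · refine (Finset.mem_erase.1 hj).1 (hinj ?_)
    rw [Pi.div_apply] at h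
    exact (div_eq_one_iff_eq (poleVal_ne_zero _ _ _)).1 h.symm
  · exact (Finset.mem_filter.1 hj).2 (hpair j h.symm)

theorem meromorphicOn_contM (hτ : 0 < τ.im) (hσ : 0 < σ.im) {S : Finset (ℕ × ℕ)} (ω : ℕ × ℕ) {z : ℂ}
    {c B : ℝ} (hC : IsCut τ σ S z c B) {Φ : ℂ → ℂ} (hΦ : IsTest Φ) :
    MeromorphicOn (contM τ σ S ω (IsTest.descend Φ) (B + 1) z) {g | g.im < c} := by
  intro g hg
  have h1 : MeromorphicAt (fun _ : ℂ => (1 : ℂ)) g := MeromorphicAt.const _ _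
  exact (((differentiable_qProd_ee (summable_tailWt hτ hσ _) (-2)).analyticAt g).meromorphicAt.div
    ((differentiable_qProd_ee (summable_wt1 hτ hσ) 2).analyticAt g).meromorphicAt).mul
    (MeromorphicAt.fun_sum fun i _ => ((meromorphicAt_splitCoeff S ω z i g).mul
      (h1.sub (((differentiable_poleVal z i).analyticAt g).meromorphicAt.pow 2)).inv).mul
      (hC.analyticAt_poleInt hτ hσ hΦ i hg).meromorphicAt)

/-- Im g ≥ 0 keeps the denominator of the prefactor nonzero, distinct poles keep 1 - s_j/s_i
nonzero, and the pairing hypothesis handles both 1 - s_j s_i for unpaired indices and 1 - s_i². -/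
theorem analyticAt_contM (hτ : 0 < τ.im) (hσ : 0 < σ.im) {S : Finset (ℕ × ℕ)} {ω : ℕ × ℕ} {z : ℂ}
    {c B : ℝ} (hC : IsCut τ σ S z c B) {g : ℂ} (hg : g.im < c) (hg' : 0 ≤ g.im)
    (hinj : Function.Injective (poleVal τ σ z g))
    (hpair : ∀ i j, poleVal τ σ z g j * poleVal τ σ z g i = 1 → Paired ω i j)
    {Φ : ℂ → ℂ} (hΦ : IsTest Φ) :
    AnalyticAt ℂ (contM τ σ S ω (IsTest.descend Φ) (B + 1) z) g := by
  have h1 : AnalyticAt ℂ (fun _ : ℂ => (1 : ℂ)) g := analyticAt_const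
  refine (((differentiable_qProd_ee (summable_tailWt hτ hσ _) (-2)).analyticAt g).div
    ((differentiable_qProd_ee (summable_wt1 hτ hσ) 2).analyticAt g)
    (qProd_wt1_ne_zero hτ hσ ?_)).mul
    (Finset.analyticAt_fun_sum _ fun i _ => ((analyticAt_splitCoeff hinj (hpair i)).mul
      ((h1.sub (((differentiable_poleVal z i).analyticAt g).pow 2)).inv
        (sub_ne_zero.2 fun h => (hpair i i ?_).2 rfl))).mul
      (hC.analyticAt_poleInt hτ hσ hΦ i hg))
  · rw [norm_ee, Real.exp_le_one_iff]
    have := Real.pi_pos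
    simp
    positivity
  · rw [← sq]
    exact h.symm

/-- The coefficients of the continuation at a degenerate value of the spin. -/
noncomputable def contCoeff (τ σ : ℂ) (S : Finset (ℕ × ℕ)) (ω : ℕ × ℕ) (z g : ℂ) (ij : ℕ × ℕ) : ℂ :=
  qPoch σ * qPoch τ * (qProd (tailWt τ σ {ω}) (ee (-2 * g)) / qProd (wt1 τ σ) (ee (2 * g))) *
    pairCoeff τ σ S ω z g ij *
    (kerNum (qProd (wt1 τ σ)) (axisProd τ σ) z g (poleVal τ σ z g (ij, true)) /
      kerDen (qProd (tailWt τ σ S)) z g (poleVal τ σ z g (ij, true)))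

theorem qPoch_eq_qProd (τ : ℂ) : qPoch τ = qProd (fun i : ℕ => ee τ ^ (i + 1)) 1 := by
  simp only [qPoch, qProd, one_mul, ee]

theorem qProd_pow_eq (hτ : 0 < τ.im) (t : ℂ) :
    qProd (fun i : ℕ => ee τ ^ i) t = (1 - t) * qProd (fun i : ℕ => ee τ ^ (i + 1)) t := by
  rw [qProd_split (summable_norm_pow (norm_ee_lt_one hτ)) (e := fun _ : Unit => 0)
    (e' := fun i : ℕ => i + 1)]
  · simp [qProd]
  · intro i j _
    rfl
  · intro i j h
    simpa using h
  · intro i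
    cases i <;> simp

theorem qProd_tailWt_zero (hτ : 0 < τ.im) (hσ : 0 < σ.im) (t : ℂ) :
    qProd (wt τ σ) t = (1 - t) * qProd (tailWt τ σ {0}) t := by
  have := qProd_tailWt_eq hτ hσ (Finset.empty_subset {0}) t
  rw [Finset.sdiff_empty, tailWt_empty, Finset.prod_singleton] at this
  rw [this, wt_eq]
  simp

theorem qProd_tailWt_zero_one (hτ : 0 < τ.im) (hσ : 0 < σ.im) :
    qProd (tailWt τ σ {0}) 1 = qPoch τ * qPoch σ * qProd (wt1 τ σ) 1 := by
  have hp := summable_norm_pow_succ (norm_ee_lt_one hτ)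
  have hq := summable_norm_pow_succ (norm_ee_lt_one hσ)
  have key : qProd (tailWt τ σ {0}) = fun t => qProd (fun i : ℕ => ee τ ^ (i + 1)) t *
      qProd (fun i : ℕ => ee σ ^ (i + 1)) t * qProd (wt1 τ σ) t := by
    -- Off t = 1 one divides by 1 - t; the identity extends to t = 1 by continuity.
    refine Continuous.ext_on (dense_compl_singleton (1 : ℂ))
      (differentiable_qProd (summable_tailWt hτ hσ _)).continuous
      (((differentiable_qProd hp).mul (differentiable_qProd hq)).mul
        (differentiable_qProd (summable_wt1 hτ hσ))).continuous fun t ht => ?_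
    have h1 : (1 : ℂ) - t ≠ 0 := sub_ne_zero.2 fun h => ht h.symm
    refine mul_left_cancel₀ h1 ?_
    rw [← qProd_tailWt_zero hτ hσ, qProd_wt_eq_axisProd hτ hσ, axisProd, qProd_pow_eq hτ]
    ring
  rw [key, qPoch_eq_qProd, qPoch_eq_qProd]

/-- This is M(0) = 1, the start of the induction. The single pair of poles is at e^{±2πiz}, and the
normalizing constants (p;p)_∞(q;q)_∞ cancel those left by the double products at 1. -/
theorem contCoeff_zero (hτ : 0 < τ.im) (hσ : 0 < σ.im) {S : Finset (ℕ × ℕ)} (hS : 0 ∈ S) {z : ℂ}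
    (h1 : qProd (wt τ σ) (ee (2 * z)) ≠ 0) (h2 : qProd (wt τ σ) (ee (-(2 * z))) ≠ 0) :
    contCoeff τ σ S 0 z 0 0 = 1 := by
  have e1 : poleVal τ σ z 0 (0, true) = ee z := by simp [poleVal, wt, ee_zero]
  have e2 : poleVal τ σ z 0 (0, false) = ee (-z) := by simp [poleVal, wt, ee_zero]
  have hset : ((poleSet S).erase (0, true)).erase (0, false) = poleSet (S \ {0}) := by
    ext ⟨ij, a⟩
    cases a <;> simp [mem_poleSet]
    tauto
    tauto
  have hden := kerDen_tailWt_eq hτ hσ (Finset.singleton_subset_iff.2 hS) z 0 (ee z)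
  have hne : ∀ t, qProd (wt τ σ) t ≠ 0 → 1 - t ≠ 0 ∧ qProd (tailWt τ σ {0}) t ≠ 0 := fun t ht => by
    rw [qProd_tailWt_zero hτ hσ] at ht
    exact ⟨left_ne_zero_of_mul ht, right_ne_zero_of_mul ht⟩
  have hQ1 : qProd (wt1 τ σ) 1 ≠ 0 := qProd_wt1_ne_zero hτ hσ (by simp)
  have hp := qPoch_ne_zero hτ
  have hq := qPoch_ne_zero hσ
  have hax : ∀ t, axisProd τ σ t * qProd (wt1 τ σ) t = (1 - t) * qProd (tailWt τ σ {0}) t := fun t => by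
    rw [← qProd_wt_eq_axisProd hτ hσ, qProd_tailWt_zero hτ hσ]
  have hD : kerDen (qProd (tailWt τ σ {0})) z 0 (ee z) = qProd (tailWt τ σ {0}) (ee (2 * z)) *
      qProd (tailWt τ σ {0}) (ee (-(2 * z))) * qProd (tailWt τ σ {0}) 1 ^ 2 := by
    rw [kerDen, ← ee_neg, ← ee_add, ← ee_add, ← ee_add, ← ee_add, ← ee_zero]
    ring_nf
  have hN : kerNum (qProd (wt1 τ σ)) (axisProd τ σ) z 0 (ee z) =
      (1 - ee (2 * z)) * (1 - ee (-(2 * z))) * (qProd (tailWt τ σ {0}) (ee (2 * z)) *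
      qProd (tailWt τ σ {0}) (ee (-(2 * z)))) * qProd (wt1 τ σ) 1 ^ 2 := by
    rw [kerNum, ← ee_neg, ← ee_add, ← ee_add, ← ee_add, ← ee_add, ← ee_nat_mul, ← ee_nat_mul]
    have := congrArg₂ (· * ·) (hax (ee (2 * z))) (hax (ee (-(2 * z))))
    rw [show (0 : ℂ) - z + -z = -(2 * z) by ring, show (0 : ℂ) - z + z = 0 by ring,
      show (0 : ℂ) + z + -z = 0 by ring, show (0 : ℂ) + z + z = 2 * z by ring,
      show ((2 : ℕ) : ℂ) * z = 2 * z by norm_num, show ((2 : ℕ) : ℂ) * -z = -(2 * z) by push_cast; ring, ee_zero]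
    linear_combination qProd (wt1 τ σ) 1 ^ 2 * this
  obtain ⟨h3, h4⟩ := hne _ h1
  obtain ⟨h5, h6⟩ := hne _ h2
  have es : ∀ u, ee u ^ 2 = ee (2 * u) := fun u => by
    rw [← ee_nat_mul]
    norm_num
  have e0 : ((0 : ℕ × ℕ) - 0) = 0 := rfl
  rw [contCoeff, pairCoeff, e0, hset, e1, e2, es, es, show (2 : ℂ) * -z = -(2 * z) by ring, hN,
    mul_zero, mul_zero, ee_zero]
  have hq1 := qProd_tailWt_zero_one hτ hσ
  have hq1' : qProd (tailWt τ σ {0}) 1 ≠ 0 := by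
    rw [hq1]
    exact mul_ne_zero (mul_ne_zero hp hq) hQ1
  rw [hD] at hden
  have hne' := mul_ne_zero (mul_ne_zero h4 h6) (pow_ne_zero 2 hq1')
  rw [hden] at hne'
  generalize (∏ i ∈ poleSet (S \ {0}), ((1 - poleVal τ σ z 0 i * ee z) *
    (1 - poleVal τ σ z 0 i / ee z))) = P at *
  generalize kerDen (qProd (tailWt τ σ S)) z 0 (ee z) = D at *
  have hP := left_ne_zero_of_mul hne'
  have hDD := right_ne_zero_of_mul hne'
  rw [hq1] at hden ⊢
  field_simp
  linear_combination hden

end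

/-! ### The continued operator as a finite sum -/

section degenerate

variable {τ η : ℂ}

/-- The set `S` is chosen before Φ, so the coefficients are the same for all test functions. This
uniformity lets them be determined later by testing. -/
theorem isMValue_sum (hτ : 0 < τ.im) (hη : 0 < η.im) (hgen : Generic τ η) {z : ℂ}
    (hz : OffLattice τ η (2 * z)) (n m : ℕ) : ∃ S : Finset (ℕ × ℕ), Finset.Iic (m, n) ⊆ S ∧
    ∀ Φ, IsTest Φ → IsMValue τ η (n * η + m * (τ / 2)) Φ z
      (∑ ij ∈ Finset.Iic (m, n), contCoeff τ (2 * η) S (m, n) z (n * η + m * (τ / 2)) ij *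
        Φ (z - (n * η + m * (τ / 2)) + (ij.1 * τ + ij.2 * (2 * η)))) := by
  have hσ : 0 < (2 * η).im := by simpa using hη
  set g₀ := n * η + m * (τ / 2) with hg₀
  obtain ⟨S, B, hS, hC⟩ := exists_isCut hτ hσ z (g₀.im + 1) (m, n)
  have hg₀im : 0 ≤ g₀.im := by
    have : g₀.im = n * η.im + m * (τ.im / 2) := by simp [hg₀]
    rw [this]
    positivity
  refine ⟨S, hS, fun Φ hΦ => ⟨g₀.im + 1, fun g => qPoch (2 * η) * qPoch τ / 2 *
    contM τ (2 * η) S (m, n) (IsTest.descend Φ) (B + 1) z g, lt_add_one _, ?_, ?_, ?_, ?_⟩⟩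
  · intro g hg
    exact (MeromorphicAt.const _ _).mul (meromorphicOn_contM hτ hσ (m, n) hC hΦ g hg)
  · intro g hg h1 h2 _
    exact (intM_eq_contM hτ hσ hgen hz ⟨_, hS (Finset.mem_Iic.2 le_rfl)⟩ (m, n) hC hg h1 h2 hΦ).symm
  · exact analyticAt_const.mul (analyticAt_contM hτ hσ hC (lt_add_one _) hg₀im
      (poleVal_injective hgen hz g₀) (fun i j h => paired_of_poleVal_mul hgen hz h) hΦ)
  · simp only
    rw [contM_eq_sum hτ hσ hS hC (lt_add_one _) (ee_mul_wt n m) hΦ, Finset.mul_sum, Finset.mul_sum]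
    refine Finset.sum_congr rfl fun ij _ => ?_
    rw [contCoeff, kerE]
    nth_rewrite 3 [poleVal_eq_ee]
    rw [hΦ.descend_ee]
    simp only [if_true]
    ring

end degenerate

/-! ### The recursion in the spin -/

section recursion

variable {τ η : ℂ}

/-- The kernel of `M(g)`. -/
noncomputable def gamKer (τ σ z g x : ℂ) : ℂ :=
  ellGamma τ σ (z + x - g) * ellGamma τ σ (z - x - g) *
    ellGamma τ σ (-z + x - g) * ellGamma τ σ (-z - x - g) /
  (ellGamma τ σ (-2 * g) * ellGamma τ σ (2 * x) * ellGamma τ σ (-2 * x))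

theorem intM_eq_gamKer (g : ℂ) (Φ : ℂ → ℂ) (z : ℂ) : intM τ η g Φ z =
    qPoch (2 * η) * qPoch τ / 2 * ∫ x in (0 : ℝ)..1, gamKer τ (2 * η) z g x * Φ x := rfl

theorem gamKer_neg (σ z g x : ℂ) : gamKer τ σ (-z) g x = gamKer τ σ z g x := by
  rw [gamKer, gamKer, neg_neg]
  ring

/-- Under z ↦ z+η, G ↦ G-η only the arguments z±x-G and -2G change, each by the full period 2η, so
the functional equation of Γ applies three times. -/
theorem gamKer_shift (hτ : 0 < τ.im) (hη : 0 < (2 * η).im) {z G x : ℂ} (h1 : 0 < (z + x - G).im)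
    (h2 : 0 < (z - x - G).im) (h3 : 0 < (-2 * G).im) :
    gamKer τ (2 * η) (z + η) (G - η) x = R τ * exp (2 * Real.pi * I * z) *
      (theta1 (z + x - G) τ * theta1 (z - x - G) τ / theta1 (-2 * G) τ) * gamKer τ (2 * η) z G x := by
  rw [gamKer, gamKer, show z + η + x - (G - η) = z + x - G + 2 * η by ring,
    show z + η - x - (G - η) = z - x - G + 2 * η by ring,
    show -(z + η) + x - (G - η) = -z + x - G by ring,
    show -(z + η) - x - (G - η) = -z - x - G by ring,
    show -2 * (G - η) = -2 * G + 2 * η by ring, ellGamma_add hτ hη h1, ellGamma_add hτ hη h2,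
    ellGamma_add hτ hη h3, thetaMul_eq _ hτ, thetaMul_eq _ hτ, thetaMul_eq _ hτ,
    show exp (2 * Real.pi * I * z) = exp (Real.pi * I * (z + x - G)) * exp (Real.pi * I * (z - x - G)) *
      (exp (Real.pi * I * (-2 * G)))⁻¹ by
      rw [← exp_neg, ← exp_add, ← exp_add]
      ring_nf]
  have hR : R τ * (R τ)⁻¹ = 1 := mul_inv_cancel₀ (R_ne_zero hτ)
  generalize exp (Real.pi * I * (z + x - G)) = E1
  generalize exp (Real.pi * I * (z - x - G)) = E2
  generalize exp (Real.pi * I * (-2 * G)) = E3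
  generalize theta1 (z + x - G) τ = t1
  generalize theta1 (z - x - G) τ = t2
  generalize theta1 (-2 * G) τ = t3
  generalize R τ = r at *
  simp only [div_eq_mul_inv, mul_inv]
  generalize ellGamma τ (2 * η) (z + x - G) = A
  generalize ellGamma τ (2 * η) (z - x - G) = B
  generalize ellGamma τ (2 * η) (-2 * G) = C
  generalize ellGamma τ (2 * η) (-z + x - G) = D
  generalize ellGamma τ (2 * η) (-z - x - G) = E
  generalize ellGamma τ (2 * η) (2 * x) = X
  generalize ellGamma τ (2 * η) (-2 * x) = Y
  linear_combination (r * E1 * t1 * A * E2 * t2 * B * D * E * E3⁻¹ * t3⁻¹ * C⁻¹ * X⁻¹ * Y⁻¹) * hR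

/-- The kernel is even in z, so the shift by -η follows from the one by η. The Gaussians reduce both
exponential factors to e^{-πiη}, and the bracket left over is `theta_kernel`. -/
theorem gamKer_recursion (hτ : 0 < τ.im) (hη : 0 < η.im) (k : Idx) {z G : ℂ} (x : ℝ)
    (hz : theta1 (2 * z) τ ≠ 0) (hG : theta1 (-2 * G) τ ≠ 0) (h1 : 0 < (-G + z).im)
    (h2 : 0 < (-G - z).im) :
    exp (Real.pi * I / η * z ^ 2) * (cA τ η / theta1 (2 * z) τ *
      (theta k (z + G) (τ / 2) * (exp (-(Real.pi * I / η) * (z + η) ^ 2) *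
        gamKer τ (2 * η) (z + η) (G - η) x) -
      theta k (z - G) (τ / 2) * (exp (-(Real.pi * I / η) * (z - η) ^ 2) *
        gamKer τ (2 * η) (z - η) (G - η) x))) = theta k x (τ / 2) * gamKer τ (2 * η) z G x := by
  have hσ : 0 < (2 * η).im := by simpa using hη
  have hη0 := ne_zero_of_im_pos hη
  simp only [add_im, sub_im, neg_im] at h1 h2
  have h3 : 0 < (-2 * G).im := by
    simp
    linarith
  have hp : gamKer τ (2 * η) (z + η) (G - η) x = _ :=
    gamKer_shift hτ hσ (by simp; linarith) (by simp; linarith) h3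
  have hm : gamKer τ (2 * η) (-z + η) (G - η) x = _ :=
    gamKer_shift hτ hσ (by simp; linarith) (by simp; linarith) h3
  rw [show z - η = -(-z + η) by ring, gamKer_neg, hm, gamKer_neg, hp]
  have e1 : exp (Real.pi * I / η * z ^ 2) * exp (-(Real.pi * I / η) * (z + η) ^ 2) *
      exp (2 * Real.pi * I * z) = exp (-(Real.pi * I * η)) := by
    rw [← exp_add, ← exp_add]
    congr 1
    field_simp
    ring
  have e2 : exp (Real.pi * I / η * z ^ 2) * exp (-(Real.pi * I / η) * (-(-z + η)) ^ 2) *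
      exp (2 * Real.pi * I * -z) = exp (-(Real.pi * I * η)) := by
    rw [← exp_add, ← exp_add]
    congr 1
    field_simp
    ring
  -- This is what fixes the constant c_A.
  have hc : cA τ η * exp (-(Real.pi * I * η)) * R τ = 1 := by
    rw [cA, exp_neg]
    have := R_ne_zero hτ
    have := exp_ne_zero (Real.pi * I * η)
    field_simp
  have hk := theta_kernel k z G x hτ
  calc _ = cA τ η / theta1 (2 * z) τ * R τ * gamKer τ (2 * η) z G x / theta1 (-2 * G) τ *
        (theta k (z + G) (τ / 2) * (exp (Real.pi * I / η * z ^ 2) *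
          exp (-(Real.pi * I / η) * (z + η) ^ 2) * exp (2 * Real.pi * I * z)) *
          (theta1 (z + x - G) τ * theta1 (z - x - G) τ) -
        theta k (z - G) (τ / 2) * (exp (Real.pi * I / η * z ^ 2) *
          exp (-(Real.pi * I / η) * (-(-z + η)) ^ 2) * exp (2 * Real.pi * I * -z)) *
          (theta1 (-z + x - G) τ * theta1 (-z - x - G) τ)) := by ring
    _ = (cA τ η * exp (-(Real.pi * I * η)) * R τ) / theta1 (2 * z) τ * gamKer τ (2 * η) z G x /
        theta1 (-2 * G) τ *
        (theta k (z + G) (τ / 2) * (theta1 (z + x - G) τ * theta1 (z - x - G) τ) -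
        theta k (z - G) (τ / 2) * (theta1 (-z + x - G) τ * theta1 (-z - x - G) τ)) := by
      rw [e1, e2]
      ring
    _ = _ := by
      rw [hk, hc]
      generalize theta1 (-2 * G) τ = t at *
      field_simp

theorem continuous_gamKer_mul (hτ : 0 < τ.im) (hη : 0 < (2 * η).im) {Φ : ℂ → ℂ} (hΦ : IsTest Φ)
    {z g : ℂ} (h1 : 0 < (-g + z).im) (h2 : 0 < (-g - z).im) :
    Continuous fun x : ℝ => gamKer τ (2 * η) z g x * Φ x := by
  have he : (fun x : ℝ => gamKer τ (2 * η) z g x * Φ x) = fun x : ℝ =>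
      qProd (wt τ (2 * η)) (ee (-2 * g)) / qProd (wt1 τ (2 * η)) (ee (2 * g)) *
      (kerNum (qProd (wt1 τ (2 * η))) (axisProd τ (2 * η)) z g (ee x) /
        kerDen (qProd (wt τ (2 * η))) z g (ee x) * IsTest.descend Φ (ee x)) :=
    funext fun x => integrand_eq hτ hη hΦ z g x
  rw [he]
  have hcts : Continuous fun x : ℝ => ((g, ee x) : ℂ × ℂ) :=
    continuous_const.prodMk (differentiable_ee.continuous.comp continuous_ofReal)
  refine continuous_const.mul (Continuous.mul (Continuous.div ?_ ?_ ?_) ?_)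
  · exact continuous_iff_continuousAt.2 fun x =>
      (differentiableAt_kerNum (differentiable_qProd (summable_wt1 hτ hη))
        (differentiable_axisProd hτ hη) z (p := (g, ee x)) (ee_ne_zero _)).continuousAt.comp
        (f := fun x : ℝ => ((g, ee x) : ℂ × ℂ)) hcts.continuousAt
  · exact continuous_iff_continuousAt.2 fun x =>
      (differentiableAt_kerDen (differentiable_qProd (summable_wt hτ hη)) z (p := (g, ee x))
        (ee_ne_zero _)).continuousAt.comp (f := fun x : ℝ => ((g, ee x) : ℂ × ℂ)) hcts.continuousAt
  · intro x
    have h : ∀ u : ℂ, 0 < u.im → ∀ Y : ℂ, ‖Y‖ = 1 → qProd (wt τ (2 * η)) (ee u * Y) ≠ 0 :=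
      fun u hu Y hY => qProd_wt_ne_zero hτ hη (by
        rw [norm_mul, hY, mul_one]
        exact norm_ee_lt_one hu)
    have hx : ‖ee x‖ = 1 := by rw [norm_ee]; simp
    have hx' : ‖(ee x)⁻¹‖ = 1 := by rw [norm_inv, hx, inv_one]
    have h1' : 0 < (z - g).im := by rwa [sub_eq_neg_add]
    have h2' : 0 < (-z - g).im := by rwa [neg_sub_left, neg_add, ← sub_eq_add_neg]
    exact mul_ne_zero (mul_ne_zero (h _ h1' _ hx) (h _ h1' _ hx'))
      (mul_ne_zero (h _ h2' _ hx) (h _ h2' _ hx'))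
  · exact continuous_iff_continuousAt.2 fun x =>
      ContinuousAt.comp (f := fun x : ℝ => ee x) (hΦ.differentiableAt_descend (ee_ne_zero _)).continuousAt
        (differentiable_ee.continuous.comp continuous_ofReal).continuousAt

theorem opA_intM (hτ : 0 < τ.im) (hη : 0 < η.im) (k : Idx) {Φ : ℂ → ℂ} (hΦ : IsTest Φ) {z G : ℂ}
    (hz : theta1 (2 * z) τ ≠ 0) (hG : theta1 (-2 * G) τ ≠ 0) (h1 : 0 < (-G + z).im)
    (h2 : 0 < (-G - z).im) :
    opA k τ η (G - η) (intM τ η (G - η) Φ) z =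
      intM τ η G (fun x => theta k x (τ / 2) * Φ x) z := by
  have hσ : 0 < (2 * η).im := by simpa using hη
  have hi : ∀ w, 0 < (-(G - η) + w).im → 0 < (-(G - η) - w).im →
      IntervalIntegrable (fun x : ℝ => gamKer τ (2 * η) w (G - η) x * Φ x) MeasureTheory.volume 0 1 :=
    fun w hw hw' => (continuous_gamKer_mul hτ hσ hΦ hw hw').intervalIntegrable _ _
  simp only [add_im, sub_im, neg_im] at h1 h2
  have hp := hi (z + η) (by simp; linarith) (by simp; linarith)
  have hm := hi (z - η) (by simp; linarith) (by simp; linarith)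
  set a := exp (Real.pi * I / η * z ^ 2) * (cA τ η / theta1 (2 * z) τ) with ha
  rw [opA_apply, intM_eq_gamKer, intM_eq_gamKer, intM_eq_gamKer,
    show z + (G - η) + η = z + G by ring, show z - (G - η) - η = z - G by ring]
  have key : ∀ x : ℝ, gamKer τ (2 * η) z G x * (theta k x (τ / 2) * Φ x) =
      a * theta k (z + G) (τ / 2) * exp (-(Real.pi * I / η) * (z + η) ^ 2) *
        (gamKer τ (2 * η) (z + η) (G - η) x * Φ x) -
      a * theta k (z - G) (τ / 2) * exp (-(Real.pi * I / η) * (z - η) ^ 2) *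
        (gamKer τ (2 * η) (z - η) (G - η) x * Φ x) := fun x => by
    have := gamKer_recursion hτ hη k x hz hG (by simpa using h1) (by simpa using h2)
    rw [ha]
    linear_combination (-Φ x) * this
  simp only [key]
  rw [intervalIntegral.integral_sub (hp.const_mul _) (hm.const_mul _),
    intervalIntegral.integral_const_mul, intervalIntegral.integral_const_mul, ha]
  ring

theorem IsTest.theta_mul (hτ : 0 < τ.im) (k : Idx) {Φ : ℂ → ℂ} (hΦ : IsTest Φ) :
    IsTest fun x => theta k x (τ / 2) * Φ x where
  holo := (differentiable_theta k (half_im_pos hτ)).mul hΦ.holo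
  periodic x := by rw [theta_add_one, hΦ.periodic]
  even x := by rw [theta_neg, hΦ.even]

/-- Identity theorem: infinite order of vanishing of the difference spreads over the connected
half-plane, and analyticity at the end point turns this into equality of values. -/
theorem eq_of_meromorphicOn {c : ℝ} {F F' : ℂ → ℂ} (hF : MeromorphicOn F {g | g.im < c})
    (hF' : MeromorphicOn F' {g | g.im < c}) {g₁ g₀ : ℂ} (hg₁ : g₁.im < c) (hg₀ : g₀.im < c)
    (h : ∀ᶠ g in nhds g₁, F g = F' g) (ha : AnalyticAt ℂ F g₀) (ha' : AnalyticAt ℂ F' g₀) :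
    F g₀ = F' g₀ := by
  have hD : MeromorphicOn (F - F') {g | g.im < c} := hF.sub hF'
  have hU : IsPreconnected {g : ℂ | g.im < c} := (convex_halfSpace_im_lt c).isPreconnected
  have h1 : meromorphicOrderAt (F - F') g₁ = ⊤ := meromorphicOrderAt_eq_top_iff.2
    (Filter.Eventually.filter_mono nhdsWithin_le_nhds (h.mono fun g hg => by simp [hg]))
  have h0 : meromorphicOrderAt (F - F') g₀ = ⊤ := by
    by_contra hne
    exact hD.meromorphicOrderAt_ne_top_of_isPreconnected hU hg₀ hg₁ hne h1
  have ht : Filter.Tendsto (F - F') (nhdsWithin g₀ {g₀}ᶜ) (nhds ((F - F') g₀)) :=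
    (ha.sub ha').continuousAt.tendsto.mono_left nhdsWithin_le_nhds
  have ht0 : Filter.Tendsto (F - F') (nhdsWithin g₀ {g₀}ᶜ) (nhds 0) :=
    tendsto_const_nhds.congr' ((meromorphicOrderAt_eq_top_iff.1 h0).mono fun g hg => hg.symm)
  exact sub_eq_zero.1 (tendsto_nhds_unique ht ht0)

/-- The points -Nη serve as base points for the identity theorem. A zero of Γ at 2Nη would be an
integer relation in which τ has a positive coefficient. -/
theorem eventually_ellGamma_ne_zero (hτ : 0 < τ.im) (hη : 0 < η.im) (hgen : Generic τ η) {N : ℕ}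
    (hN : 0 < N) : ∀ᶠ g in nhds (-(N * η)), ellGamma τ (2 * η) (-2 * g) ≠ 0 := by
  have hσ : 0 < (2 * η).im := by simpa using hη
  have him : 0 < (-2 * -(N * η)).im := by
    have : (0 : ℝ) < N := by exact_mod_cast hN
    simp
    positivity
  have hc : ContinuousAt (fun g => ellGamma τ (2 * η) (-2 * g)) (-(N * η)) := by
    simp only [ellGamma_eq]
    refine ContinuousAt.div ?_ ?_ (qProd_wt_ne_zero hτ hσ (norm_ee_lt_one him))
    · have := (differentiable_qProd (summable_wt1 hτ hσ)).continuous
      have := differentiable_ee.continuous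
      fun_prop
    · have := (differentiable_qProd (summable_wt hτ hσ)).continuous
      have := differentiable_ee.continuous
      fun_prop
  refine hc.eventually_ne (ellGamma_ne_zero hτ hσ him fun i j k h => ?_)
  obtain ⟨-, -, h3⟩ := hgen k (j + 1 - N) (i + 1) (by push_cast; linear_combination -h)
  omega

/-- Both sides of the recursion are meromorphic in the spin and agree where the integrals converge,
by `opA_intM`; hence they agree at g₀+η, where both are analytic. -/
theorem IsMValue.opA_eq (hτ : 0 < τ.im) (hη : 0 < η.im) (hgen : Generic τ η) (k : Idx) {Φ : ℂ → ℂ}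
    (hΦ : IsTest Φ) {z g₀ w : ℂ} (hz : OffLattice τ η (2 * z)) {f : ℂ → ℂ}
    (h₁ : IsMValue τ η g₀ Φ (z + η) (f (z + η))) (h₂ : IsMValue τ η g₀ Φ (z - η) (f (z - η)))
    (h : IsMValue τ η (g₀ + η) (fun x => theta k x (τ / 2) * Φ x) z w) :
    w = opA k τ η g₀ f z := by
  have hσ : 0 < (2 * η).im := by simpa using hη
  obtain ⟨c, F, hc, hF, hFi, hFa, rfl⟩ := h
  obtain ⟨c₁, F₁, hc₁, hF₁, hFi₁, hFa₁, hv₁⟩ := h₁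
  obtain ⟨c₂, F₂, hc₂, hF₂, hFi₂, hFa₂, hv₂⟩ := h₂
  set e : ℂ → ℂ := fun g => exp (Real.pi * I / η * z ^ 2) * (cA τ η / theta1 (2 * z) τ *
      (theta k (z + (g - η) + η) (τ / 2) * (exp (-(Real.pi * I / η) * (z + η) ^ 2) * F₁ (g - η)) -
        theta k (z - (g - η) - η) (τ / 2) * (exp (-(Real.pi * I / η) * (z - η) ^ 2) * F₂ (g - η))))
    with he
  have hθ := differentiable_theta k (half_im_pos hτ)
  have hθ₁ : ∀ g, AnalyticAt ℂ (fun g => theta k (z + (g - η) + η) (τ / 2)) g := fun g =>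
    (hθ.comp (f := fun g => z + (g - η) + η) (by fun_prop)).analyticAt g
  have hθ₂ : ∀ g, AnalyticAt ℂ (fun g => theta k (z - (g - η) - η) (τ / 2)) g := fun g =>
    (hθ.comp (f := fun g => z - (g - η) - η) (by fun_prop)).analyticAt g
  have hsub : ∀ g : ℂ, AnalyticAt ℂ (fun g => g - η) g := fun g => by fun_prop
  -- The continuations at z±η are used at g-η, so their half-planes move up by Im η.
  set c₀ := min c (min (c₁ + η.im) (c₂ + η.im)) with hc₀
  have hlt : ∀ g : ℂ, g.im < c₀ → g.im < c ∧ (g - η).im < c₁ ∧ (g - η).im < c₂ := fun g hg => by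
    rw [hc₀, lt_min_iff, lt_min_iff] at hg
    rw [sub_im]
    exact ⟨hg.1, by linarith, by linarith⟩
  have hg₀ : (g₀ + η).im < c₀ := by
    rw [hc₀, lt_min_iff, lt_min_iff, add_im]
    rw [add_im] at hc
    exact ⟨hc, by linarith, by linarith⟩
  have hem : MeromorphicOn e {g | g.im < c₀} := fun g hg => by
    have m₁ : MeromorphicAt (fun g => F₁ (g - η)) g :=
      MeromorphicAt.comp_analyticAt (f := F₁) (g := fun g => g - η) (hF₁ _ (hlt g hg).2.1) (hsub g)
    have m₂ : MeromorphicAt (fun g => F₂ (g - η)) g :=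
      MeromorphicAt.comp_analyticAt (f := F₂) (g := fun g => g - η) (hF₂ _ (hlt g hg).2.2) (hsub g)
    exact (MeromorphicAt.const _ _).mul ((MeromorphicAt.const _ _).mul
      (((hθ₁ g).meromorphicAt.mul ((MeromorphicAt.const _ _).mul m₁)).sub
        ((hθ₂ g).meromorphicAt.mul ((MeromorphicAt.const _ _).mul m₂))))
  have hea : AnalyticAt ℂ e (g₀ + η) := by
    have m₁ : AnalyticAt ℂ (fun g => F₁ (g - η)) (g₀ + η) :=
      AnalyticAt.fun_comp (g := F₁) (f := fun g => g - η) (by simpa using hFa₁) (hsub _)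
    have m₂ : AnalyticAt ℂ (fun g => F₂ (g - η)) (g₀ + η) :=
      AnalyticAt.fun_comp (g := F₂) (f := fun g => g - η) (by simpa using hFa₂) (hsub _)
    exact analyticAt_const.mul (analyticAt_const.mul
      (((hθ₁ _).mul (analyticAt_const.mul m₁)).sub ((hθ₂ _).mul (analyticAt_const.mul m₂))))
  -- Large N puts -Nη below c₀ and into the region where all three integrals represent the operator.
  obtain ⟨N, hN⟩ := exists_nat_gt ((|c₀| + |z.im|) / η.im)
  rw [div_lt_iff₀ hη] at hN
  have hN0 : 0 < N := by
    rcases Nat.eq_zero_or_pos N with h0 | h0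
    · rw [h0] at hN
      simp only [Nat.cast_zero, zero_mul] at hN
      linarith [abs_nonneg c₀, abs_nonneg z.im]
    · exact h0
  have hz1 := hz.theta1_ne_zero hτ
  have hb := neg_abs_le c₀
  have hb1 := neg_abs_le z.im
  have hb2 := le_abs_self z.im
  have hb3 := abs_nonneg z.im
  have hb4 := abs_nonneg c₀
  have o1 : ∀ᶠ g : ℂ in nhds (-(N * η)), g.im < c₀ := by
    refine continuous_im.continuousAt.eventually_lt continuousAt_const ?_
    simp
    linarith
  have o2 : ∀ᶠ g : ℂ in nhds (-(N * η)), 0 < (-g + z).im := by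
    refine ContinuousAt.eventually_lt continuousAt_const (by fun_prop) ?_
    simp
    linarith
  have o3 : ∀ᶠ g : ℂ in nhds (-(N * η)), 0 < (-g - z).im := by
    refine ContinuousAt.eventually_lt continuousAt_const (by fun_prop) ?_
    simp
    linarith
  have o4 := eventually_ellGamma_ne_zero hτ hη hgen hN0
  have o5 : ∀ᶠ g : ℂ in nhds (-(N * η)), ellGamma τ (2 * η) (-2 * (g - η)) ≠ 0 := by
    have := eventually_ellGamma_ne_zero hτ hη hgen (Nat.succ_pos N)
    have ht : Filter.Tendsto (fun g : ℂ => g - η) (nhds (-(N * η))) (nhds (-((N.succ : ℕ) * η))) := by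
      have : ContinuousAt (fun g : ℂ => g - η) (-(N * η)) := by fun_prop
      convert this.tendsto using 2
      push_cast
      ring
    exact ht.eventually this
  have hev : ∀ᶠ g in nhds (-(N * η)), F g = e g := by
    filter_upwards [o1, o2, o3, o4, o5] with g a1 a2 a3 a4 a5
    obtain ⟨b1, b2, b3⟩ := hlt g a1
    have him : 0 < (-2 * g).im := by
      simp at a2 a3 ⊢
      linarith
    -- Γ(-2(g-η)) is a multiple of θ₁(-2g), so nonvanishing of the former gives that of the latter.
    have hG : theta1 (-2 * g) τ ≠ 0 := fun h0 => a5 (by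
      rw [show -2 * (g - η) = -2 * g + 2 * η by ring, ellGamma_add hτ hσ him, thetaMul_eq _ hτ, h0]
      ring)
    simp only [add_im, sub_im, neg_im] at a2 a3
    rw [hFi g b1 (by simpa using a2) (by simpa using a3) a4, he]
    simp only
    rw [hFi₁ _ b2 (by simp; linarith) (by simp; linarith) a5,
      hFi₂ _ b3 (by simp; linarith) (by simp; linarith) a5,
      ← opA_intM hτ hη k hΦ hz1 hG (by simpa using a2) (by simpa using a3), opA_apply]
  have := eq_of_meromorphicOn (hF.mono_set fun g hg => (hlt g hg).1) hem (g₁ := -(N * η))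
    o1.self_of_nhds hg₀ hev hFa hea
  rw [this, he, opA_apply, ← hv₁, ← hv₂]
  simp only [add_sub_cancel_right]

end recursion

/-! ### Determination of the coefficients -/

section separation

theorem isTest_ee_add : IsTest fun x => ee x + ee (-x) where
  holo := differentiable_ee.add (differentiable_ee.comp (by fun_prop))
  periodic x := by
    have h : ee 1 = 1 := ee_eq_one_iff.2 ⟨1, by simp⟩
    rw [neg_add, ee_add, ee_add, ee_neg 1, h, inv_one, mul_one, mul_one]
  even x := by rw [neg_neg, add_comm]

theorem IsTest.sub_const {Φ : ℂ → ℂ} (h : IsTest Φ) (c : ℂ) : IsTest fun x => Φ x - c where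
  holo := h.holo.sub_const c
  periodic x := by rw [h.periodic]
  even x := by rw [h.even]

theorem IsTest.prod {ι : Type*} (s : Finset ι) {Φ : ι → ℂ → ℂ} (h : ∀ i, IsTest (Φ i)) :
    IsTest fun x => ∏ i ∈ s, Φ i x where
  holo := Differentiable.fun_finsetProd fun i _ => (h i).holo
  periodic x := Finset.prod_congr rfl fun i _ => (h i).periodic x
  even x := Finset.prod_congr rfl fun i _ => (h i).even x

theorem ee_add_ee_neg_eq {u v : ℂ} (h : ee u + ee (-u) = ee v + ee (-v)) :
    ee u = ee v ∨ ee u * ee v = 1 := by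
  rw [ee_neg, ee_neg] at h
  have hu := ee_ne_zero u
  have hv := ee_ne_zero v
  have : (ee u - ee v) * (ee u * ee v - 1) = 0 := by
    field_simp at h
    linear_combination h
  rcases mul_eq_zero.1 this with h0 | h0
  · exact Or.inl (sub_eq_zero.1 h0)
  · exact Or.inr (sub_eq_zero.1 h0)

/-- Test functions, multiplied by `θ₃` or `θ₄`, separate points. -/
theorem eq_of_sum_theta_mul_eq {τ : ℂ} (hτ : 0 < τ.im) {ι : Type*} [DecidableEq ι] {s : Finset ι}
    {x : ι → ℂ} (hx : ∀ i ∈ s, ∀ j ∈ s, ee (x i) + ee (-x i) = ee (x j) + ee (-x j) → i = j)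
    {C D : ι → ℂ} (h : ∀ k Φ, IsTest Φ → ∑ i ∈ s, C i * (theta k (x i) (τ / 2) * Φ (x i)) =
      ∑ i ∈ s, D i * (theta k (x i) (τ / 2) * Φ (x i))) {i : ι} (hi : i ∈ s) : C i = D i := by
  -- An interpolating test function in the variable X + 1/X: it vanishes at all the points but the
  -- i-th.
  set Φ : ℂ → ℂ := fun y => ∏ j ∈ s.erase i, (ee y + ee (-y) - (ee (x j) + ee (-x j))) with hΦ
  have ht : IsTest Φ := IsTest.prod _ fun j => isTest_ee_add.sub_const _
  have hne : Φ (x i) ≠ 0 := Finset.prod_ne_zero_iff.2 fun j hj h0 =>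
    (Finset.mem_erase.1 hj).1 (hx i hi j (Finset.mem_erase.1 hj).2 (sub_eq_zero.1 h0)).symm
  have hz : ∀ j ∈ s, j ≠ i → Φ (x j) = 0 := fun j hj hji =>
    Finset.prod_eq_zero (Finset.mem_erase.2 ⟨hji, hj⟩) (sub_self _)
  have key : ∀ k, C i * (theta k (x i) (τ / 2) * Φ (x i)) =
      D i * (theta k (x i) (τ / 2) * Φ (x i)) := fun k => by
    have := h k Φ ht
    rwa [Finset.sum_eq_single_of_mem i hi (fun j hj hji => by rw [hz j hj hji, mul_zero, mul_zero]),
      Finset.sum_eq_single_of_mem i hi (fun j hj hji => by rw [hz j hj hji, mul_zero, mul_zero])] at this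
  rcases theta3_ne_zero_or_theta4_ne_zero (half_im_pos hτ) (u := x i) with h3 | h4
  · exact mul_right_cancel₀ (mul_ne_zero h3 hne) (key Idx.three)
  · exact mul_right_cancel₀ (mul_ne_zero h4 hne) (key Idx.four)

end separation

/-! ### Induction on the spin -/

section induction

variable {τ η : ℂ}

/-- Both summation indices are reversed so that the shifts appear as the positions of the poles in
`isMValue_sum`. -/
theorem prodM_eq_sum_Iic (n m : ℕ) (f : ℂ → ℂ) (z : ℂ) : prodM τ η n m f z =
    ∑ ij ∈ Finset.Iic (m, n), prodCoeff τ η n m (n - ij.2) (m - ij.1) z *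
      f (z - (n * η + m * (τ / 2)) + (ij.1 * τ + ij.2 * (2 * η))) := by
  have hI : Finset.Iic (m, n) = Finset.range (m + 1) ×ˢ Finset.range (n + 1) := by
    ext ⟨i, j⟩
    simp
  rw [prodM_eq_sum, hI, Finset.sum_product, Finset.sum_comm, ← Finset.sum_flip]
  refine Finset.sum_congr rfl fun i hi => ?_
  rw [← Finset.sum_flip]
  refine Finset.sum_congr rfl fun j hj => ?_
  rw [Finset.mem_range, Nat.lt_succ_iff] at hi hj
  rw [Nat.cast_sub hi, Nat.cast_sub hj]
  congr 2
  ring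

theorem isMValue_prodM_zero (hτ : 0 < τ.im) (hη : 0 < η.im) (hgen : Generic τ η) {Φ : ℂ → ℂ}
    (hΦ : IsTest Φ) {z : ℂ} (hz : OffLattice τ η (2 * z)) :
    IsMValue τ η ((0 : ℕ) * η + (0 : ℕ) * (τ / 2)) Φ z (prodM τ η 0 0 Φ z) := by
  have hσ : 0 < (2 * η).im := by simpa using hη
  obtain ⟨S, hS, h⟩ := isMValue_sum hτ hη hgen hz 0 0
  have hI : Finset.Iic ((0, 0) : ℕ × ℕ) = {(0, 0)} := by
    ext ⟨i, j⟩
    simp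
  have hne : ∀ u, OffLattice τ η u → qProd (wt τ (2 * η)) (ee u) ≠ 0 := fun u hu =>
    qProd_ne_zero (summable_wt hτ hσ) fun ij h1 => by
      rw [wt, ← ee_add, ee_eq_one_iff] at h1
      obtain ⟨k, hk⟩ := h1
      exact hu k (-ij.2) (-ij.1) (by push_cast; linear_combination hk)
  have hneg : OffLattice τ η (-(2 * z)) := fun a b c h1 =>
    hz (-a) (-b) (-c) (by push_cast; linear_combination -h1)
  have hC := contCoeff_zero hτ hσ (hS (Finset.mem_Iic.2 le_rfl)) (hne _ hz) (hne _ hneg)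
  have := h Φ hΦ
  rw [hI, Finset.sum_singleton] at this
  rw [prodM_zero_left hτ 0 Φ hz, diffM_zero hσ Φ hz.swap]
  simp only [Nat.cast_zero, zero_mul, add_zero, sub_zero] at this ⊢
  change contCoeff τ (2 * η) S (0, 0) z 0 (0, 0) = 1 at hC
  rwa [hC, one_mul] at this

/-- At the new spin the value is a sum over known points with coefficients independent of Φ. On
functions θ_kΨ the continued recursion and `opA_prodM` yield the sum with the coefficients of
`prodM`; taking k = 3, 4 and all Ψ identifies them. -/
theorem isMValue_prodM_succ (hτ : 0 < τ.im) (hη : 0 < η.im) (hgen : Generic τ η) {n m : ℕ}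
    (ih : ∀ Φ, IsTest Φ → ∀ z, OffLattice τ η (2 * z) →
      IsMValue τ η (n * η + m * (τ / 2)) Φ z (prodM τ η n m Φ z))
    {Φ : ℂ → ℂ} (hΦ : IsTest Φ) {z : ℂ} (hz : OffLattice τ η (2 * z)) :
    IsMValue τ η ((n + 1 : ℕ) * η + m * (τ / 2)) Φ z (prodM τ η (n + 1) m Φ z) := by
  obtain ⟨S, hS, h⟩ := isMValue_sum hτ hη hgen hz (n + 1) m
  rw [prodM_eq_sum_Iic]
  convert h Φ hΦ using 1
  refine Finset.sum_congr rfl fun ij hij => ?_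
  congr 1
  symm
  refine eq_of_sum_theta_mul_eq hτ (s := Finset.Iic (m, n + 1))
    (x := fun ij : ℕ × ℕ => z - ((n + 1 : ℕ) * η + m * (τ / 2)) + (ij.1 * τ + ij.2 * (2 * η)))
    (C := contCoeff τ (2 * η) S (m, n + 1) z ((n + 1 : ℕ) * η + m * (τ / 2)))
    (D := fun ij => prodCoeff τ η (n + 1) m (n + 1 - ij.2) (m - ij.1) z) ?_ ?_ hij
  -- Equal values of X + 1/X mean X_i = X_j or X_i X_j = 1. The second would pair two poles with the
  -- same sign of z.
  · intro i _ j _ hxy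
    have hp : ∀ i : ℕ × ℕ, ee (z - ((n + 1 : ℕ) * η + m * (τ / 2)) + (i.1 * τ + i.2 * (2 * η))) =
        poleVal τ (2 * η) z ((n + 1 : ℕ) * η + m * (τ / 2)) (i, true) := fun i => by
      rw [poleVal_eq_ee]
      simp
    rcases ee_add_ee_neg_eq hxy with h1 | h1
    · rw [hp, hp] at h1
      exact congrArg Prod.fst (poleVal_injective hgen hz _ h1)
    · rw [hp, hp] at h1
      exact absurd rfl (paired_of_poleVal_mul hgen hz h1).2
  · intro k Ψ hΨ
    have h1 := ih Ψ hΨ (z + η) (hz.add 0 1 0 (by push_cast; ring))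
    have h2 := ih Ψ hΨ (z - η) (hz.add 0 (-1) 0 (by push_cast; ring))
    have h3 := h _ (hΨ.theta_mul hτ k)
    have e : ((n + 1 : ℕ) : ℂ) * η + m * (τ / 2) = n * η + m * (τ / 2) + η := by
      push_cast
      ring
    have hval := IsMValue.opA_eq hτ hη hgen k hΨ hz h1 h2 (by rw [← e]; exact h3)
    rw [opA_prodM hτ hη hgen k n m Ψ hz, prodM_eq_sum_Iic] at hval
    exact hval

theorem ellGamma_comm (τ σ u : ℂ) : ellGamma τ σ u = ellGamma σ τ u := by
  rw [ellGamma, ellGamma]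
  congr 1
  · rw [← (Equiv.prodComm ℕ ℕ).tprod_eq]
    exact tprod_congr fun ij => by
      rw [Equiv.prodComm_apply, Prod.fst_swap, Prod.snd_swap, mul_right_comm]
  · rw [← (Equiv.prodComm ℕ ℕ).tprod_eq]
    exact tprod_congr fun ij => by
      rw [Equiv.prodComm_apply, Prod.fst_swap, Prod.snd_swap, mul_right_comm]

/-- Γ and the normalization are symmetric in p and q, so results on the spin nη transfer to mτ/2. -/
theorem intM_swap (g : ℂ) (Φ : ℂ → ℂ) (z : ℂ) : intM (2 * η) (τ / 2) g Φ z = intM τ η g Φ z := by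
  rw [intM, intM, show 2 * (τ / 2) = τ by ring, mul_comm (qPoch τ)]
  simp only [ellGamma_comm (2 * η) τ]

theorem isMValue_swap {g₀ : ℂ} {Φ : ℂ → ℂ} {z v : ℂ} :
    IsMValue (2 * η) (τ / 2) g₀ Φ z v ↔ IsMValue τ η g₀ Φ z v := by
  simp only [IsMValue, intM_swap, show 2 * (τ / 2) = τ by ring, ellGamma_comm (2 * η) τ]

theorem isMValue_prodM_swap (hτ : 0 < τ.im) (hη : 0 < η.im) {n m : ℕ} {Φ : ℂ → ℂ} {z : ℂ} :
    IsMValue (2 * η) (τ / 2) (m * (τ / 2) + n * (2 * η / 2)) Φ z (prodM (2 * η) (τ / 2) m n Φ z) ↔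
      IsMValue τ η (n * η + m * (τ / 2)) Φ z (prodM τ η n m Φ z) := by
  rw [isMValue_swap, ← prodM'_eq_prodM_swap,
    prodM'_eq_prodM (ne_zero_of_im_pos hτ) (ne_zero_of_im_pos hη), show 2 * η / 2 = η by ring,
    add_comm ((m : ℂ) * (τ / 2))]

theorem isMValue_prodM (hτ : 0 < τ.im) (hη : 0 < η.im) (hgen : Generic τ η) (n m : ℕ) (Φ : ℂ → ℂ)
    (hΦ : IsTest Φ) (z : ℂ) (hz : OffLattice τ η (2 * z)) :
    IsMValue τ η (n * η + m * (τ / 2)) Φ z (prodM τ η n m Φ z) := by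
  induction m generalizing Φ z with
  | zero =>
    induction n generalizing Φ z with
    | zero => exact isMValue_prodM_zero hτ hη hgen hΦ hz
    | succ n ih => exact isMValue_prodM_succ hτ hη hgen ih hΦ hz
  | succ m ih =>
    -- Raising m is raising n for the exchanged moduli; equality of the two orders of the factors
    -- makes the exchanged operator the right one.
    rw [← isMValue_prodM_swap hτ hη]
    refine isMValue_prodM_succ (by simpa using hη) (half_im_pos hτ) hgen.swap (fun Ψ hΨ w hw => ?_)
      hΦ hz.swap
    rw [isMValue_prodM_swap hτ hη]
    refine ih Ψ hΨ w ?_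
    intro a b c h
    exact hw a c b (by linear_combination h)

end induction

end EllipticDouble

/-! ### The theorem -/

theorem mainTheorem4 (τ η : ℂ) (hτ : 0 < τ.im) (hη : 0 < η.im)
    (hind : LinearIndependent ℚ ![(1 : ℂ), 2 * η, τ]) (n m : ℕ) :
    -- the intertwining operator (continued integral operator) on test functions
    (∀ Φ : ℂ → ℂ, EllipticDouble.IsTest Φ → ∀ z : ℂ,
      (EllipticDouble.OffLattice τ η (2 * z) →
        EllipticDouble.IsMValue τ η (n * η) Φ z (EllipticDouble.diffM τ η n Φ z) ∧
        EllipticDouble.IsMValue τ η (m * (τ / 2)) Φ z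
          (EllipticDouble.diffM (2 * η) (τ / 2) m Φ z) ∧
        EllipticDouble.IsMValue τ η (n * η + m * (τ / 2)) Φ z
          (EllipticDouble.prodM τ η n m Φ z) ∧
        EllipticDouble.IsMValue τ η (n * η + m * (τ / 2)) Φ z
          (EllipticDouble.prodM' τ η n m Φ z)) ∧
      (EllipticDouble.OffLattice τ η (4 * z) → ∀ k : EllipticDouble.Idx,
        EllipticDouble.IsMValue τ η (n * η + m * (τ / 2)) Φ z
          (EllipticDouble.factM k τ η n m Φ z))) ∧
    -- identities between the difference operators, on arbitrary functions
    (∀ (k : EllipticDouble.Idx) (f : ℂ → ℂ) (z : ℂ), EllipticDouble.OffLattice τ η (4 * z) →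
      (EllipticDouble.gaussOp (-(Real.pi * Complex.I / η)) *
          EllipticDouble.factM k τ η n 0 *
          EllipticDouble.gaussOp (Real.pi * Complex.I / η)) f z =
        ∑ l ∈ Finset.range (n + 1),
          (-1) ^ l * EllipticDouble.alpha τ η n l z * f (z + ((n : ℂ) - 2 * l) * η) ∧
      (EllipticDouble.gaussOp (-(2 * Real.pi * Complex.I / τ)) *
          EllipticDouble.factM k τ η 0 m *
          EllipticDouble.gaussOp (2 * Real.pi * Complex.I / τ)) f z =
        ∑ l ∈ Finset.range (m + 1),
          (-1) ^ l * EllipticDouble.alpha (2 * η) (τ / 2) m l z *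
            f (z + ((m : ℂ) - 2 * l) * (τ / 2)) ∧
      EllipticDouble.factM k τ η n m f z = EllipticDouble.prodM τ η n m f z ∧
      EllipticDouble.factM k τ η n m f z = EllipticDouble.prodM' τ η n m f z) := by
  open EllipticDouble in
  have hgen : Generic τ η := generic_of_linearIndependent hind
  have hτ0 := ne_zero_of_im_pos hτ
  have hη0 := ne_zero_of_im_pos hη
  have hp' : prodM' τ η n m = prodM τ η n m := prodM'_eq_prodM hτ0 hη0 n m
  have htwo : ∀ z, OffLattice τ η (4 * z) → OffLattice τ η (2 * z) := fun z hz =>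
    OffLattice.of_two_mul (by rwa [← mul_assoc, show (2 : ℂ) * 2 = 4 by norm_num])
  have hcancel : ∀ (c w : ℂ) (f : ℂ → ℂ), exp (-c * w ^ 2) * gaussOp c f w = f w := fun c w f => by
    rw [gaussOp_apply, ← mul_assoc, ← exp_add, neg_mul, neg_add_cancel, exp_zero, one_mul]
  refine ⟨fun Φ hΦ z => ⟨fun hz => ⟨?_, ?_, isMValue_prodM hτ hη hgen n m Φ hΦ z hz, ?_⟩,
    fun hz k => ?_⟩, fun k f z hz => ⟨?_, ?_, factM_eq_prodM hτ hη hgen k n m f hz, ?_⟩⟩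
  · have := isMValue_prodM hτ hη hgen n 0 Φ hΦ z hz
    rwa [prodM_zero_right hη n Φ hz, Nat.cast_zero, zero_mul, add_zero] at this
  · have := isMValue_prodM hτ hη hgen 0 m Φ hΦ z hz
    rwa [prodM_zero_left hτ m Φ hz, Nat.cast_zero, zero_mul, zero_add] at this
  · rw [hp']
    exact isMValue_prodM hτ hη hgen n m Φ hΦ z hz
  · rw [factM_eq_prodM hτ hη hgen k n m Φ hz]
    exact isMValue_prodM hτ hη hgen n m Φ hΦ z (htwo z hz)
  · rw [op_mul_apply, op_mul_apply, gaussOp_apply, factM_eq_prodM hτ hη hgen k n 0 _ hz,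
      prodM_zero_right hη n _ (htwo z hz), diffM_apply, ← mul_assoc, ← exp_add, neg_mul, neg_add_cancel,
      exp_zero, one_mul]
    simp only [hcancel]
  · rw [op_mul_apply, op_mul_apply, gaussOp_apply, factM_eq_prodM hτ hη hgen k 0 m _ hz,
      prodM_zero_left hτ m _ (htwo z hz), diffM_apply,
      show (Real.pi * Complex.I / (τ / 2)) = 2 * Real.pi * Complex.I / τ by field_simp,
      ← mul_assoc, ← exp_add, neg_mul, neg_add_cancel, exp_zero, one_mul]
    simp only [hcancel]
  · rw [hp', factM_eq_prodM hτ hη hgen k n m f hz]
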